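/- Let $n,k\ge 1$, let $A_1,\dots,A_k$ be independent random $n\times n$ matrices with i.i.d. standard complex Gaussian entries (each entry has density $\pi^{-1}e^{-|z|^2}$ with respect to Lebesgue measure on $\mathbb{C}$), let $\epsilon_1,\dots,\epsilon_k\in\{+1,-1\}$, and put $A=A_1^{\epsilon_1}A_2^{\epsilon_2}\cdots A_k^{\epsilon_k}$ (which is almost surely well defined). Then the following hold. 1. There is a measurable weight function $\omega:\mathbb{C}\to[0,\infty)$ such that the measure $\omega(z)\,|dz|^2$ is the push-forward of the measure $$e^{-\sum_{j=1}^k|x_j|^2}\prod_{j=1}^k|x_j|^{(1-\epsilon_j)(n-1)}\,\prod_{j=1}^k|dx_j|^2$$ on $\mathbb{C}^k$ under the map $(x_1,\dots,x_k)\mapsto x_1^{\epsilon_1}\cdots x_k^{\epsilon_k}$, where $|dz|^2$ denotes Lebesgue measure on $\mathbb{C}$; it is unique up to Lebesgue-null sets. 2. For every such $\omega$, the vector of eigenvalues of $A$ (with algebraic multiplicities, listed in uniformly random order) has a density with respect to Lebesgue measure on $\mathbb{C}^n$, and this density equals $$C\prod_{\ell=1}^n\omega(z_\ell)\prod_{1\le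 i<j\le n}|z_i-z_j|^2$$ for some constant $C>0$. 3. The eigenvalues of $A$ form a determinantal point process on $\mathbb{C}$: almost surely they are distinct, and there is a measurable kernel $K:\mathbb{C}^2\to\mathbb{C}$ with $K(y,x)=\overline{K(x,y)}$ such that, for every $m\ge 1$, the $m$-point joint intensity (correlation function) of the eigenvalues with respect to Lebesgue measure is $\rho_m(x_1,\dots,x_m)=\det\big(K(x_i,x_j)\big)_{i,j=1}^m$; that is, $\mathbb{E}\prod_{i=1}^m\#\{\text{eigenvalues in }D_i\}=\int_{D_1\times\cdots\times D_m}\rho_m$ for all pairwise disjoint Borel sets $D_1,\dots,D_m\subset\mathbb{C}$. -/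

import Mathlib

open MeasureTheory ProbabilityTheory
open scoped ENNReal NNReal Nat

noncomputable section

/-- The standard complex Gaussian distribution: density `π⁻¹ exp (-|z|²)` with respect to
Lebesgue measure on `ℂ`. -/
def stdComplexGaussian : Measure ℂ :=
  volume.withDensity fun z => ENNReal.ofReal (Real.pi⁻¹ * Real.exp (-‖z‖ ^ 2))

/-- The entries of all the random matrices `A 0, …, A (k-1)` are mutually independent standard
complex Gaussian random variables; equivalently, the matrices are independent and each of them
has i.i.d. standard complex Gaussian entries. -/
structure IsIndepGinibre {Ω : Type*} [MeasurableSpace Ω] (P : Measure Ω) {n k : ℕ}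
    (A : Fin k → Ω → Matrix (Fin n) (Fin n) ℂ) : Prop where
  law : ∀ i a b, HasLaw (fun ω => A i ω a b) stdComplexGaussian P
  indep : iIndepFun (fun (p : Fin k × Fin n × Fin n) (ω : Ω) => A p.1 ω p.2.1 p.2.2) P

/-- The ordered product `A₁^ε₁ A₂^ε₂ ⋯ A_k^ε_k`. -/
def signedProduct {n k : ℕ} (ε : Fin k → ℤ) (A : Fin k → Matrix (Fin n) (Fin n) ℂ) :
    Matrix (Fin n) (Fin n) ℂ :=
  (List.ofFn fun i => A i ^ ε i).prod

/-- The multiset of eigenvalues of a complex matrix, with algebraic multiplicities. -/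
def eigenvalueMultiset {n : ℕ} (M : Matrix (Fin n) (Fin n) ℂ) : Multiset ℂ :=
  M.charpoly.roots

/-- Some enumeration of the `n` eigenvalues (with multiplicities) of an `n × n` matrix.
(The default value `0` is never used, as there are exactly `n` eigenvalues.) -/
def eigenvalueVector {n : ℕ} (M : Matrix (Fin n) (Fin n) ℂ) : Fin n → ℂ :=
  fun i => (eigenvalueMultiset M).toList.getD i 0

/-- The law of the eigenvalues of a fixed matrix listed in uniformly random order. It does not
depend on the enumeration of the eigenvalues that is used to write it down. -/
def uniformOrderingLaw {n : ℕ} (M : Matrix (Fin n) (Fin n) ℂ) : Measure (Fin n → ℂ) :=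
  ((n ! : ℝ≥0∞)⁻¹) •
    ∑ σ : Equiv.Perm (Fin n), Measure.dirac (fun i => eigenvalueVector M (σ i))

/-- The random matrix `M` has joint eigenvalue density `f`: its vector of eigenvalues, listed in
uniformly random order, has density `f` with respect to Lebesgue measure on `ℂⁿ`. -/
def HasEigenvalueDensity {Ω : Type*} [MeasurableSpace Ω] (P : Measure Ω) {n : ℕ}
    (M : Ω → Matrix (Fin n) (Fin n) ℂ) (f : (Fin n → ℂ) → ℝ) : Prop :=
  AEMeasurable (fun ω => uniformOrderingLaw (M ω)) P ∧
    P.bind (fun ω => uniformOrderingLaw (M ω)) =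
      (volume : Measure (Fin n → ℂ)).withDensity fun z => ENNReal.ofReal (f z)

/-- `w` is the weight function: `w(z) |dz|²` is the push-forward of
`exp (-∑ |x_j|²) ∏ |x_j|^((1 - ε_j)(n - 1)) ∏ |dx_j|²` under `x ↦ ∏ x_j^ε_j`. -/
structure IsWeight (n : ℕ) {k : ℕ} (ε : Fin k → ℤ) (w : ℂ → ℝ) : Prop where
  measurable : Measurable w
  nonneg : ∀ z, 0 ≤ w z
  pushforward :
    (volume : Measure ℂ).withDensity (fun z => ENNReal.ofReal (w z)) =
      Measure.map (fun x : Fin k → ℂ => ∏ j, x j ^ ε j)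
        ((volume : Measure (Fin k → ℂ)).withDensity fun x =>
          ENNReal.ofReal (Real.exp (-∑ j, ‖x j‖ ^ 2) *
            ∏ j, ‖x j‖ ^ ((1 - ε j) * ((n : ℤ) - 1))))

open Classical in
/-- The number of points of the finite configuration `s` that lie in `D`. -/
def pointCount (s : Multiset ℂ) (D : Set ℂ) : ℕ :=
  s.countP (· ∈ D)

/-- `ρ` is the `m`-point joint intensity (correlation function), with respect to Lebesgue measure,
of the random configuration `X`. -/
def IsJointIntensity {Ω : Type*} [MeasurableSpace Ω] (P : Measure Ω) (X : Ω → Multiset ℂ)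
    {m : ℕ} (ρ : (Fin m → ℂ) → ℝ≥0) : Prop :=
  Measurable ρ ∧
    ∀ D : Fin m → Set ℂ, (∀ i, MeasurableSet (D i)) → (Pairwise fun i j => Disjoint (D i) (D j)) →
      ∫⁻ ω, ∏ i, (pointCount (X ω) (D i) : ℝ≥0∞) ∂P =
        ∫⁻ x in Set.pi Set.univ D, (ρ x : ℝ≥0∞)

/-- The random finite configuration `X` is a determinantal point process in the plane with
(Hermitian) kernel `K` with respect to Lebesgue measure: it is a simple point process and its
joint intensities are `ρ_m(x₁, …, x_m) = det (K(x_i, x_j))` for every `m`. -/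
structure IsDeterminantalPointProcess {Ω : Type*} [MeasurableSpace Ω] (P : Measure Ω)
    (X : Ω → Multiset ℂ) (K : ℂ → ℂ → ℂ) : Prop where
  aemeasurable_count : ∀ D, MeasurableSet D → AEMeasurable (fun ω => pointCount (X ω) D) P
  simple : ∀ᵐ ω ∂P, (X ω).Nodup
  measurable_kernel : Measurable (Function.uncurry K)
  hermitian : ∀ x y, K y x = starRingEnd ℂ (K x y)
  intensity : ∀ m : ℕ, ∃ ρ : (Fin m → ℂ) → ℝ≥0, IsJointIntensity P X ρ ∧
    ∀ x, (Matrix.of fun i j => K (x i) (x j)).det = ((ρ x : ℝ) : ℂ)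

end

/-! The argument is a change of variables modelled on the generalized Schur decomposition, with
unipotent lower triangular matrices in place of unitary ones. With indices taken cyclically, almost
every family can be written so that `A_j ^ ε_j = L_j * R_j ^ ε_j * L_{j+1}⁻¹`, with `L_j` unipotent
lower and `R_j` upper triangular. The product telescopes to a conjugate of an upper triangular
matrix, so its eigenvalues are the diagonal products `z_a = ∏ j, (R_j)_{aa} ^ ε_j`. Ordering the
`z_a` lexicographically makes the parametrization `assemble` injective (`injOn_assemble`), and its
image is conull (`ae_mem_image_assemble`).

Because inverses of unipotent matrices are adjugates, `assemble` is polynomial, and its real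
Jacobian is the squared modulus of a complex determinant. In a moving frame the derivative becomes
block triangular, with one cyclic bidiagonal block for each position below the diagonal. The block
at `(a, b)` contributes `z_b - z_a` times a monomial in diagonal entries for each `j` with `ε_j =
-1`. This produces the squared Vandermonde factor and the powers `|x_j| ^ ((1 - ε_j)(n - 1))`
(`abs_det_fderiv_assemble`).

The price of using non-unitary `L_j` is that the Gaussian weight depends on them. Writing `L_j = U_j
* S_j` with `U_j` unitary and `S_j` upper triangular, the `U_j` drop out of the Frobenius norm, and
the `S_j` are absorbed by a linear substitution in the `R_j` that keeps every `z_a` and rescales the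
Jacobian by a constant. Hence the lower triangular variables contribute only a constant factor
(`exists_lintegral_upper`), whose finiteness is read off from the finite total Gaussian mass
(`exists_lintegral_schurWeight`). The strictly upper entries integrate to another constant, and the
diagonal entries push forward to `n` copies of the weight measure (`lintegral_schurWeight`).
Symmetrizing over orderings gives the density.

For the determinantal structure, the weight is rotation invariant and has finite moments of degree
`2l` for `l < n`, so the monomials `z ^ l` are orthogonal for it. The density is a constant times
`det K(z_i, z_j)` for the associated rank-`n` projection kernel, and the reproducing property allows
points to be integrated out one at a time (`IsOrthonormalSystem.integral_det`). -/

/-! ### Triangular matrices, LU and QR factorizations, Frobenius norm. -/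

section TriangularMatrices

variable {n : ℕ}

theorem Matrix.BlockTriangular.mul_apply_diag {m α R : Type*} [Fintype m] [LinearOrder α]
    [NonUnitalNonAssocSemiring R] {M N : Matrix m m R} {b : m → α} (hM : M.BlockTriangular b)
    (hN : N.BlockTriangular b) (hb : Function.Injective b) (i : m) :
    (M * N) i i = M i i * N i i := by
  rw [Matrix.mul_apply, Finset.sum_eq_single i _ (by simp)]
  intro c _ hc
  rcases lt_trichotomy (b c) (b i) with h | h | h
  · rw [hM h, zero_mul]
  · exact absurd (hb h) hc
  · rw [hN h, mul_zero]

theorem Matrix.BlockTriangular.inv_of_isUnit {m α : Type*} [Fintype m] [DecidableEq m]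
    [LinearOrder α] {M : Matrix m m ℂ} {b : m → α} (hM : M.BlockTriangular b)
    (hd : IsUnit M.det) : M⁻¹.BlockTriangular b := by
  have := M.invertibleOfIsUnitDet hd
  exact Matrix.blockTriangular_inv_of_blockTriangular hM

theorem Matrix.BlockTriangular.inv_apply_diag {m α : Type*} [Fintype m] [DecidableEq m]
    [LinearOrder α] {M : Matrix m m ℂ} {b : m → α} (hM : M.BlockTriangular b)
    (hd : IsUnit M.det) (hb : Function.Injective b) (i : m) : M⁻¹ i i = (M i i)⁻¹ := by
  have h := hM.mul_apply_diag (hM.inv_of_isUnit hd) hb i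
  rw [Matrix.mul_nonsing_inv _ hd, Matrix.one_apply_eq] at h
  exact eq_inv_of_mul_eq_one_right h.symm

/-- Lower triangular matrices with ones on the diagonal. -/
structure IsUnipotentLower (L : Matrix (Fin n) (Fin n) ℂ) : Prop where
  apply_of_lt : ∀ a b, a < b → L a b = 0
  apply_diag : ∀ a, L a a = 1

namespace IsUnipotentLower

variable {L M : Matrix (Fin n) (Fin n) ℂ}

theorem isLowerTriangular (hL : IsUnipotentLower L) : L.IsLowerTriangular :=
  fun a b h => hL.apply_of_lt a b h

theorem det (hL : IsUnipotentLower L) : L.det = 1 := by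
  rw [Matrix.det_of_isLowerTriangular L hL.isLowerTriangular]
  exact Finset.prod_eq_one fun a _ => hL.apply_diag a

theorem isUnit_det (hL : IsUnipotentLower L) : IsUnit L.det := by
  rw [hL.det]; exact isUnit_one

theorem mul (hL : IsUnipotentLower L) (hM : IsUnipotentLower M) : IsUnipotentLower (L * M) where
  apply_of_lt a b h := hL.isLowerTriangular.mul hM.isLowerTriangular h
  apply_diag a := by
    rw [hL.isLowerTriangular.mul_apply_diag hM.isLowerTriangular OrderDual.toDual.injective,
      hL.apply_diag, hM.apply_diag, one_mul]

theorem inv (hL : IsUnipotentLower L) : IsUnipotentLower L⁻¹ where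
  apply_of_lt a b h := hL.isLowerTriangular.inv_of_isUnit hL.isUnit_det h
  apply_diag a := by
    rw [hL.isLowerTriangular.inv_apply_diag hL.isUnit_det OrderDual.toDual.injective,
      hL.apply_diag, inv_one]

end IsUnipotentLower

theorem Matrix.IsUpperTriangular.isUnit_det {R : Matrix (Fin n) (Fin n) ℂ}
    (hR : R.IsUpperTriangular) (hd : ∀ a, R a a ≠ 0) : IsUnit R.det := by
  rw [Matrix.det_of_isUpperTriangular hR]
  exact (Finset.prod_ne_zero_iff.2 fun a _ => hd a).isUnit

theorem Matrix.IsUpperTriangular.diag_ne_zero {R : Matrix (Fin n) (Fin n) ℂ}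
    (hR : R.IsUpperTriangular) (hd : IsUnit R.det) (a : Fin n) : R a a ≠ 0 := by
  rw [Matrix.det_of_isUpperTriangular hR] at hd
  exact Finset.prod_ne_zero_iff.1 hd.ne_zero a (Finset.mem_univ _)

theorem Matrix.zpow_sign {ε : ℤ} (hε : ε = 1 ∨ ε = -1) (M : Matrix (Fin n) (Fin n) ℂ) :
    (ε = 1 ∧ M ^ ε = M) ∨ (ε = -1 ∧ M ^ ε = M⁻¹) := by
  rcases hε with rfl | rfl
  · left; simp
  · right; simp

theorem Matrix.IsUpperTriangular.zpow_sign {R : Matrix (Fin n) (Fin n) ℂ}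
    (hR : R.IsUpperTriangular) (hd : ∀ a, R a a ≠ 0) {ε : ℤ} (hε : ε = 1 ∨ ε = -1) :
    (R ^ ε).IsUpperTriangular ∧ ∀ a, (R ^ ε) a a = R a a ^ ε := by
  rcases Matrix.zpow_sign hε R with ⟨rfl, h⟩ | ⟨rfl, h⟩
  · rw [h]; exact ⟨hR, fun a => by simp⟩
  · rw [h]
    refine ⟨hR.inv_of_isUnit (hR.isUnit_det hd), fun a => ?_⟩
    rw [hR.inv_apply_diag (hR.isUnit_det hd) Function.injective_id, _root_.zpow_neg_one]

theorem List.prod_ofFn_isUpperTriangular {k : ℕ} (B : Fin k → Matrix (Fin n) (Fin n) ℂ)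
    (hB : ∀ i, (B i).IsUpperTriangular) :
    (List.ofFn B).prod.IsUpperTriangular ∧ ∀ a, (List.ofFn B).prod a a = ∏ i, B i a a := by
  induction k with
  | zero => simpa using Matrix.blockTriangular_one
  | succ k ih =>
    obtain ⟨h1, h2⟩ := ih (fun i => B i.succ) fun i => hB _
    rw [List.ofFn_succ, List.prod_cons]
    refine ⟨(hB 0).mul h1, fun a => ?_⟩
    rw [(hB 0).mul_apply_diag h1 Function.injective_id, h2, Fin.prod_univ_succ]

/-- The inner frames cancel in neighbouring pairs. Indexing `F` by `ℕ` leaves the two end frames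
independent; they are identified only later, when the indices become cyclic. -/
theorem List.prod_ofFn_conj {k : ℕ} (F : ℕ → Matrix (Fin n) (Fin n) ℂ)
    (hF : ∀ i, IsUnit (F i).det) (B : Fin k → Matrix (Fin n) (Fin n) ℂ) :
    (List.ofFn fun i : Fin k => F i * B i * (F (i + 1))⁻¹).prod =
      F 0 * (List.ofFn B).prod * (F k)⁻¹ := by
  induction k generalizing F with
  | zero => simp [Matrix.mul_nonsing_inv _ (hF 0)]
  | succ k ih =>
    have h := ih (fun i => F (i + 1)) (fun i => hF _) fun i => B i.succ
    rw [List.ofFn_succ, List.ofFn_succ, List.prod_cons, List.prod_cons]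
    simp only [Fin.val_succ, Fin.val_zero, zero_add] at h ⊢
    rw [h]
    simp only [Matrix.mul_assoc]
    rw [Matrix.nonsing_inv_mul_cancel_left _ _ (hF 1)]

/-- Gaussian elimination row by row: the multipliers that clear the entries of row `a` left of the
diagonal solve a linear system whose matrix is the leading principal block of size `a`. -/
theorem Matrix.exists_unipotentLower_mul_upper (A : Matrix (Fin n) (Fin n) ℂ)
    (hA : ∀ a : Fin n, IsUnit (A.toSquareBlockProp (fun c => c < a)).det) :
    ∃ L R : Matrix (Fin n) (Fin n) ℂ, IsUnipotentLower L ∧ R.IsUpperTriangular ∧ A = L * R := by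
  classical
  have hx : ∀ a : Fin n, ∃ x : {c // c < a} → ℂ,
      Matrix.vecMul x (A.toSquareBlockProp (fun c => c < a)) = fun b : {c // c < a} => - A a b := by
    intro a
    refine ⟨Matrix.vecMul (fun b : {c // c < a} => - A a b) (A.toSquareBlockProp (fun c => c < a))⁻¹, ?_⟩
    rw [Matrix.vecMul_vecMul, Matrix.nonsing_inv_mul _ (hA a), Matrix.vecMul_one]
  choose x hx using hx
  let L' : Matrix (Fin n) (Fin n) ℂ :=
    Matrix.of fun a c => if h : c < a then x a ⟨c, h⟩ else if c = a then 1 else 0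
  have hL' : IsUnipotentLower L' :=
    ⟨fun a b h => by simp [L', h.not_gt, h.ne'], fun a => by simp [L']⟩
  refine ⟨L'⁻¹, L' * A, hL'.inv, ?_, ?_⟩
  · intro a b hab
    have hab' : b < a := hab
    have h := congrFun (hx a) ⟨b, hab'⟩
    simp only [Matrix.vecMul, dotProduct, Matrix.toSquareBlockProp_def, Matrix.of_apply] at h
    rw [Matrix.mul_apply, ← Finset.sum_filter_add_sum_filter_not _ (fun c => c < a)]
    have h1 : ∑ c with c < a, L' a c * A c b = - A a b := by
      rw [← h, Finset.sum_subtype (p := fun c => c < a) _ (by simp)]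
      refine Finset.sum_congr rfl fun c _ => ?_
      simp [L', c.2]
    have h2 : ∑ c with ¬ c < a, L' a c * A c b = A a b := by
      rw [Finset.sum_eq_single a]
      · simp [L']
      · intro c hc hca
        have : ¬ c < a := (Finset.mem_filter.1 hc).2
        simp [L', this, hca]
      · simp
    rw [h1, h2, neg_add_cancel]
  · rw [Matrix.nonsing_inv_mul_cancel_left _ _ hL'.isUnit_det]

theorem Matrix.exists_unitary_mul_upper (F : Matrix (Fin n) (Fin n) ℂ) :
    ∃ U S : Matrix (Fin n) (Fin n) ℂ,
      U ∈ Matrix.unitaryGroup (Fin n) ℂ ∧ S.IsUpperTriangular ∧ F = U * S := by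
  let f : Fin n → EuclideanSpace ℂ (Fin n) := fun j => WithLp.toLp 2 fun i => F i j
  have h : Module.finrank ℂ (EuclideanSpace ℂ (Fin n)) = Fintype.card (Fin n) := by simp
  let b := InnerProductSpace.gramSchmidtOrthonormalBasis h f
  let e := EuclideanSpace.basisFun (Fin n) ℂ
  refine ⟨e.toBasis.toMatrix b, b.toBasis.toMatrix f,
    e.toMatrix_orthonormalBasis_mem_unitary b,
    InnerProductSpace.gramSchmidtOrthonormalBasis_inv_isUpperTriangular h f, ?_⟩
  have h2 := e.toBasis.toMatrix_mul_toMatrix b.toBasis f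
  rw [b.coe_toBasis] at h2
  rw [h2]
  ext i j
  simp [Module.Basis.toMatrix_apply, e, f]

/-- The squared Frobenius norm of a matrix. -/
noncomputable def frobeniusSq (M : Matrix (Fin n) (Fin n) ℂ) : ℝ := ∑ a, ∑ b, ‖M a b‖ ^ 2

theorem frobeniusSq_eq_trace (M : Matrix (Fin n) (Fin n) ℂ) :
    (frobeniusSq M : ℂ) = (M.conjTranspose * M).trace := by
  simp only [frobeniusSq, Matrix.trace, Matrix.diag, Matrix.mul_apply, Matrix.conjTranspose_apply]
  rw [Finset.sum_comm]
  push_cast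
  refine Finset.sum_congr rfl fun a _ => Finset.sum_congr rfl fun b _ => ?_
  rw [← Complex.conj_mul']
  rfl

/-- This invariance is what lets unitary factors disappear from the Gaussian weight. -/
theorem frobeniusSq_unitary_mul_mul {U V : Matrix (Fin n) (Fin n) ℂ}
    (hU : U ∈ Matrix.unitaryGroup (Fin n) ℂ) (hV : V ∈ Matrix.unitaryGroup (Fin n) ℂ)
    (M : Matrix (Fin n) (Fin n) ℂ) : frobeniusSq (U * M * V) = frobeniusSq M := by
  have h : (frobeniusSq (U * M * V) : ℂ) = frobeniusSq M := by
    rw [frobeniusSq_eq_trace, frobeniusSq_eq_trace, Matrix.conjTranspose_mul,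
      Matrix.conjTranspose_mul]
    have h1 : V.conjTranspose * (M.conjTranspose * U.conjTranspose) * (U * M * V) =
        V.conjTranspose * (M.conjTranspose * ((U.conjTranspose * U) * (M * V))) := by
      simp only [Matrix.mul_assoc]
    have h2 : U.conjTranspose * U = 1 := (Matrix.mem_unitaryGroup_iff'.1 hU)
    have h3 : V * V.conjTranspose = 1 := (Matrix.mem_unitaryGroup_iff.1 hV)
    rw [h1, h2, Matrix.one_mul, ← Matrix.mul_assoc M.conjTranspose, Matrix.trace_mul_comm,
      Matrix.mul_assoc, h3, Matrix.mul_one]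
  exact_mod_cast h

end TriangularMatrices

/-! ### Coordinates for families of matrices. -/

section Blocks

variable {n k : ℕ}

/-- The `j`-th matrix in a family of matrices given by the list of all entries. -/
def block (X : Fin k × Fin n × Fin n → ℂ) (j : Fin k) : Matrix (Fin n) (Fin n) ℂ :=
  Matrix.of fun a b => X (j, a, b)

/-- The list of all entries of a family of matrices. -/
def unblock (A : Fin k → Matrix (Fin n) (Fin n) ℂ) : Fin k × Fin n × Fin n → ℂ :=
  fun i => A i.1 i.2.1 i.2.2

@[simp] theorem block_unblock (A : Fin k → Matrix (Fin n) (Fin n) ℂ) : block (unblock A) = A := rfl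

@[simp] theorem unblock_block (X : Fin k × Fin n × Fin n → ℂ) : unblock (block X) = X := rfl

theorem block_apply (X : Fin k × Fin n × Fin n → ℂ) (j : Fin k) (a b : Fin n) :
    block X j a b = X (j, a, b) := rfl

theorem unblock_injective : Function.Injective
    (unblock : (Fin k → Matrix (Fin n) (Fin n) ℂ) → Fin k × Fin n × Fin n → ℂ) :=
  Function.LeftInverse.injective block_unblock

/-- The unipotent lower triangular matrix with the same strictly lower triangular part. -/
def unipotentPart (B : Matrix (Fin n) (Fin n) ℂ) : Matrix (Fin n) (Fin n) ℂ :=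
  Matrix.of fun a b => if b < a then B a b else if a = b then 1 else 0

/-- The upper triangular part of a matrix. -/
def upperPart (B : Matrix (Fin n) (Fin n) ℂ) : Matrix (Fin n) (Fin n) ℂ :=
  Matrix.of fun a b => if b < a then 0 else B a b

theorem isUnipotentLower_unipotentPart (B : Matrix (Fin n) (Fin n) ℂ) :
    IsUnipotentLower (unipotentPart B) :=
  ⟨fun a b h => by simp [unipotentPart, h.not_gt, h.ne], fun a => by simp [unipotentPart]⟩

theorem isUpperTriangular_upperPart (B : Matrix (Fin n) (Fin n) ℂ) :
    (upperPart B).IsUpperTriangular := fun a b h => by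
  have h' : b < a := h
  simp [upperPart, h']

theorem upperPart_apply_diag (B : Matrix (Fin n) (Fin n) ℂ) (a : Fin n) :
    upperPart B a a = B a a := by simp [upperPart]

theorem exists_parts_eq {L R : Matrix (Fin n) (Fin n) ℂ} (hL : IsUnipotentLower L)
    (hR : R.IsUpperTriangular) : ∃ B, unipotentPart B = L ∧ upperPart B = R := by
  refine ⟨Matrix.of fun a b => if b < a then L a b else R a b, ?_, ?_⟩
  · ext a b
    simp only [unipotentPart, Matrix.of_apply]
    rcases lt_trichotomy b a with h | rfl | h
    · simp [h]
    · simp [hL.apply_diag]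
    · simp [h.not_gt, h.ne, hL.apply_of_lt _ _ h]
  · ext a b
    simp only [upperPart, Matrix.of_apply]
    by_cases h : b < a
    · simp only [h, if_true]; exact (hR h).symm
    · simp [h]

theorem eq_of_parts_eq {B C : Matrix (Fin n) (Fin n) ℂ} (h1 : unipotentPart B = unipotentPart C)
    (h2 : upperPart B = upperPart C) : B = C := by
  ext a b
  by_cases h : b < a
  · simpa [unipotentPart, h] using congrFun (congrFun h1 a) b
  · simpa [upperPart, h] using congrFun (congrFun h2 a) b

end Blocks

/-! ### The generalized Schur parametrization and its eigenvalues. -/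

section Assemble

variable {n k : ℕ}

/-- The index of the left basis in the decomposition of the `j`-th matrix. -/
def src (ε : Fin (k + 1) → ℤ) (j : Fin (k + 1)) : Fin (k + 1) := if ε j = 1 then j else j + 1

/-- The index of the right basis in the decomposition of the `j`-th matrix. -/
def tgt (ε : Fin (k + 1) → ℤ) (j : Fin (k + 1)) : Fin (k + 1) := if ε j = 1 then j + 1 else j

/-- The indices `src` and `tgt` are swapped when the sign is `-1`, so that after taking the signed
power every factor goes from frame `j` to frame `j + 1`. The cyclic convention `last + 1 = 0` makes
the telescoped product a conjugation. -/
theorem signedProduct_conj {ε : Fin (k + 1) → ℤ} (hε : ∀ j, ε j = 1 ∨ ε j = -1)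
    {F B : Fin (k + 1) → Matrix (Fin n) (Fin n) ℂ} (hF : ∀ j, IsUnit (F j).det) :
    signedProduct ε (fun j => F (src ε j) * B j * (F (tgt ε j))⁻¹) =
      F 0 * signedProduct ε B * (F 0)⁻¹ := by
  -- Reducing natural indices modulo `k + 1` makes frame `k + 1` equal to frame `0`.
  have h := List.prod_ofFn_conj (fun i : ℕ => F (Fin.ofNat (k + 1) i)) (fun i => hF _)
    (fun j => B j ^ ε j)
  have h0 : Fin.ofNat (k + 1) (k + 1) = 0 := by ext; simp
  have h1 : Fin.ofNat (k + 1) 0 = 0 := by ext; simp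
  rw [h0, h1] at h
  rw [signedProduct, signedProduct, ← h]
  congr 2
  funext j
  have h2 : Fin.ofNat (k + 1) (j : ℕ) = j := by ext; simp
  have h3 : Fin.ofNat (k + 1) ((j : ℕ) + 1) = j + 1 := by
    ext; simp [Fin.val_add]
  rw [h2, h3]
  rcases hε j with hj | hj
  · simp [src, tgt, hj]
  · have hne : ¬ ((-1 : ℤ) = 1) := by norm_num
    simp only [src, tgt, hj, hne, if_false, Matrix.zpow_neg_one, Matrix.mul_inv_rev,
      Matrix.nonsing_inv_nonsing_inv _ (hF _), Matrix.mul_assoc]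

theorem signedProduct_upper {ε : Fin k → ℤ} (hε : ∀ j, ε j = 1 ∨ ε j = -1)
    {B : Fin k → Matrix (Fin n) (Fin n) ℂ} (hB : ∀ j, (B j).IsUpperTriangular)
    (hd : ∀ j a, B j a a ≠ 0) :
    (signedProduct ε B).IsUpperTriangular ∧
      ∀ a, signedProduct ε B a a = ∏ j, B j a a ^ ε j := by
  obtain ⟨h1, h2⟩ := List.prod_ofFn_isUpperTriangular (fun j => B j ^ ε j)
    fun j => ((hB j).zpow_sign (hd j) (hε j)).1
  exact ⟨h1, fun a => (h2 a).trans (Finset.prod_congr rfl fun j _ =>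
    ((hB j).zpow_sign (hd j) (hε j)).2 a)⟩

theorem eigenvalueMultiset_conj_upper {F T : Matrix (Fin n) (Fin n) ℂ} (hF : IsUnit F.det)
    (hT : T.IsUpperTriangular) :
    eigenvalueMultiset (F * T * F⁻¹) = Finset.univ.val.map fun a => T a a := by
  rw [eigenvalueMultiset, Matrix.mul_assoc, Matrix.charpoly_mul_comm, Matrix.mul_assoc,
    Matrix.nonsing_inv_mul _ hF, Matrix.mul_one, Matrix.charpoly_of_isUpperTriangular T hT]
  have := Polynomial.roots_multiset_prod_X_sub_C (Finset.univ.val.map fun a : Fin n => T a a)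
  rw [Multiset.map_map] at this
  exact this

/-- The generalized Schur parametrization, with unipotent lower triangular matrices in place of
unitary ones. -/
noncomputable def assemble (ε : Fin (k + 1) → ℤ) (X : Fin (k + 1) × Fin n × Fin n → ℂ) :
    Fin (k + 1) × Fin n × Fin n → ℂ :=
  unblock fun j => unipotentPart (block X (src ε j)) * upperPart (block X j) *
    (unipotentPart (block X (tgt ε j)))⁻¹

/-- The products of the diagonal entries, with the given signs. -/
noncomputable def diagProd (ε : Fin k → ℤ) (X : Fin k × Fin n × Fin n → ℂ) : Fin n → ℂ :=
  fun a => ∏ j, X (j, a, a) ^ ε j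

theorem eigenvalueMultiset_assemble {ε : Fin (k + 1) → ℤ} (hε : ∀ j, ε j = 1 ∨ ε j = -1)
    {X : Fin (k + 1) × Fin n × Fin n → ℂ} (hX : ∀ j a, X (j, a, a) ≠ 0) :
    eigenvalueMultiset (signedProduct ε (block (assemble ε X))) =
      Finset.univ.val.map (diagProd ε X) := by
  have h := signedProduct_conj hε (F := fun j => unipotentPart (block X j))
    (B := fun j => upperPart (block X j))
    (fun j => (isUnipotentLower_unipotentPart _).isUnit_det)
  obtain ⟨h1, h2⟩ := signedProduct_upper hε (B := fun j => upperPart (block X j))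
    (fun j => isUpperTriangular_upperPart _)
    (fun j a => by rw [upperPart_apply_diag, block_apply]; exact hX j a)
  rw [assemble, block_unblock, h,
    eigenvalueMultiset_conj_upper (isUnipotentLower_unipotentPart _).isUnit_det h1]
  simp only [h2, upperPart_apply_diag, block_apply]
  rfl

end Assemble

/-! ### Injectivity on parameters with sorted eigenvalues. -/

section Injectivity

variable {n k : ℕ}

/-- The lexicographic order on complex numbers, as a map to a linear order. -/
def lexKey (z : ℂ) : ℝ ×ₗ ℝ := toLex (z.re, z.im)

theorem lexKey_injective : Function.Injective lexKey := fun z w h => by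
  have h' : (z.re, z.im) = (w.re, w.im) := toLex.injective h
  exact Complex.ext (congrArg Prod.fst h') (congrArg Prod.snd h')

/-- The vectors of complex numbers that are strictly increasing in the lexicographic order. -/
def sortedSet (n : ℕ) : Set (Fin n → ℂ) := {z | StrictMono (lexKey ∘ z)}

theorem sortedSet.injective {z : Fin n → ℂ} (hz : z ∈ sortedSet n) : Function.Injective z :=
  Function.Injective.of_comp (f := lexKey) (StrictMono.injective hz)

theorem eq_of_mem_sortedSet {z w : Fin n → ℂ} (hz : z ∈ sortedSet n) (hw : w ∈ sortedSet n)
    (h : (Finset.univ.val.map z : Multiset ℂ) = Finset.univ.val.map w) : z = w := by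
  have hr : Set.range z = Set.range w := by
    ext x
    have := congrArg (x ∈ ·) h
    simpa using this
  have h2 := (StrictMono.range_inj hz hw).1 (by rw [Set.range_comp, Set.range_comp, hr])
  funext i
  exact lexKey_injective (congrFun h2 i)

/-- The parameters with nonzero diagonal entries whose diagonal products are sorted. -/
def regularSet (ε : Fin k → ℤ) : Set (Fin k × Fin n × Fin n → ℂ) :=
  {X | (∀ j a, X (j, a, a) ≠ 0) ∧ diagProd ε X ∈ sortedSet n}

/-- Multiplying the recursion around the cycle gives `∏ q = ∏ q * ∏ ρ`, so some `q i` vanishes; the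
recursion then carries this zero forward to the last index, over to `0`, and on to every `j`. -/
theorem eq_zero_of_cyclic_recursion {q ρ : Fin (k + 1) → ℂ} (h : ∀ j, q (j + 1) = q j * ρ j)
    (hρ : ∏ j, ρ j ≠ 1) (j : Fin (k + 1)) : q j = 0 := by
  have h1 : ∏ j, q j = (∏ j, q j) * ∏ j, ρ j := by
    rw [← Finset.prod_mul_distrib, ← Equiv.prod_comp (Equiv.addRight (1 : Fin (k + 1))) q]
    exact Finset.prod_congr rfl fun j _ => h j
  have h2 : ∏ j, q j = 0 := by
    by_contra hne
    exact hρ (mul_left_cancel₀ hne (by rw [mul_one]; exact h1.symm))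
  obtain ⟨i, _, hi⟩ := Finset.prod_eq_zero_iff.1 h2
  have h3 : ∀ i, q i = 0 → q 0 = 0 := by
    intro i
    induction i using Fin.reverseInduction with
    | last => intro hi; rw [← Fin.last_add_one, h, hi, zero_mul]
    | cast i ih => intro hi; exact ih (by rw [← Fin.coeSucc_eq_succ, h, hi, zero_mul])
  have h4 := h3 i hi
  induction j using Fin.induction with
  | zero => exact h4
  | succ i ih => rw [← Fin.coeSucc_eq_succ, h, ih, zero_mul]

theorem upper_mul_apply {R Q : Matrix (Fin n) (Fin n) ℂ} (hR : R.IsUpperTriangular) {a b : Fin n}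
    (hQ : ∀ c, a < c → Q c b = 0) : (R * Q) a b = R a a * Q a b := by
  rw [Matrix.mul_apply, Finset.sum_eq_single a _ (by simp)]
  intro c _ hc
  rcases lt_or_gt_of_ne hc with h | h
  · rw [hR h, zero_mul]
  · rw [hQ c h, mul_zero]

theorem mul_upper_apply {R Q : Matrix (Fin n) (Fin n) ℂ} (hR : R.IsUpperTriangular) {a b : Fin n}
    (hQ : ∀ c, c < b → Q a c = 0) : (Q * R) a b = Q a b * R b b := by
  rw [Matrix.mul_apply, Finset.sum_eq_single b _ (by simp)]
  intro c _ hc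
  rcases lt_or_gt_of_ne hc with h | h
  · rw [hQ c h, zero_mul]
  · rw [hR h, mul_zero]

/-- The sign of `ε j` decides which side of the relation carries `q (j + 1)`; the exponent `ε j` on
the ratio records exactly this. -/
theorem src_tgt_recursion {ε : Fin (k + 1) → ℤ} (hε : ∀ j, ε j = 1 ∨ ε j = -1)
    {q r s : Fin (k + 1) → ℂ} (hr : ∀ j, r j ≠ 0) (hs : ∀ j, s j ≠ 0)
    (h : ∀ j, r j * q (tgt ε j) = q (src ε j) * s j) (j : Fin (k + 1)) :
    q (j + 1) = q j * (s j / r j) ^ ε j := by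
  have h' := h j
  have h1 := hr j
  have h2 := hs j
  rcases hε j with hj | hj
  · simp only [tgt, src, hj, if_true] at h'
    rw [hj, zpow_one]
    field_simp
    linear_combination h'
  · have hne : ¬ ((-1 : ℤ) = 1) := by norm_num
    simp only [tgt, src, hj, hne, if_false] at h'
    rw [hj, zpow_neg_one]
    field_simp
    linear_combination -h'

/-- The entries below the diagonal are treated from the bottom left corner outwards, where `n - a +
b` is smallest. Once the entries further down in the column and further left in the row vanish,
entry `(a, b)` of the intertwining relation involves only diagonal entries of `R j` and `S j`. It is
a cyclic recursion whose total ratio differs from `1` because the diagonal products differ. -/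
theorem eq_one_of_intertwine {ε : Fin (k + 1) → ℤ} (hε : ∀ j, ε j = 1 ∨ ε j = -1)
    {R S Q : Fin (k + 1) → Matrix (Fin n) (Fin n) ℂ} (hR : ∀ j, (R j).IsUpperTriangular)
    (hS : ∀ j, (S j).IsUpperTriangular) (hR0 : ∀ j a, R j a a ≠ 0) (hS0 : ∀ j a, S j a a ≠ 0)
    (hQ : ∀ j, IsUnipotentLower (Q j)) (h : ∀ j, R j * Q (tgt ε j) = Q (src ε j) * S j)
    (hz : ∀ a b, b < a → ∏ j, S j b b ^ ε j ≠ ∏ j, R j a a ^ ε j) (j : Fin (k + 1)) :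
    Q j = 1 := by
  have main : ∀ d : ℕ, ∀ a b : Fin n, b < a → (n - a + b : ℕ) = d → ∀ j, Q j a b = 0 := by
    intro d
    induction d using Nat.strong_induction_on with
    | _ d ih =>
      intro a b hab hd
      have e1 : ∀ j c, a < c → Q j c b = 0 := fun j c hc =>
        ih (n - c + b) (by have := c.2; have : (a : ℕ) < c := hc; omega) c b (hab.trans hc) rfl j
      have e2 : ∀ j c, c < b → Q j a c = 0 := fun j c hc =>
        ih (n - a + c) (by have : (c : ℕ) < b := hc; omega) a c (hc.trans hab) rfl j
      refine eq_zero_of_cyclic_recursion (ρ := fun j => (S j b b / R j a a) ^ ε j)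
        (src_tgt_recursion hε (q := fun j => Q j a b) (fun j => hR0 j a) (fun j => hS0 j b)
          fun j => ?_) ?_
      · rw [← upper_mul_apply (hR j) (e1 _), h j, mul_upper_apply (hS j) (e2 _)]
      · simp only [div_zpow]
        rw [Finset.prod_div_distrib, Ne, div_eq_one_iff_eq]
        · exact hz a b hab
        · exact Finset.prod_ne_zero_iff.2 fun j _ => zpow_ne_zero _ (hR0 j a)
  ext a b
  rcases lt_trichotomy b a with h' | rfl | h'
  · rw [main _ a b h' rfl j, Matrix.one_apply_ne h'.ne']
  · rw [(hQ j).apply_diag, Matrix.one_apply_eq]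
  · rw [(hQ j).apply_of_lt _ _ h', Matrix.one_apply_ne h'.ne]

/-- The eigenvalues, being sorted, recover the vector of diagonal products. The quotients `L_X⁻¹ *
L_Y` of the two choices of frames then intertwine the triangular parts, and distinct diagonal
products force these quotients to be `1`. -/
theorem injOn_assemble {ε : Fin (k + 1) → ℤ} (hε : ∀ j, ε j = 1 ∨ ε j = -1) :
    Set.InjOn (assemble ε) (regularSet (n := n) ε) := by
  intro X hX Y hY hXY
  have hz : diagProd ε X = diagProd ε Y := by
    refine eq_of_mem_sortedSet hX.2 hY.2 ?_
    rw [← eigenvalueMultiset_assemble hε hX.1, ← eigenvalueMultiset_assemble hε hY.1, hXY]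
  have hL := fun (Z : Fin (k + 1) × Fin n × Fin n → ℂ) j =>
    isUnipotentLower_unipotentPart (block Z j)
  have hXY' := fun j => congrFun (unblock_injective hXY) j
  have hQ : ∀ j, (unipotentPart (block X j))⁻¹ * unipotentPart (block Y j) = 1 := by
    refine eq_one_of_intertwine hε (R := fun j => upperPart (block X j))
      (S := fun j => upperPart (block Y j))
      (Q := fun j => (unipotentPart (block X j))⁻¹ * unipotentPart (block Y j))
      (fun j => isUpperTriangular_upperPart _) (fun j => isUpperTriangular_upperPart _)
      (fun j a => by rw [upperPart_apply_diag]; exact hX.1 j a)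
      (fun j a => by rw [upperPart_apply_diag]; exact hY.1 j a)
      (fun j => (hL X j).inv.mul (hL Y j)) (fun j => ?_) (fun a b hab => ?_)
    · have h := congrArg (fun M => (unipotentPart (block X (src ε j)))⁻¹ * M *
        unipotentPart (block Y (tgt ε j))) (hXY' j)
      simp only [Matrix.mul_assoc] at h
      rw [Matrix.nonsing_inv_mul_cancel_left _ _ (hL X _).isUnit_det,
        Matrix.nonsing_inv_mul _ (hL Y _).isUnit_det, Matrix.mul_one] at h
      rw [h, Matrix.mul_assoc]
    · simp only [upperPart_apply_diag]
      intro hab'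
      have h1 : diagProd ε Y b = diagProd ε X a := hab'
      rw [← hz] at h1
      exact hab.ne ((sortedSet.injective hX.2) h1)
  have hLeq : ∀ j, unipotentPart (block X j) = unipotentPart (block Y j) := fun j => by
    have h := congrArg (unipotentPart (block X j) * ·) (hQ j)
    simp only [Matrix.mul_one] at h
    rw [Matrix.mul_nonsing_inv_cancel_left _ _ (hL X j).isUnit_det] at h
    exact h.symm
  have hReq : ∀ j, upperPart (block X j) = upperPart (block Y j) := fun j => by
    have h := hXY' j
    simp only [hLeq] at h
    have h2 := congrArg (fun M => (unipotentPart (block Y (src ε j)))⁻¹ * M *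
        unipotentPart (block Y (tgt ε j))) h
    simpa only [Matrix.mul_assoc, Matrix.nonsing_inv_mul_cancel_left _ _ (hL Y _).isUnit_det,
      Matrix.nonsing_inv_mul _ (hL Y _).isUnit_det, Matrix.mul_one] using h2
  have : block X = block Y := funext fun j => eq_of_parts_eq (hLeq j) (hReq j)
  rw [← unblock_block X, this, unblock_block]

end Injectivity

/-! ### Determinant formulas. -/

section Determinants

theorem Matrix.det_eq_one_of_weight {ι : Type*} [Fintype ι] [DecidableEq ι] {M : Matrix ι ι ℂ}
    (wt : ι → ℤ) (h : ∀ i j, wt j ≤ wt i → M i j = if i = j then 1 else 0) : M.det = 1 := by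
  have hM : M.BlockTriangular wt := fun i j hij => by
    rw [h i j hij.le, if_neg]
    rintro rfl
    exact lt_irrefl _ hij
  rw [hM.det]
  refine Finset.prod_eq_one fun w _ => ?_
  have : M.toSquareBlock wt w = 1 := by
    ext i j
    rw [Matrix.toSquareBlock_def, Matrix.of_apply, h _ _ (by rw [i.2, j.2]), Matrix.one_apply]
    simp [Subtype.ext_iff]
  rw [this, Matrix.det_one]

/-- The first column has only two nonzero entries, in the first and the last row. The corresponding
minors are upper triangular with diagonal `α` and lower triangular with diagonal `-β`. -/
theorem Matrix.det_cyclic_bidiagonal {k : ℕ} (α β : Fin (k + 1) → ℂ) :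
    (Matrix.of fun j i : Fin (k + 1) =>
      (if i = j then α j else 0) - (if i = j + 1 then β j else 0)).det =
      ∏ j, α j - ∏ j, β j := by
  -- For a cycle of length one both conditions `i = j` and `i = j + 1` hold, and the single entry is
  -- `α 0 - β 0`.
  rcases k with _ | m
  · simp [Matrix.det_unique]
  · rw [Matrix.det_succ_column_zero, Fin.sum_univ_succ, Fin.sum_univ_castSucc]
    have h0 : ∀ i : Fin m, (Matrix.of fun j i : Fin (m + 1 + 1) =>
        (if i = j then α j else 0) - (if i = j + 1 then β j else 0)) i.castSucc.succ 0 = 0 := by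
      intro i
      have h1 : (0 : Fin (m + 1 + 1)) ≠ i.castSucc.succ := (Fin.succ_ne_zero _).symm
      have h2 : (0 : Fin (m + 1 + 1)) ≠ i.castSucc.succ + 1 := by
        rw [Fin.succ_castSucc, Fin.coeSucc_eq_succ]
        exact (Fin.succ_ne_zero _).symm
      simp [h1, h2]
    simp only [h0, mul_zero, zero_mul, Finset.sum_const_zero, zero_add]
    have h1 : ((Matrix.of fun j i : Fin (m + 1 + 1) =>
        (if i = j then α j else 0) - (if i = j + 1 then β j else 0)).submatrix
          (Fin.succAbove 0) Fin.succ).det = ∏ i : Fin (m + 1), α i.succ := by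
      rw [Matrix.det_of_isUpperTriangular]
      · refine Finset.prod_congr rfl fun i _ => ?_
        have : i.succ ≠ i.succ + 1 := by simp
        simp [this]
      · intro i j hij
        have hij' : j < i := hij
        have h3 : j.succ ≠ i.succ + 1 := by
          induction i using Fin.lastCases with
          | last => simp [Fin.succ_last, Fin.last_add_one]
          | cast i =>
            rw [Fin.succ_castSucc, Fin.coeSucc_eq_succ]
            intro h
            have := Fin.succ_injective _ h
            rw [this] at hij'
            exact absurd hij' (not_lt.2 (Fin.castSucc_lt_succ).le)
        simp [hij'.ne, h3]
    have h2 : ((Matrix.of fun j i : Fin (m + 1 + 1) =>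
        (if i = j then α j else 0) - (if i = j + 1 then β j else 0)).submatrix
          (Fin.succAbove (Fin.last m).succ) Fin.succ).det =
          (-1) ^ (m + 1) * ∏ i : Fin (m + 1), β i.castSucc := by
      rw [Matrix.det_of_isLowerTriangular]
      · have : ∀ i : Fin (m + 1), i.succ ≠ i.castSucc := fun i => (Fin.castSucc_lt_succ).ne'
        simp [Fin.succ_last, this, Finset.prod_neg]
      · intro i j hij
        have hij' : i < j := hij
        have h3 : j.succ ≠ i.castSucc :=
          ((Fin.castSucc_lt_succ (i := i)).trans (Fin.succ_lt_succ_iff.2 hij')).ne'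
        simp [Fin.succ_last, h3, hij'.ne']
    rw [h1, h2, Fin.prod_univ_succ α, Fin.prod_univ_castSucc β]
    have h4 : (0 : Fin (m + 1 + 1)) ≠ Fin.last (m + 1) := (Fin.last_pos).ne
    have h5 : ((-1 : ℂ) ^ (m + 1)) ^ 2 = 1 := by rw [← pow_mul, mul_comm, pow_mul]; simp
    simp [Fin.succ_last, Fin.last_add_one, h4]
    linear_combination (-(∏ i : Fin (m + 1), β i.castSucc) * β (Fin.last (m + 1))) * h5

theorem LinearMap.abs_det_restrictScalars {ι : Type*} [Fintype ι]
    (f : (ι → ℂ) →ₗ[ℂ] (ι → ℂ)) : |(f.restrictScalars ℝ).det| = ‖LinearMap.det f‖ ^ 2 := by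
  rw [LinearMap.det_restrictScalars, Algebra.norm_complex_apply, Complex.normSq_eq_norm_sq,
    abs_of_nonneg (sq_nonneg _)]

end Determinants

/-! ### The derivative in a moving frame and its determinant. -/

section LinearizedAssemble

variable {n k : ℕ}

/-- The strictly lower triangular part of a matrix. -/
def strictPart (B : Matrix (Fin n) (Fin n) ℂ) : Matrix (Fin n) (Fin n) ℂ :=
  Matrix.of fun a b => if b < a then B a b else 0

theorem lower_mul_strictPart {L : Matrix (Fin n) (Fin n) ℂ} (hL : IsUnipotentLower L)
    (B : Matrix (Fin n) (Fin n) ℂ) : strictPart (L * strictPart B) = L * strictPart B := by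
  ext a b
  by_cases h : b < a
  · simp [strictPart, h]
  · rw [strictPart, Matrix.of_apply, if_neg h, Matrix.mul_apply]
    refine (Finset.sum_eq_zero fun c _ => ?_).symm
    by_cases hc : b < c
    · rw [hL.apply_of_lt _ _ ((not_lt.1 h).trans_lt hc), zero_mul]
    · simp [strictPart, hc]

/-- Simultaneous two-sided multiplication. -/
def twoSidedMul (L N : Fin k → Matrix (Fin n) (Fin n) ℂ) :
    (Fin k × Fin n × Fin n → ℂ) →ₗ[ℂ] (Fin k × Fin n × Fin n → ℂ) where
  toFun Y := unblock fun j => L j * block Y j * N j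
  map_add' X Y := by
    have : ∀ j, block (X + Y) j = block X j + block Y j := fun j => rfl
    simp only [this, Matrix.mul_add, Matrix.add_mul]; rfl
  map_smul' c X := by
    have : ∀ j, block (c • X) j = c • block X j := fun j => rfl
    simp only [this, Matrix.mul_smul, Matrix.smul_mul]; rfl

theorem block_single (j j' : Fin k) (c d : Fin n) :
    block (Pi.single (j', c, d) 1 : Fin k × Fin n × Fin n → ℂ) j =
      if j' = j then Matrix.single c d 1 else 0 := by
  ext a b
  rw [block_apply, Pi.single_apply]
  by_cases h : j' = j
  · subst h
    simp [Matrix.single_apply, eq_comm]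
  · have : ¬ (j = j') := fun h' => h h'.symm
    simp [h, this]

/-- Entry `(a, b)` of `L * E_{cd} * N` is `L a c * N d b`, which vanishes unless `c ≤ a` and `b ≤
d`. Apart from the identity part, the map therefore strictly lowers `b - a`. -/
theorem det_twoSidedMul {L N : Fin k → Matrix (Fin n) (Fin n) ℂ}
    (hL : ∀ j, IsUnipotentLower (L j)) (hN : ∀ j, IsUnipotentLower (N j)) :
    LinearMap.det (twoSidedMul L N) = 1 := by
  rw [← LinearMap.det_toMatrix']
  refine Matrix.det_eq_one_of_weight (fun i => (i.2.2 : ℤ) - i.2.1) ?_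
  rintro ⟨j, a, b⟩ ⟨j', c, d⟩ h
  rw [LinearMap.toMatrix'_apply]
  change (L j * block _ j * N j : Matrix (Fin n) (Fin n) ℂ) a b = _
  rw [block_single]
  by_cases hj : j' = j
  · subst hj
    have : (L j' * Matrix.single c d 1 * N j' : Matrix (Fin n) (Fin n) ℂ) a b = L j' a c * N j' d b := by
      rw [Matrix.mul_apply, Finset.sum_eq_single d]
      · simp
      · intro e _ he
        rw [Matrix.mul_single_apply_of_ne _ _ _ _ _ he, zero_mul]
      · simp
    rw [if_pos rfl, this]
    by_cases hac : a = c
    · subst hac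
      by_cases hbd : b = d
      · subst hbd; simp [(hL j').apply_diag, (hN j').apply_diag]
      · have hdb : d < b := by
          refine lt_of_le_of_ne ?_ (Ne.symm hbd)
          simp only [sub_le_sub_iff_right] at h
          exact_mod_cast h
        simp [hbd, (hN j').apply_of_lt _ _ hdb]
    · rcases lt_or_gt_of_ne hac with hlt | hlt
      · simp [hac, (hL j').apply_of_lt _ _ hlt]
      · have hdb : d < b := by
          simp only at h
          have h1 : (c : ℤ) < a := by exact_mod_cast hlt
          have : (d : ℤ) < b := by linarith
          exact_mod_cast this
        simp [hac, (hN j').apply_of_lt _ _ hdb]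
  · have : ¬ (j = j') := fun h' => hj h'.symm
    simp [hj, this]

/-- Multiplication of the strictly lower triangular parts. -/
def strictMul (L : Fin k → Matrix (Fin n) (Fin n) ℂ) :
    (Fin k × Fin n × Fin n → ℂ) →ₗ[ℂ] (Fin k × Fin n × Fin n → ℂ) where
  toFun Y := unblock fun j => strictPart (L j * strictPart (block Y j)) + upperPart (block Y j)
  map_add' X Y := by
    have h1 : ∀ A B : Matrix (Fin n) (Fin n) ℂ,
        strictPart (A + B) = strictPart A + strictPart B := fun A B => by
      ext a b; simp only [strictPart, Matrix.of_apply, Matrix.add_apply]; split_ifs <;> simp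
    have h2 : ∀ A B : Matrix (Fin n) (Fin n) ℂ,
        upperPart (A + B) = upperPart A + upperPart B := fun A B => by
      ext a b; simp only [upperPart, Matrix.of_apply, Matrix.add_apply]; split_ifs <;> simp
    have : ∀ j, block (X + Y) j = block X j + block Y j := fun j => rfl
    simp only [this, h1, h2, Matrix.mul_add]
    ext i
    simp only [unblock, Matrix.add_apply, Pi.add_apply]
    ring
  map_smul' c X := by
    have h1 : ∀ A : Matrix (Fin n) (Fin n) ℂ,
        strictPart (c • A) = c • strictPart A := fun A => by
      ext a b; simp only [strictPart, Matrix.of_apply, Matrix.smul_apply]; split_ifs <;> simp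
    have h2 : ∀ A : Matrix (Fin n) (Fin n) ℂ,
        upperPart (c • A) = c • upperPart A := fun A => by
      ext a b; simp only [upperPart, Matrix.of_apply, Matrix.smul_apply]; split_ifs <;> simp
    have : ∀ j, block (c • X) j = c • block X j := fun j => rfl
    simp only [this, h1, h2, Matrix.mul_smul]
    ext i
    simp only [unblock, Matrix.add_apply, Matrix.smul_apply, Pi.smul_apply, RingHom.id_apply,
      smul_add]

theorem strictPart_single (c d : Fin n) :
    strictPart (Matrix.single c d (1 : ℂ)) = if d < c then Matrix.single c d 1 else 0 := by
  ext a b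
  rw [strictPart, Matrix.of_apply]
  by_cases h1 : c = a ∧ d = b
  · obtain ⟨rfl, rfl⟩ := h1
    split_ifs <;> simp
  · have h2 : Matrix.single c d (1 : ℂ) a b = 0 := by simp only [Matrix.single_apply, h1, if_false]
    split_ifs <;> simp [h2]

theorem upperPart_single (c d : Fin n) :
    upperPart (Matrix.single c d (1 : ℂ)) = if d < c then 0 else Matrix.single c d 1 := by
  ext a b
  rw [upperPart, Matrix.of_apply]
  by_cases h1 : c = a ∧ d = b
  · obtain ⟨rfl, rfl⟩ := h1
    split_ifs <;> simp
  · have h2 : Matrix.single c d (1 : ℂ) a b = 0 := by simp only [Matrix.single_apply, h1, if_false]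
    split_ifs <;> simp [h2]

@[simp] theorem strictPart_zero : strictPart (0 : Matrix (Fin n) (Fin n) ℂ) = 0 := by
  ext; simp [strictPart]

@[simp] theorem upperPart_zero : upperPart (0 : Matrix (Fin n) (Fin n) ℂ) = 0 := by
  ext; simp [upperPart]

theorem Matrix.mul_single_apply_ite (M : Matrix (Fin n) (Fin n) ℂ) (a b c d : Fin n) :
    (M * Matrix.single c d 1 : Matrix (Fin n) (Fin n) ℂ) a b = if d = b then M a c else 0 := by
  by_cases h : d = b
  · subst h; simp
  · rw [Matrix.mul_single_apply_of_ne _ _ _ _ _ (Ne.symm h), if_neg h]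

theorem Matrix.single_mul_apply_ite (M : Matrix (Fin n) (Fin n) ℂ) (a b c d : Fin n) :
    (Matrix.single c d 1 * M : Matrix (Fin n) (Fin n) ℂ) a b = if c = a then M d b else 0 := by
  by_cases h : c = a
  · subst h; simp
  · rw [Matrix.single_mul_apply_of_ne _ _ _ _ _ (Ne.symm h), if_neg h]

/-- The weight `b - a` works again: left multiplication by `L` moves entries of a column only
downwards. -/
theorem det_strictMul {L : Fin k → Matrix (Fin n) (Fin n) ℂ}
    (hL : ∀ j, IsUnipotentLower (L j)) : LinearMap.det (strictMul L) = 1 := by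
  rw [← LinearMap.det_toMatrix']
  refine Matrix.det_eq_one_of_weight (fun i => (i.2.2 : ℤ) - i.2.1) ?_
  rintro ⟨j, a, b⟩ ⟨j', c, d⟩ h
  rw [LinearMap.toMatrix'_apply]
  change (strictPart (L j * strictPart (block _ j)) + upperPart (block _ j) :
    Matrix (Fin n) (Fin n) ℂ) a b = _
  rw [block_single]
  by_cases hj : j' = j
  · subst hj
    rw [if_pos rfl, strictPart_single, upperPart_single]
    by_cases hdc : d < c
    · rw [if_pos hdc, if_pos hdc, add_zero, strictPart, Matrix.of_apply,
        Matrix.mul_single_apply_ite]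
      by_cases hdb : d = b
      · subst hdb
        simp only [sub_le_sub_iff_left] at h
        have h' : a ≤ c := by exact_mod_cast h
        rcases h'.eq_or_lt with rfl | hlt
        · simp [hdc, (hL j').apply_diag]
        · simp [hlt.ne, (hL j').apply_of_lt _ _ hlt]
      · have : ¬ (b = d) := fun h' => hdb h'.symm
        simp [hdb, this]
    · rw [if_neg hdc, if_neg hdc, Matrix.mul_zero, strictPart_zero, zero_add, Matrix.single_apply]
      simp [eq_comm]
  · have : ¬ (j = j') := fun h' => hj h'.symm
    simp [hj, this]

/-- The derivative of the generalized Schur parametrization, in a moving frame. -/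
def intertwineMap (ε : Fin (k + 1) → ℤ) (R : Fin (k + 1) → Matrix (Fin n) (Fin n) ℂ) :
    (Fin (k + 1) × Fin n × Fin n → ℂ) →ₗ[ℂ] (Fin (k + 1) × Fin n × Fin n → ℂ) where
  toFun Y := unblock fun j => strictPart (block Y (src ε j)) * R j + upperPart (block Y j) -
    R j * strictPart (block Y (tgt ε j))
  map_add' X Y := by
    have h1 : ∀ A B : Matrix (Fin n) (Fin n) ℂ,
        strictPart (A + B) = strictPart A + strictPart B := fun A B => by
      ext a b; simp only [strictPart, Matrix.of_apply, Matrix.add_apply]; split_ifs <;> simp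
    have h2 : ∀ A B : Matrix (Fin n) (Fin n) ℂ,
        upperPart (A + B) = upperPart A + upperPart B := fun A B => by
      ext a b; simp only [upperPart, Matrix.of_apply, Matrix.add_apply]; split_ifs <;> simp
    have : ∀ j, block (X + Y) j = block X j + block Y j := fun j => rfl
    simp only [this, h1, h2, Matrix.mul_add, Matrix.add_mul]
    ext i
    simp only [unblock, Matrix.add_apply, Matrix.sub_apply, Pi.add_apply]
    ring
  map_smul' c X := by
    have h1 : ∀ A : Matrix (Fin n) (Fin n) ℂ,
        strictPart (c • A) = c • strictPart A := fun A => by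
      ext a b; simp only [strictPart, Matrix.of_apply, Matrix.smul_apply]; split_ifs <;> simp
    have h2 : ∀ A : Matrix (Fin n) (Fin n) ℂ,
        upperPart (c • A) = c • upperPart A := fun A => by
      ext a b; simp only [upperPart, Matrix.of_apply, Matrix.smul_apply]; split_ifs <;> simp
    have : ∀ j, block (c • X) j = c • block X j := fun j => rfl
    simp only [this, h1, h2, Matrix.mul_smul, Matrix.smul_mul]
    ext i
    simp only [unblock, Matrix.add_apply, Matrix.sub_apply, Matrix.smul_apply, Pi.smul_apply,
      RingHom.id_apply, smul_add, smul_sub]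

theorem intertwineMap_single (ε : Fin (k + 1) → ℤ) (R : Fin (k + 1) → Matrix (Fin n) (Fin n) ℂ)
    (j i : Fin (k + 1)) (a b c d : Fin n) :
    intertwineMap ε R (Pi.single (i, c, d) 1) (j, a, b) =
      if d < c then (if i = src ε j ∧ c = a then R j d b else 0) -
        (if i = tgt ε j ∧ d = b then R j a c else 0)
      else if i = j ∧ c = a ∧ d = b then 1 else 0 := by
  change (strictPart (block _ (src ε j)) * R j + upperPart (block _ j) -
    R j * strictPart (block _ (tgt ε j)) : Matrix (Fin n) (Fin n) ℂ) a b = _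
  have hs : ∀ l : Fin (k + 1), strictPart (if i = l then Matrix.single c d (1 : ℂ) else 0) =
      if d < c ∧ i = l then Matrix.single c d 1 else 0 := fun l => by
    by_cases h : i = l
    · simp [h, strictPart_single]
    · simp [h]
  have hu : upperPart (if i = j then Matrix.single c d (1 : ℂ) else 0) =
      if ¬ d < c ∧ i = j then Matrix.single c d 1 else 0 := by
    by_cases h : i = j
    · by_cases hdc : d < c <;> simp [h, hdc, upperPart_single, -not_lt]
    · simp [h]
  rw [block_single, block_single, block_single, hs, hs, hu]
  simp only [Matrix.sub_apply, Matrix.add_apply]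
  by_cases hdc : d < c
  · have e1 : ((if d < c ∧ i = src ε j then Matrix.single c d (1 : ℂ) else 0) * R j) a b =
        if i = src ε j ∧ c = a then R j d b else 0 := by
      by_cases h : i = src ε j
      · rw [if_pos ⟨hdc, h⟩, Matrix.single_mul_apply_ite]; simp [h]
      · simp [h]
    have e2 : (R j * (if d < c ∧ i = tgt ε j then Matrix.single c d (1 : ℂ) else 0)) a b =
        if i = tgt ε j ∧ d = b then R j a c else 0 := by
      by_cases h : i = tgt ε j
      · rw [if_pos ⟨hdc, h⟩, Matrix.mul_single_apply_ite]; simp [h]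
      · simp [h]
    rw [e1, e2, if_pos hdc]
    simp [hdc]
  · rw [if_neg hdc]
    by_cases h : i = j
    · simp [h, hdc, Matrix.single_apply]
    · simp [h, hdc]

/-- The weight for which the linearized parametrization is block triangular. -/
def entryWeight (p : Fin n × Fin n) : ℤ ×ₗ ℤ := toLex ((p.1 : ℤ) - p.2, (p.1 : ℤ))

theorem entryWeight_injective : Function.Injective (entryWeight (n := n)) := fun p q h => by
  have h' : (((p.1 : ℤ) - p.2, (p.1 : ℤ)) : ℤ × ℤ) = ((q.1 : ℤ) - q.2, (q.1 : ℤ)) := toLex.injective h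
  simp only [Prod.mk.injEq] at h'
  ext <;> omega

theorem entryWeight_lt {p q : Fin n × Fin n} (h : entryWeight p < entryWeight q) :
    (p.1 : ℤ) - p.2 < (q.1 : ℤ) - q.2 ∨
      (p.1 : ℤ) - p.2 = (q.1 : ℤ) - q.2 ∧ (p.1 : ℤ) < q.1 := by
  simpa [entryWeight, Prod.Lex.toLex_lt_toLex] using h

/-- Multiplication by an upper triangular matrix moves an entry up or to the right, so `a - b` never
increases. The second component of `entryWeight` only separates positions on a common diagonal, so
that each block belongs to a single position. -/
theorem blockTriangular_intertwineMap (ε : Fin (k + 1) → ℤ)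
    {R : Fin (k + 1) → Matrix (Fin n) (Fin n) ℂ} (hR : ∀ j, (R j).IsUpperTriangular) :
    (LinearMap.toMatrix' (intertwineMap ε R)).BlockTriangular (fun i => entryWeight i.2) := by
  rintro ⟨j, a, b⟩ ⟨i, c, d⟩ h
  have h := entryWeight_lt h
  simp only at h
  rw [LinearMap.toMatrix'_apply, intertwineMap_single]
  by_cases hdc : d < c
  · rw [if_pos hdc]
    have e1 : (if i = src ε j ∧ c = a then R j d b else 0) = 0 := by
      split_ifs with h1
      · obtain ⟨-, rfl⟩ := h1
        exact hR j (show b < d by have : (b : ℤ) < d := by omega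
                                  exact_mod_cast this)
      · rfl
    have e2 : (if i = tgt ε j ∧ d = b then R j a c else 0) = 0 := by
      split_ifs with h1
      · obtain ⟨-, rfl⟩ := h1
        exact hR j (show c < a by have : (c : ℤ) < a := by omega
                                  exact_mod_cast this)
      · rfl
    rw [e1, e2, sub_zero]
  · rw [if_neg hdc, if_neg]
    rintro ⟨-, rfl, rfl⟩
    omega

/-- The blocks of the block triangular matrix of `intertwineMap`. -/
def intertwineBlock (ε : Fin (k + 1) → ℤ) (R : Fin (k + 1) → Matrix (Fin n) (Fin n) ℂ)
    (p : Fin n × Fin n) : Matrix (Fin (k + 1)) (Fin (k + 1)) ℂ :=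
  if p.2 < p.1 then Matrix.of fun j i => (if i = src ε j then R j p.2 p.2 else 0) -
    (if i = tgt ε j then R j p.1 p.1 else 0) else 1

theorem det_intertwineMap (ε : Fin (k + 1) → ℤ)
    {R : Fin (k + 1) → Matrix (Fin n) (Fin n) ℂ} (hR : ∀ j, (R j).IsUpperTriangular) :
    LinearMap.det (intertwineMap ε R) = ∏ p, (intertwineBlock ε R p).det := by
  rw [← LinearMap.det_toMatrix', (blockTriangular_intertwineMap ε hR).det]
  have himg : (Finset.univ.image fun i : Fin (k + 1) × Fin n × Fin n => entryWeight i.2) =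
      Finset.univ.image (entryWeight (n := n)) := by
    ext w
    simp only [Finset.mem_image, Finset.mem_univ, true_and]
    exact ⟨fun ⟨i, hi⟩ => ⟨i.2, hi⟩, fun ⟨p, hp⟩ => ⟨(0, p), hp⟩⟩
  rw [himg, Finset.prod_image entryWeight_injective.injOn]
  refine Finset.prod_congr rfl fun p _ => ?_
  let e : Fin (k + 1) ≃ {i : Fin (k + 1) × Fin n × Fin n // entryWeight i.2 = entryWeight p} :=
    { toFun := fun j => ⟨(j, p), rfl⟩
      invFun := fun i => i.1.1
      left_inv := fun j => rfl
      right_inv := fun i => by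
        obtain ⟨⟨j, q⟩, hi⟩ := i
        have : q = p := entryWeight_injective hi
        subst this
        rfl }
  rw [← Matrix.det_submatrix_equiv_self e]
  congr 1
  ext j i
  obtain ⟨a, b⟩ := p
  simp only [Matrix.submatrix_apply, Matrix.toSquareBlock_def, Matrix.of_apply, e,
    Equiv.coe_fn_mk, LinearMap.toMatrix'_apply, intertwineMap_single, intertwineBlock]
  split_ifs with h1 <;> simp_all [Matrix.one_apply, eq_comm]

/-- For `ε j = -1` the roles of `j` and `j + 1` in row `j` are exchanged. Extracting `-(R j a a * R
j b b)` turns the row into the form it has for sign `+1`, with inverted entries, so one cyclic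
bidiagonal determinant covers all sign patterns. -/
theorem det_intertwineBlock {ε : Fin (k + 1) → ℤ} (hε : ∀ j, ε j = 1 ∨ ε j = -1)
    {R : Fin (k + 1) → Matrix (Fin n) (Fin n) ℂ} (hR : ∀ j a, R j a a ≠ 0) {a b : Fin n}
    (hab : b < a) :
    (intertwineBlock ε R (a, b)).det =
      (∏ j, if ε j = 1 then 1 else -(R j a a * R j b b)) *
        (∏ j, R j b b ^ ε j - ∏ j, R j a a ^ ε j) := by
  have hne : ¬ ((-1 : ℤ) = 1) := by norm_num
  have h : intertwineBlock ε R (a, b) = Matrix.of fun j i : Fin (k + 1) =>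
      (if i = j then (if ε j = 1 then 1 else -(R j a a * R j b b)) * R j b b ^ ε j else 0) -
      (if i = j + 1 then (if ε j = 1 then 1 else -(R j a a * R j b b)) * R j a a ^ ε j else 0) := by
    ext j i
    have ha := hR j a
    have hb := hR j b
    simp only [intertwineBlock, hab, if_true, Matrix.of_apply]
    rcases hε j with hj | hj
    · simp [src, tgt, hj]
    · have e1 : -(R j a a * R j b b) * (R j b b) ^ (-1 : ℤ) = - R j a a := by
        rw [zpow_neg_one]; field_simp
      have e2 : -(R j a a * R j b b) * (R j a a) ^ (-1 : ℤ) = - R j b b := by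
        rw [zpow_neg_one]; field_simp
      simp only [src, tgt, hj, hne, if_false, e1, e2]
      split_ifs <;> ring
  rw [h, Matrix.det_cyclic_bidiagonal, Finset.prod_mul_distrib, Finset.prod_mul_distrib, mul_sub]

end LinearizedAssemble

/-! ### The Jacobian of the parametrization. -/

section Jacobian

variable {n k : ℕ}

/-- Each index lies in exactly `n - 1` unordered pairs. -/
theorem Finset.prod_prod_lt_mul {M : Type*} [CommMonoid M] (f : Fin n → M) :
    ∏ a, ∏ b, (if b < a then f a * f b else 1) = ∏ a, f a ^ (n - 1) := by
  have h1 : ∀ a b : Fin n, (if b < a then f a * f b else 1) =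
      (if b < a then f a else 1) * (if b < a then f b else 1) := fun a b => by
    split_ifs <;> simp
  simp only [h1, Finset.prod_mul_distrib]
  rw [Finset.prod_comm (f := fun a b => if b < a then f b else 1), ← Finset.prod_mul_distrib]
  refine Finset.prod_congr rfl fun a _ => ?_
  rw [← Finset.prod_mul_distrib]
  have h2 : ∀ b : Fin n, (if b < a then f a else 1) * (if a < b then f a else 1) =
      if b ≠ a then f a else 1 := fun b => by
    rcases lt_trichotomy b a with h | rfl | h
    · simp [h, h.not_gt, h.ne]
    · simp
    · simp [h, h.not_gt, h.ne']
  simp only [h2]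
  rw [Finset.prod_ite, Finset.prod_const, Finset.prod_const_one, mul_one]
  congr 1
  rw [Finset.filter_ne', Finset.card_erase_of_mem (Finset.mem_univ _), Finset.card_univ,
    Fintype.card_fin]

/-- The Jacobian determinant of the generalized Schur parametrization. -/
noncomputable def schurJacobian (ε : Fin k → ℤ) (X : Fin k × Fin n × Fin n → ℂ) : ℝ :=
  (∏ i, ∏ j ∈ Finset.Ioi i, ‖diagProd ε X i - diagProd ε X j‖ ^ 2) *
    ∏ j, ∏ a, ‖X (j, a, a)‖ ^ ((1 - ε j) * ((n : ℤ) - 1))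

/-- The differences `z_b - z_a` give the Vandermonde factor. A sign `-1` contributes `|x_a|² |x_b|²`
for each pair, hence the exponent `2(n - 1) = (1 - ε_j)(n - 1)` on each diagonal entry; a sign `+1`
contributes nothing. -/
theorem norm_det_intertwineMap {ε : Fin (k + 1) → ℤ} (hε : ∀ j, ε j = 1 ∨ ε j = -1)
    {X : Fin (k + 1) × Fin n × Fin n → ℂ} (hX : ∀ j a, X (j, a, a) ≠ 0) :
    ‖LinearMap.det (intertwineMap ε fun j => upperPart (block X j))‖ ^ 2 = schurJacobian ε X := by
  rw [det_intertwineMap ε fun j => isUpperTriangular_upperPart _, norm_prod, ← Finset.prod_pow,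
    Fintype.prod_prod_type]
  have h1 : ∀ a b, ‖(intertwineBlock ε (fun j => upperPart (block X j)) (a, b)).det‖ ^ 2 =
      (if b < a then ‖diagProd ε X b - diagProd ε X a‖ ^ 2 else 1) *
        ∏ j, if b < a then (if ε j = 1 then 1 else ‖X (j, a, a)‖ ^ 2 * ‖X (j, b, b)‖ ^ 2)
          else 1 := by
    intro a b
    by_cases h : b < a
    · rw [det_intertwineBlock hε (fun j a => by rw [upperPart_apply_diag]; exact hX j a) h]
      simp only [upperPart_apply_diag, block_apply, h, if_true, norm_mul, mul_pow, norm_prod]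
      rw [mul_comm, ← Finset.prod_pow]
      congr 1
      refine Finset.prod_congr rfl fun j _ => ?_
      split_ifs <;> simp [mul_pow]
    · simp [intertwineBlock, h]
  simp only [h1, Finset.prod_mul_distrib, schurJacobian]
  congr 1
  · rw [Finset.prod_comm]
    refine Finset.prod_congr rfl fun i _ => ?_
    rw [← Finset.prod_filter]
    refine Finset.prod_congr ?_ fun _ _ => rfl
    ext; simp
  · have h2 : ∀ a : Fin n, ∏ b : Fin n, ∏ j, (if b < a then
        (if ε j = 1 then (1 : ℝ) else ‖X (j, a, a)‖ ^ 2 * ‖X (j, b, b)‖ ^ 2) else 1) =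
        ∏ j, ∏ b : Fin n, (if b < a then
        (if ε j = 1 then (1 : ℝ) else ‖X (j, a, a)‖ ^ 2 * ‖X (j, b, b)‖ ^ 2) else 1) :=
      fun a => Finset.prod_comm
    simp only [h2]
    rw [Finset.prod_comm]
    refine Finset.prod_congr rfl fun j _ => ?_
    rcases hε j with hj | hj
    · simp [hj]
    · have hne : ¬ ((-1 : ℤ) = 1) := by norm_num
      simp only [hj, hne, if_false]
      rw [Finset.prod_prod_lt_mul fun a => ‖X (j, a, a)‖ ^ 2]
      refine Finset.prod_congr rfl fun a _ => ?_
      have : ((1 : ℤ) - -1) * ((n : ℤ) - 1) = ((2 * (n - 1) : ℕ) : ℤ) := by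
        have := a.pos
        push_cast [Nat.cast_sub (show 1 ≤ n from this)]
        ring
      rw [this, zpow_natCast, pow_mul]

theorem differentiable_det {E : Type*} [NormedAddCommGroup E] [NormedSpace ℂ E] {m : Type*}
    [Fintype m] [DecidableEq m] {f : E → Matrix m m ℂ}
    (hf : ∀ i j, Differentiable ℂ fun x => f x i j) : Differentiable ℂ fun x => (f x).det := by
  simp only [Matrix.det_apply']
  fun_prop

theorem differentiable_adjugate {E : Type*} [NormedAddCommGroup E] [NormedSpace ℂ E] {m : Type*}
    [Fintype m] [DecidableEq m] {f : E → Matrix m m ℂ}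
    (hf : ∀ i j, Differentiable ℂ fun x => f x i j) (i j : m) :
    Differentiable ℂ fun x => (f x).adjugate i j := by
  simp only [Matrix.adjugate_apply]
  refine differentiable_det fun a b => ?_
  simp only [Matrix.updateRow_apply]
  split_ifs
  · exact differentiable_const _
  · exact hf a b

theorem differentiable_mul {E : Type*} [NormedAddCommGroup E] [NormedSpace ℂ E] {m : Type*}
    [Fintype m] {f g : E → Matrix m m ℂ} (hf : ∀ i j, Differentiable ℂ fun x => f x i j)
    (hg : ∀ i j, Differentiable ℂ fun x => g x i j) (i j : m) :
    Differentiable ℂ fun x => (f x * g x) i j := by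
  simp only [Matrix.mul_apply]
  fun_prop

theorem hasDerivAt_mul {m : Type*} [Fintype m] {f g : ℂ → Matrix m m ℂ} {f' g' : Matrix m m ℂ}
    {t : ℂ} (hf : ∀ i j, HasDerivAt (fun x => f x i j) (f' i j) t)
    (hg : ∀ i j, HasDerivAt (fun x => g x i j) (g' i j) t) (i j : m) :
    HasDerivAt (fun x => (f x * g x) i j) ((f' * g t + f t * g') i j) t := by
  simp only [Matrix.mul_apply, Matrix.add_apply, ← Finset.sum_add_distrib]
  exact HasDerivAt.fun_sum fun c _ => (hf i c).mul (hg c j)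

theorem IsUnipotentLower.inv_eq_adjugate {L : Matrix (Fin n) (Fin n) ℂ}
    (hL : IsUnipotentLower L) : L⁻¹ = L.adjugate := by
  rw [Matrix.inv_def, hL.det, Ring.inverse_one, one_smul]

theorem differentiable_unipotentPart (j : Fin k) (a b : Fin n) :
    Differentiable ℂ fun X : Fin k × Fin n × Fin n → ℂ => unipotentPart (block X j) a b := by
  simp only [unipotentPart, Matrix.of_apply, block_apply]
  split_ifs <;> fun_prop

theorem differentiable_upperPart (j : Fin k) (a b : Fin n) :
    Differentiable ℂ fun X : Fin k × Fin n × Fin n → ℂ => upperPart (block X j) a b := by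
  simp only [upperPart, Matrix.of_apply, block_apply]
  split_ifs <;> fun_prop

/-- The inverse of a unipotent matrix is its adjugate, so the map is polynomial and no point needs
to be excluded. -/
theorem differentiable_assemble (ε : Fin (k + 1) → ℤ) :
    Differentiable ℂ (assemble (n := n) ε) := by
  rw [differentiable_pi]
  rintro ⟨j, a, b⟩
  simp only [assemble, unblock, (isUnipotentLower_unipotentPart _).inv_eq_adjugate]
  exact differentiable_mul (differentiable_mul (fun _ _ => differentiable_unipotentPart _ _ _)
    fun _ _ => differentiable_upperPart _ _ _)
    (differentiable_adjugate fun _ _ => differentiable_unipotentPart _ _ _) a b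

theorem hasDerivAt_unipotentPart (X H : Fin k × Fin n × Fin n → ℂ) (j : Fin k) (a b : Fin n) :
    HasDerivAt (fun t : ℂ => unipotentPart (block (X + t • H) j) a b)
      (strictPart (block H j) a b) 0 := by
  simp only [unipotentPart, strictPart, Matrix.of_apply, block_apply, Pi.add_apply, Pi.smul_apply,
    smul_eq_mul]
  split_ifs
  · simpa using ((hasDerivAt_id (0 : ℂ)).mul_const (H (j, a, b))).const_add (X (j, a, b))
  all_goals exact hasDerivAt_const _ _

theorem hasDerivAt_upperPart (X H : Fin k × Fin n × Fin n → ℂ) (j : Fin k) (a b : Fin n) :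
    HasDerivAt (fun t : ℂ => upperPart (block (X + t • H) j) a b)
      (upperPart (block H j) a b) 0 := by
  simp only [upperPart, Matrix.of_apply, block_apply, Pi.add_apply, Pi.smul_apply,
    smul_eq_mul]
  split_ifs
  · exact hasDerivAt_const _ _
  · simpa using ((hasDerivAt_id (0 : ℂ)).mul_const (H (j, a, b))).const_add (X (j, a, b))

/-- Pulling the increment of each `L` back by `L⁻¹`, and undoing the outer frames, leaves a map that
depends on the triangular parts alone. The two outer factors have determinant one, so
`intertwineMap` carries the whole Jacobian. -/
theorem fderiv_assemble (ε : Fin (k + 1) → ℤ) (X : Fin (k + 1) × Fin n × Fin n → ℂ) :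
    (fderiv ℂ (assemble ε) X).toLinearMap =
      (twoSidedMul (fun j => unipotentPart (block X (src ε j)))
        fun j => (unipotentPart (block X (tgt ε j)))⁻¹) ∘ₗ
      (intertwineMap ε fun j => upperPart (block X j)) ∘ₗ
      strictMul fun j => (unipotentPart (block X j))⁻¹ := by
  have hL := fun j => isUnipotentLower_unipotentPart (block X j)
  refine LinearMap.ext fun H => ?_
  have hD : HasDerivAt (fun t : ℂ => assemble ε (X + t • H)) (fderiv ℂ (assemble ε) X H) 0 := by
    have h1 : HasFDerivAt (assemble ε) (fderiv ℂ (assemble ε) X) (X + (0 : ℂ) • H) := by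
      rw [zero_smul, add_zero]
      exact (differentiable_assemble ε X).hasFDerivAt
    have h2 : HasDerivAt (fun t : ℂ => X + t • H) H 0 := by
      simpa using ((hasDerivAt_id (0 : ℂ)).smul_const H).const_add X
    exact h1.comp_hasDerivAt 0 h2
  -- Differentiating the relation `A_j * L_tgt = L_src * R_j` avoids differentiating an inverse.
  have key : ∀ j, block (fderiv ℂ (assemble ε) X H) j * unipotentPart (block X (tgt ε j)) +
      block (assemble ε X) j * strictPart (block H (tgt ε j)) =
      strictPart (block H (src ε j)) * upperPart (block X j) +
      unipotentPart (block X (src ε j)) * upperPart (block H j) := by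
    intro j
    ext a b
    have h1 := hasDerivAt_mul (f := fun t => block (assemble ε (X + t • H)) j)
      (f' := block (fderiv ℂ (assemble ε) X H) j)
      (g := fun t => unipotentPart (block (X + t • H) (tgt ε j))) (t := 0)
      (fun a b => hasDerivAt_pi.1 hD (j, a, b)) (fun a b => hasDerivAt_unipotentPart X H _ a b) a b
    have h2 := hasDerivAt_mul (fun a b => hasDerivAt_unipotentPart X H (src ε j) a b)
      (fun a b => hasDerivAt_upperPart X H j a b) a b
    simp only [zero_smul, add_zero] at h1 h2
    refine h1.unique (h2.congr_of_eventuallyEq (Filter.Eventually.of_forall fun t => ?_))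
    simp only [assemble, block_unblock, Matrix.mul_assoc]
    rw [Matrix.nonsing_inv_mul _ (isUnipotentLower_unipotentPart _).isUnit_det, Matrix.mul_one]
  have hB : block (fderiv ℂ (assemble ε) X H) = block (((twoSidedMul
        (fun j => unipotentPart (block X (src ε j)))
        fun j => (unipotentPart (block X (tgt ε j)))⁻¹) ∘ₗ
      (intertwineMap ε fun j => upperPart (block X j)) ∘ₗ
      strictMul fun j => (unipotentPart (block X j))⁻¹) H) := by
    funext j
    have hsu : ∀ j, strictPart (block (strictMul (fun j => (unipotentPart (block X j))⁻¹) H) j) =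
        (unipotentPart (block X j))⁻¹ * strictPart (block H j) := by
      intro j
      rw [← lower_mul_strictPart (hL j).inv]
      ext a b
      change strictPart (strictPart _ + upperPart _) a b = strictPart _ a b
      by_cases h : b < a <;> simp [strictPart, upperPart, h]
    have huu : upperPart (block (strictMul (fun j => (unipotentPart (block X j))⁻¹) H) j) =
        upperPart (block H j) := by
      ext a b
      change upperPart (strictPart _ + upperPart _) a b = upperPart _ a b
      by_cases h : b < a <;> simp [strictPart, upperPart, h]
    change _ = unipotentPart (block X (src ε j)) * (strictPart (block
      (strictMul (fun j => (unipotentPart (block X j))⁻¹) H) (src ε j)) * upperPart (block X j) +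
      upperPart (block (strictMul (fun j => (unipotentPart (block X j))⁻¹) H) j) -
      upperPart (block X j) * strictPart (block
      (strictMul (fun j => (unipotentPart (block X j))⁻¹) H) (tgt ε j))) *
      (unipotentPart (block X (tgt ε j)))⁻¹
    rw [hsu, hsu, huu]
    have h1 := eq_sub_of_add_eq (key j)
    have h2 := congrArg (· * (unipotentPart (block X (tgt ε j)))⁻¹) h1
    rw [Matrix.mul_nonsing_inv_cancel_right _ _ (hL _).isUnit_det] at h2
    rw [h2]
    congr 1
    simp only [assemble, block_unblock, Matrix.mul_sub, Matrix.mul_add, Matrix.mul_assoc]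
    rw [Matrix.mul_nonsing_inv_cancel_left _ _ (hL _).isUnit_det]
  exact congrArg unblock hB

theorem abs_det_fderiv_assemble {ε : Fin (k + 1) → ℤ} (hε : ∀ j, ε j = 1 ∨ ε j = -1)
    {X : Fin (k + 1) × Fin n × Fin n → ℂ} (hX : ∀ j a, X (j, a, a) ≠ 0) :
    |((fderiv ℂ (assemble ε) X).restrictScalars ℝ).det| = schurJacobian ε X := by
  have hL := fun j => isUnipotentLower_unipotentPart (block X j)
  have h := LinearMap.abs_det_restrictScalars (fderiv ℂ (assemble ε) X).toLinearMap
  rw [fderiv_assemble, LinearMap.det_comp, LinearMap.det_comp, det_twoSidedMul (fun j => hL _)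
    (fun j => (hL _).inv), det_strictMul fun j => (hL j).inv, one_mul, mul_one,
    norm_det_intertwineMap hε hX, ← fderiv_assemble] at h
  exact h

theorem hasFDerivAt_assemble (ε : Fin (k + 1) → ℤ) (X : Fin (k + 1) × Fin n × Fin n → ℂ) :
    HasFDerivAt (assemble ε) ((fderiv ℂ (assemble ε) X).restrictScalars ℝ) X :=
  (differentiable_assemble ε X).hasFDerivAt.restrictScalars ℝ

end Jacobian

/-! ### Zero sets of entire functions of several variables. -/

section AlmostEverywhere

theorem ae_of_ae_comp_linearEquiv {ι : Type*} [Fintype ι] (f : (ι → ℂ) ≃ₗ[ℂ] (ι → ℂ))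
    {p : (ι → ℂ) → Prop} (h : ∀ᵐ x, p (f x)) : ∀ᵐ x, p x := by
  have hdet : LinearMap.det ((f.restrictScalars ℝ : (ι → ℂ) ≃ₗ[ℝ] (ι → ℂ)) :
      (ι → ℂ) →ₗ[ℝ] (ι → ℂ)) ≠ 0 := (LinearEquiv.isUnit_det' _).ne_zero
  rw [ae_iff] at h ⊢
  have h2 := Measure.addHaar_preimage_linearMap volume hdet {x | ¬ p x}
  have h3 : (volume : Measure (ι → ℂ)) (((f.restrictScalars ℝ : (ι → ℂ) ≃ₗ[ℝ] (ι → ℂ)) :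
      (ι → ℂ) →ₗ[ℝ] (ι → ℂ)) ⁻¹' {x | ¬ p x}) = 0 := h
  rw [h3] at h2
  rcases mul_eq_zero.1 h2.symm with h4 | h4
  · rw [ENNReal.ofReal_eq_zero] at h4
    exact absurd h4 (not_le.2 (abs_pos.2 (inv_ne_zero hdet)))
  · exact h4

theorem ae_ne_zero_of_entire {f : ℂ → ℂ} (hf : Differentiable ℂ f) {z : ℂ} (hz : f z ≠ 0) :
    ∀ᵐ t, f t ≠ 0 := by
  have h := AnalyticOnNhd.preimage_zero_mem_codiscrete (f := f) (fun t _ => hf.analyticAt t) hz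
  have h2 := ae_restrict_le_codiscreteWithin (μ := (volume : Measure ℂ)) MeasurableSet.univ h
  rw [Measure.restrict_univ] at h2
  exact h2

/-- On every complex line through `x₀` the zeros are discrete, hence null. Fubini yields one `t ≠ 0`
with `g (x₀ + t • x) ≠ 0` for almost every `x`, and scaling by `t` and translating by `x₀` preserve
null sets. -/
theorem ae_ne_zero_of_differentiable {ι : Type*} [Fintype ι] {g : (ι → ℂ) → ℂ}
    (hg : Differentiable ℂ g) {x₀ : ι → ℂ} (hx₀ : g x₀ ≠ 0) : ∀ᵐ x, g x ≠ 0 := by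
  have h1 : ∀ᵐ x : ι → ℂ, ∀ᵐ t : ℂ, g (x₀ + t • x) ≠ 0 := Filter.Eventually.of_forall fun x =>
    ae_ne_zero_of_entire (f := fun t => g (x₀ + t • x)) (by fun_prop) (z := 0) (by simpa using hx₀)
  have hm : MeasurableSet {p : (ι → ℂ) × ℂ | g (x₀ + p.2 • p.1) ≠ 0} := by
    have hc : Continuous fun p : (ι → ℂ) × ℂ => g (x₀ + p.2 • p.1) :=
      hg.continuous.comp (by fun_prop)
    exact (isOpen_ne.preimage hc).measurableSet
  rw [Measure.ae_ae_comm hm] at h1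
  have h0 : ∀ᵐ t : ℂ, t ≠ 0 := ae_iff.2 (by simp)
  obtain ⟨t, ht, ht0⟩ := (h1.and h0).exists
  have h2 := ae_of_ae_comp_linearEquiv (p := fun x => g (x₀ + x) ≠ 0)
    (LinearEquiv.smulOfNeZero ℂ (ι → ℂ) t ht0) ht
  have h3 := (measurePreserving_sub_right (volume : Measure (ι → ℂ)) x₀).quasiMeasurePreserving.ae h2
  simpa using h3

end AlmostEverywhere

/-! ### Simple spectrum and diagonalization. -/

section Diagonalization

variable {n : ℕ}

theorem Matrix.aeval_mulVec_of_eigenvector {M : Matrix (Fin n) (Fin n) ℂ} {c : ℂ} {v : Fin n → ℂ}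
    (h : M.mulVec v = c • v) (q : Polynomial ℂ) :
    (Polynomial.aeval M q).mulVec v = q.eval c • v := by
  induction q using Polynomial.induction_on' with
  | add p q hp hq => simp [Matrix.add_mulVec, hp, hq, add_smul]
  | monomial i a =>
    have : ∀ i : ℕ, (M ^ i).mulVec v = c ^ i • v := fun i => by
      induction i with
      | zero => simp
      | succ i ih => rw [pow_succ, ← Matrix.mulVec_mulVec, h, Matrix.mulVec_smul, ih, smul_smul,
          pow_succ']
    rw [Polynomial.aeval_monomial, Polynomial.eval_monomial, ← Matrix.mulVec_mulVec, this,
      Matrix.mulVec_smul, Algebra.algebraMap_eq_smul_one, Matrix.smul_mulVec, Matrix.one_mulVec,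
      smul_smul, mul_comm]

theorem Matrix.exists_eigenvector {M : Matrix (Fin n) (Fin n) ℂ} {c : ℂ}
    (h : M.charpoly.IsRoot c) : ∃ v ≠ 0, M.mulVec v = c • v := by
  rw [Polynomial.IsRoot.def, Matrix.eval_charpoly, ← Matrix.exists_mulVec_eq_zero_iff] at h
  obtain ⟨v, hv, h⟩ := h
  refine ⟨v, hv, ?_⟩
  rw [Matrix.sub_mulVec, sub_eq_zero] at h
  rw [← h, Matrix.scalar_apply]
  ext i
  simp [Matrix.mulVec_diagonal]

/-- The determinant of `p'(M)`, with `p` the characteristic polynomial, plays the role of a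
discriminant: at a repeated root `c` an eigenvector is killed by `p'(M)`, since `p' c = 0`. Being
polynomial in the entries, it is suited to the genericity argument. -/
theorem Matrix.nodup_roots_charpoly {M : Matrix (Fin n) (Fin n) ℂ}
    (h : (Polynomial.aeval M (Polynomial.derivative M.charpoly)).det ≠ 0) :
    M.charpoly.roots.Nodup := by
  by_contra hnd
  rw [Multiset.nodup_iff_count_le_one] at hnd
  push Not at hnd
  obtain ⟨c, hc⟩ := hnd
  rw [Polynomial.count_roots, Polynomial.one_lt_rootMultiplicity_iff_isRoot
    M.charpoly_monic.ne_zero] at hc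
  obtain ⟨v, hv, hMv⟩ := Matrix.exists_eigenvector hc.1
  refine h (Matrix.exists_mulVec_eq_zero_iff.1 ⟨v, hv, ?_⟩)
  rw [Matrix.aeval_mulVec_of_eigenvector hMv, hc.2.eq_zero, zero_smul]

theorem Matrix.det_aeval_derivative_diagonal {d : Fin n → ℂ} (hd : Function.Injective d) :
    (Polynomial.aeval (Matrix.diagonal d)
      (Polynomial.derivative (Matrix.diagonal d).charpoly)).det ≠ 0 := by
  intro h
  rw [← Matrix.exists_mulVec_eq_zero_iff] at h
  obtain ⟨v, hv, h⟩ := h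
  have h2 : ∀ q : Polynomial ℂ, Polynomial.aeval (Matrix.diagonal d) q =
      Matrix.diagonal fun i => q.eval (d i) := fun q => by
    have := Polynomial.aeval_algHom_apply (Matrix.diagonalAlgHom (n := Fin n) (α := ℂ) ℂ) d q
    simp only [Matrix.diagonalAlgHom_apply] at this
    rw [this]
    congr 1
    funext i
    rw [Polynomial.aeval_fn_apply, Polynomial.aeval_def, Polynomial.eval₂_eq_eval_map]
    simp
  refine hv (funext fun i => ?_)
  have h3 := congrFun h i
  rw [h2, Matrix.mulVec_diagonal] at h3
  refine (mul_eq_zero.1 h3).resolve_left ?_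
  rw [Matrix.charpoly_diagonal]
  have hs := Polynomial.separable_prod_X_sub_C_iff.2 hd
  refine hs.eval₂_derivative_ne_zero (RingHom.id ℂ) ?_
  rw [Polynomial.eval₂_id, Polynomial.eval_prod]
  exact Finset.prod_eq_zero (Finset.mem_univ i) (by simp)

theorem Matrix.exists_diagonalization {M : Matrix (Fin n) (Fin n) ℂ}
    (h : M.charpoly.roots.Nodup) : ∃ (F : Matrix (Fin n) (Fin n) ℂ) (d : Fin n → ℂ),
      IsUnit F.det ∧ Function.Injective d ∧ M * F = F * Matrix.diagonal d := by
  have hcard : M.charpoly.roots.card = n := by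
    rw [← (IsAlgClosed.splits M.charpoly).natDegree_eq_card_roots,
      Matrix.charpoly_natDegree_eq_dim, Fintype.card_fin]
  obtain ⟨l, hl⟩ := Quotient.exists_rep M.charpoly.roots
  have hl' : (l : Multiset ℂ) = M.charpoly.roots := hl
  have hlen : l.length = n := by rw [← hcard, ← hl', Multiset.coe_card]
  subst hlen
  have hnd : l.Nodup := by rw [← Multiset.coe_nodup, hl']; exact h
  have hv : ∀ i : Fin l.length, ∃ v ≠ 0, M.mulVec v = l.get i • v := fun i =>
    Matrix.exists_eigenvector (Polynomial.isRoot_of_mem_roots (by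
      rw [← hl', Multiset.mem_coe]; exact l.get_mem i))
  choose v hv0 hv using hv
  refine ⟨(Matrix.of v).transpose, l.get, ?_, List.nodup_iff_injective_get.1 hnd, ?_⟩
  · have hli : LinearIndependent ℂ v :=
      Module.End.eigenvectors_linearIndependent' (Matrix.toLin' M) l.get
        (List.nodup_iff_injective_get.1 hnd) v fun i =>
          ⟨Module.End.mem_eigenspace_iff.2 (by rw [Matrix.toLin'_apply]; exact hv i), hv0 i⟩
    rw [Matrix.det_transpose]
    exact (Matrix.isUnit_iff_isUnit_det _).1 (Matrix.linearIndependent_rows_iff_isUnit.1 hli)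
  · ext i j
    rw [Matrix.mul_diagonal]
    have := congrFun (hv j) i
    simp only [Matrix.mulVec, dotProduct, Pi.smul_apply, smul_eq_mul] at this
    simp only [Matrix.mul_apply, Matrix.transpose_apply, Matrix.of_apply]
    rw [this, mul_comm]

end Diagonalization

/-! ### Generic families: simple spectrum and transported eigenframes. -/

section GenericMatrices

variable {n k : ℕ}

theorem differentiable_aeval {E σ : Type*} [NormedAddCommGroup E] [NormedSpace ℂ E]
    {f : E → σ → ℂ} (hf : ∀ i, Differentiable ℂ fun x => f x i) (p : MvPolynomial σ ℂ) :
    Differentiable ℂ fun x => MvPolynomial.eval (f x) p := by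
  induction p using MvPolynomial.induction_on with
  | C a => simp
  | add p q hp hq => simpa using hp.fun_add hq
  | mul_X p i hp => simpa using hp.fun_mul (hf i)

theorem Matrix.coeff_charpoly_eq_eval (M : Matrix (Fin n) (Fin n) ℂ) (m : ℕ) :
    M.charpoly.coeff m = MvPolynomial.eval (fun p : Fin n × Fin n => M p.1 p.2)
      ((Matrix.charpoly.univ ℂ (Fin n)).coeff m) := by
  have h1 := Matrix.charpoly.univ_map_eval₂Hom (Fin n) (RingHom.id ℂ)
    (fun p : Fin n × Fin n => M p.1 p.2)
  have h2 : Matrix.of (Function.curry fun p : Fin n × Fin n => M p.1 p.2) = M := by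
    ext; rfl
  rw [h2] at h1
  rw [← h1, Polynomial.coeff_map]
  rfl

theorem differentiable_charpoly_coeff {E : Type*} [NormedAddCommGroup E] [NormedSpace ℂ E]
    {f : E → Matrix (Fin n) (Fin n) ℂ} (hf : ∀ i j, Differentiable ℂ fun x => f x i j) (m : ℕ) :
    Differentiable ℂ fun x => (f x).charpoly.coeff m := by
  simp only [Matrix.coeff_charpoly_eq_eval]
  exact differentiable_aeval (f := fun x (p : Fin n × Fin n) => f x p.1 p.2)
    (fun p => hf p.1 p.2) _

theorem differentiable_list_prod {E : Type*} [NormedAddCommGroup E] [NormedSpace ℂ E] {m : ℕ}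
    {f : Fin m → E → Matrix (Fin n) (Fin n) ℂ}
    (hf : ∀ l i j, Differentiable ℂ fun x => f l x i j) (i j : Fin n) :
    Differentiable ℂ fun x => (List.ofFn fun l => f l x).prod i j := by
  induction m generalizing i j with
  | zero => simp
  | succ m ih =>
    simp only [List.ofFn_succ, List.prod_cons]
    exact differentiable_mul (hf 0) (ih fun l => hf l.succ) i j

theorem differentiable_matrix_pow {E : Type*} [NormedAddCommGroup E] [NormedSpace ℂ E]
    {f : E → Matrix (Fin n) (Fin n) ℂ}
    (hf : ∀ i j, Differentiable ℂ fun x => f x i j) (m : ℕ) (i j : Fin n) :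
    Differentiable ℂ fun x => (f x ^ m) i j := by
  induction m generalizing i j with
  | zero => simp
  | succ m ih =>
    simp only [pow_succ]
    exact differentiable_mul ih hf i j

/-- The signed product with adjugates in place of inverses. -/
noncomputable def adjugateProduct (ε : Fin k → ℤ) (A : Fin k → Matrix (Fin n) (Fin n) ℂ) :
    Matrix (Fin n) (Fin n) ℂ :=
  (List.ofFn fun i => if ε i = 1 then A i else (A i).adjugate).prod

theorem List.prod_ofFn_smul {m : ℕ} (c : Fin m → ℂ) (B : Fin m → Matrix (Fin n) (Fin n) ℂ) :
    (List.ofFn fun i => c i • B i).prod = (∏ i, c i) • (List.ofFn B).prod := by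
  induction m with
  | zero => simp
  | succ m ih =>
    rw [List.ofFn_succ, List.ofFn_succ, List.prod_cons, List.prod_cons, ih, Fin.prod_univ_succ,
      Matrix.smul_mul, Matrix.mul_smul, smul_smul]

/-- The two products differ by a nonzero scalar, so they share eigenvectors and simplicity of the
spectrum, while the adjugate version is polynomial in the entries. -/
theorem adjugateProduct_eq_smul {ε : Fin k → ℤ} (hε : ∀ j, ε j = 1 ∨ ε j = -1)
    {A : Fin k → Matrix (Fin n) (Fin n) ℂ} (hA : ∀ j, IsUnit (A j).det) :
    adjugateProduct ε A = (∏ j, if ε j = 1 then 1 else (A j).det) • signedProduct ε A := by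
  rw [signedProduct, ← List.prod_ofFn_smul, adjugateProduct]
  congr 2
  funext j
  rcases hε j with hj | hj
  · simp [hj]
  · have hne : ¬ ((-1 : ℤ) = 1) := by norm_num
    simp only [hj, hne, if_false, Matrix.zpow_neg_one]
    rw [Matrix.inv_def, smul_smul, Ring.mul_inverse_cancel _ (hA j), one_smul]

theorem ae_nodup_roots_adjugateProduct (ε : Fin (k + 1) → ℤ) :
    ∀ᵐ X : Fin (k + 1) × Fin n × Fin n → ℂ,
      (adjugateProduct ε (block X)).charpoly.roots.Nodup := by
  have hM : ∀ i j, Differentiable ℂ fun X : Fin (k + 1) × Fin n × Fin n → ℂ =>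
      adjugateProduct ε (block X) i j := by
    refine differentiable_list_prod fun l i j => ?_
    have hb : ∀ a b, Differentiable ℂ fun X : Fin (k + 1) × Fin n × Fin n → ℂ =>
        block X l a b := fun a b => by
      simp only [block_apply]; fun_prop
    split_ifs
    · exact hb i j
    · exact differentiable_adjugate hb i j
  let g : (Fin (k + 1) × Fin n × Fin n → ℂ) → ℂ := fun X =>
    (Polynomial.aeval (adjugateProduct ε (block X))
      (Polynomial.derivative (adjugateProduct ε (block X)).charpoly)).det
  have hg : Differentiable ℂ g := by
    refine differentiable_det fun i j => ?_
    have h : ∀ X : Fin (k + 1) × Fin n × Fin n → ℂ,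
        (Polynomial.aeval (adjugateProduct ε (block X))
        (Polynomial.derivative (adjugateProduct ε (block X)).charpoly)) i j =
        ∑ m ∈ Finset.range (n + 1), ((adjugateProduct ε (block X)).charpoly.coeff (m + 1) *
          (m + 1)) * (adjugateProduct ε (block X) ^ m) i j := by
      intro X
      rw [Polynomial.aeval_eq_sum_range' (n := n + 1), Matrix.sum_apply]
      · refine Finset.sum_congr rfl fun m _ => ?_
        rw [Matrix.smul_apply, Polynomial.coeff_derivative, smul_eq_mul]
      · refine (Polynomial.natDegree_derivative_le _).trans_lt ?_
        rw [Matrix.charpoly_natDegree_eq_dim, Fintype.card_fin]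
        omega
    simp only [h]
    refine Differentiable.fun_sum fun m _ => ?_
    exact ((differentiable_charpoly_coeff hM _).mul_const _).mul (differentiable_matrix_pow hM m i j)
  -- The witness puts `diag(1, …, n)` in the first factor and the identity elsewhere. Its entries
  -- are distinct and nonzero, so the entries of its adjugate, which are `n!` divided by them, are
  -- distinct too; this covers both signs of `ε 0`.
  let D : Matrix (Fin n) (Fin n) ℂ := Matrix.diagonal fun i => ((i : ℕ) + 1 : ℂ)
  have hinj : Function.Injective fun i : Fin n => ((i : ℕ) + 1 : ℂ) := fun i j h => by
    have h' : ((i : ℕ) : ℂ) = (j : ℕ) := add_right_cancel h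
    exact Fin.ext (by exact_mod_cast h')
  have hg0 : g (unblock fun j => if j = 0 then D else 1) ≠ 0 := by
    have hprod : adjugateProduct ε (block (unblock fun j : Fin (k + 1) => if j = 0 then D else 1)) =
        if ε 0 = 1 then D else D.adjugate := by
      rw [block_unblock, adjugateProduct, List.ofFn_succ, List.prod_cons, List.prod_eq_one, mul_one]
      · simp
      · intro x hx
        rw [List.mem_ofFn] at hx
        obtain ⟨i, rfl⟩ := hx
        simp
    change (Polynomial.aeval (adjugateProduct ε (block _))
      (Polynomial.derivative (adjugateProduct ε (block _)).charpoly)).det ≠ 0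
    rw [hprod]
    split_ifs
    · exact Matrix.det_aeval_derivative_diagonal hinj
    · rw [Matrix.adjugate_diagonal]
      refine Matrix.det_aeval_derivative_diagonal fun i j h => ?_
      have hne : ∀ i : Fin n, ((i : ℕ) + 1 : ℂ) ≠ 0 := fun i => by
        exact_mod_cast Nat.succ_ne_zero (i : ℕ)
      have hi := Finset.mul_prod_erase Finset.univ (fun i : Fin n => ((i : ℕ) + 1 : ℂ))
        (Finset.mem_univ i)
      have hj := Finset.mul_prod_erase Finset.univ (fun i : Fin n => ((i : ℕ) + 1 : ℂ))
        (Finset.mem_univ j)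
      rw [← hj, h] at hi
      exact hinj (mul_right_cancel₀ (Finset.prod_ne_zero_iff.2 fun l _ => hne l) hi)
  filter_upwards [ae_ne_zero_of_differentiable hg hg0] with X hX
  exact Matrix.nodup_roots_charpoly hX

theorem ae_isUnit_det_block : ∀ᵐ X : Fin k × Fin n × Fin n → ℂ, ∀ j, IsUnit (block X j).det := by
  rw [ae_all_iff]
  intro j
  have h := ae_ne_zero_of_differentiable
    (g := fun X : Fin k × Fin n × Fin n → ℂ => (block X j).det)
    (differentiable_det fun a b => by simp only [block_apply]; fun_prop)
    (x₀ := unblock fun _ => 1) (by simp)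
  filter_upwards [h] with X hX using hX.isUnit

theorem exists_sorted_perm {d : Fin n → ℂ} (hd : Function.Injective d) :
    ∃ σ : Equiv.Perm (Fin n), d ∘ σ ∈ sortedSet n := by
  refine ⟨Tuple.sort (lexKey ∘ d), ?_⟩
  have hm : Monotone (lexKey ∘ d ∘ Tuple.sort (lexKey ∘ d)) := Tuple.monotone_sort (lexKey ∘ d)
  exact hm.strictMono_of_injective
    (lexKey_injective.comp (hd.comp (Equiv.injective _)))

theorem exists_sorted_diagonalization {M : Matrix (Fin n) (Fin n) ℂ}
    (h : ∃ (F : Matrix (Fin n) (Fin n) ℂ) (d : Fin n → ℂ),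
      IsUnit F.det ∧ Function.Injective d ∧ M * F = F * Matrix.diagonal d) :
    ∃ (F : Matrix (Fin n) (Fin n) ℂ) (d : Fin n → ℂ),
      IsUnit F.det ∧ d ∈ sortedSet n ∧ M * F = F * Matrix.diagonal d := by
  obtain ⟨F, d, hF, hd, hM⟩ := h
  obtain ⟨σ, hσ⟩ := exists_sorted_perm hd
  refine ⟨F.submatrix id σ, d ∘ σ, ?_, hσ, ?_⟩
  · rw [Matrix.det_permute']
    exact ((Units.isUnit (Equiv.Perm.sign σ)).map (Int.castRingHom ℂ)).mul hF
  · ext i j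
    have := congrFun (congrFun hM i) (σ j)
    rw [Matrix.mul_diagonal] at this ⊢
    rw [Matrix.submatrix_apply, Function.comp_apply, id, ← this]
    simp [Matrix.mul_apply]

theorem ae_exists_diagonalization {ε : Fin (k + 1) → ℤ} (hε : ∀ j, ε j = 1 ∨ ε j = -1) :
    ∀ᵐ X : Fin (k + 1) × Fin n × Fin n → ℂ, (∀ j, IsUnit (block X j).det) ∧
      ∃ (F : Matrix (Fin n) (Fin n) ℂ) (d : Fin n → ℂ), IsUnit F.det ∧ d ∈ sortedSet n ∧
        signedProduct ε (block X) * F = F * Matrix.diagonal d := by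
  filter_upwards [ae_nodup_roots_adjugateProduct ε, ae_isUnit_det_block] with X h1 h2
  refine ⟨h2, exists_sorted_diagonalization ?_⟩
  obtain ⟨F, d, hF, hd, hM⟩ := Matrix.exists_diagonalization h1
  have hc : (∏ j, if ε j = 1 then 1 else (block X j).det) ≠ 0 :=
    Finset.prod_ne_zero_iff.2 fun j _ => by
      split_ifs
      · exact one_ne_zero
      · exact (h2 j).ne_zero
  set c := ∏ j, if ε j = 1 then 1 else (block X j).det
  refine ⟨F, c⁻¹ • d, hF, fun i j hij => hd ?_, ?_⟩
  · simpa [hc] using hij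
  · rw [adjugateProduct_eq_smul hε h2, Matrix.smul_mul] at hM
    have : signedProduct ε (block X) * F = c⁻¹ • (c • (signedProduct ε (block X) * F)) := by
      rw [smul_smul, inv_mul_cancel₀ hc, one_smul]
    rw [this, hM, Matrix.diagonal_smul, Matrix.mul_smul]

/-- The eigenframe `F` of the product is transported through the factors: `G_j` is the inverse of
the product of the first `j` signed factors, applied to `F`. In these frames every factor becomes
the identity except the last, which closes the cycle and must carry all of `diagonal d`. -/
theorem exists_intertwining_frames {ε : Fin (k + 1) → ℤ} (hε : ∀ j, ε j = 1 ∨ ε j = -1)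
    {A : Fin (k + 1) → Matrix (Fin n) (Fin n) ℂ} (hA : ∀ j, IsUnit (A j).det)
    {F : Matrix (Fin n) (Fin n) ℂ} {d : Fin n → ℂ} (hF : IsUnit F.det)
    (hM : signedProduct ε A * F = F * Matrix.diagonal d) :
    ∃ (G B : Fin (k + 1) → Matrix (Fin n) (Fin n) ℂ), (∀ j, IsUnit (G j).det) ∧
      (∀ j, (B j).IsUpperTriangular) ∧ (∀ j a, B j a a ≠ 0) ∧
      (∀ a, ∏ j, B j a a ^ ε j = d a) ∧
      ∀ j, A j = G (src ε j) * B j * (G (tgt ε j))⁻¹ := by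
  have hAz : ∀ j, IsUnit (A j ^ ε j).det := fun j => by
    rcases Matrix.zpow_sign (hε j) (A j) with ⟨-, h⟩ | ⟨-, h⟩
    · rw [h]; exact hA j
    · rw [h]; exact Matrix.isUnit_nonsing_inv_det _ (hA j)
  let l := List.ofFn fun i => A i ^ ε i
  have hlen : l.length = k + 1 := List.length_ofFn
  have hunit : ∀ m, IsUnit (l.take m).prod.det := by
    intro m
    induction m with
    | zero => simp
    | succ m ih =>
      by_cases hm : m < l.length
      · rw [List.prod_take_succ l m hm, Matrix.det_mul]
        refine ih.mul ?_
        simp only [l, List.getElem_ofFn]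
        exact hAz _
      · rw [List.take_of_length_le (by omega)]
        rwa [List.take_of_length_le (by omega)] at ih
  have hprod : l.prod = signedProduct ε A := rfl
  have hd0 : ∀ a, d a ≠ 0 := by
    have h1 : IsUnit (signedProduct ε A * F).det := by
      rw [Matrix.det_mul, ← hprod, ← List.take_length (l := l)]
      exact (hunit _).mul hF
    rw [hM, Matrix.det_mul, Matrix.det_diagonal] at h1
    intro a
    exact Finset.prod_ne_zero_iff.1 (isUnit_of_mul_isUnit_right h1).ne_zero a (Finset.mem_univ a)
  let G : Fin (k + 1) → Matrix (Fin n) (Fin n) ℂ := fun j => (l.take j).prod⁻¹ * F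
  have hG : ∀ j, IsUnit (G j).det := fun j => by
    rw [Matrix.det_mul]
    exact (Matrix.isUnit_nonsing_inv_det _ (hunit j)).mul hF
  -- The entries are `d a ^ ε j`, so that the signed power `B j ^ ε j` of the last factor is
  -- `diagonal d` for either sign.
  let B : Fin (k + 1) → Matrix (Fin n) (Fin n) ℂ := fun j =>
    if j = Fin.last k then Matrix.diagonal (fun a => d a ^ ε j) else 1
  have hBu : ∀ j, (B j).IsUpperTriangular := fun j => by
    simp only [B]
    split_ifs
    · exact Matrix.blockTriangular_diagonal _
    · exact Matrix.blockTriangular_one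
  have hBd : ∀ j a, B j a a = if j = Fin.last k then d a ^ ε j else 1 := fun j a => by
    simp only [B]
    split_ifs <;> simp
  have hB0 : ∀ j a, B j a a ≠ 0 := fun j a => by
    rw [hBd]
    split_ifs
    · exact zpow_ne_zero _ (hd0 a)
    · exact one_ne_zero
  have hBz : ∀ j, B j ^ ε j = if j = Fin.last k then Matrix.diagonal d else 1 := fun j => by
    have hdu : IsUnit d := by
      rw [Pi.isUnit_iff]; exact fun a => (hd0 a).isUnit
    rcases hε j with hj | hj
    · simp [B, hj]
    · simp only [B, hj]
      split_ifs
      · rw [Matrix.zpow_neg_one]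
        refine Matrix.inv_eq_left_inv ?_
        rw [Matrix.diagonal_mul_diagonal]
        have : (fun i => d i * d i ^ (-1 : ℤ)) = fun _ => 1 := by
          funext i
          rw [zpow_neg_one, mul_inv_cancel₀ (hd0 i)]
        rw [this, Matrix.diagonal_one]
      · simp
  have hstep : ∀ j, A j ^ ε j * G (j + 1) = G j * B j ^ ε j := by
    intro j
    have hts := List.prod_take_succ l j (by rw [hlen]; exact j.2)
    have hget : l[(j : ℕ)]'(by rw [hlen]; exact j.2) = A j ^ ε j := by
      simp only [l, List.getElem_ofFn]
    rw [hget] at hts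
    rw [hBz]
    by_cases hj : j = Fin.last k
    · subst hj
      have hall : l.take (((Fin.last k : Fin (k + 1)) : ℕ) + 1) = l := by
        rw [List.take_of_length_le]; rw [hlen]; simp
      rw [hall, hprod] at hts
      rw [if_pos rfl, Fin.last_add_one]
      have hG0 : G 0 = F := by simp [G]
      rw [hG0]
      simp only [G]
      rw [Matrix.mul_assoc, ← hM, hts, Matrix.mul_assoc, Matrix.nonsing_inv_mul_cancel_left _ _
        (hunit _)]
    · have hj1 : ((j + 1 : Fin (k + 1)) : ℕ) = j + 1 := by
        rw [Fin.val_add_one, if_neg hj]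
      rw [if_neg hj, Matrix.mul_one]
      simp only [G, hj1]
      rw [hts, Matrix.mul_inv_rev, ← Matrix.mul_assoc, Matrix.mul_nonsing_inv_cancel_left _ _
        (hAz j)]
  refine ⟨G, B, hG, hBu, hB0, fun a => ?_, fun j => ?_⟩
  · simp only [hBd]
    rw [Finset.prod_eq_single (Fin.last k)]
    · rw [if_pos rfl, ← zpow_mul]
      rcases hε (Fin.last k) with h | h <;> simp [h]
    · intro j _ hj
      rw [if_neg hj, one_zpow]
    · simp
  · have h := hstep j
    rcases hε j with hj | hj
    · rw [hj, zpow_one, zpow_one] at h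
      simp only [src, tgt, hj, if_true]
      rw [← h, Matrix.mul_nonsing_inv_cancel_right _ _ (hG _)]
    · have hne : ¬ ((-1 : ℤ) = 1) := by norm_num
      rw [hj, Matrix.zpow_neg_one, Matrix.zpow_neg_one] at h
      simp only [src, tgt, hj, hne, if_false]
      have hBi : IsUnit (B j).det := (hBu j).isUnit_det (hB0 j)
      have h2 : G (j + 1) * B j = A j * G j := by
        have h3 := congrArg (fun Z => A j * Z * B j) h
        simp only [Matrix.mul_assoc] at h3
        rw [Matrix.mul_nonsing_inv_cancel_left _ _ (hA j), Matrix.nonsing_inv_mul _ hBi,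
          Matrix.mul_one] at h3
        exact h3
      rw [h2, Matrix.mul_nonsing_inv_cancel_right _ _ (hG _)]

end GenericMatrices

/-! ### The parametrization covers almost every family. -/

section ConullImage

variable {n k : ℕ}

/-- After taking signed powers the frame factors are `s j / s (j + 1)`, whose product over the cycle
is `1`. Thus triangular changes of frame do not alter the eigenvalues `z_a`. -/
theorem prod_frame_zpow {ε : Fin (k + 1) → ℤ} (hε : ∀ j, ε j = 1 ∨ ε j = -1)
    {s : Fin (k + 1) → ℂ} (hs : ∀ j, s j ≠ 0) (b : Fin (k + 1) → ℂ) :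
    ∏ j, (s (src ε j) * b j * (s (tgt ε j))⁻¹) ^ ε j = ∏ j, b j ^ ε j := by
  have h : ∀ j, (s (src ε j) * b j * (s (tgt ε j))⁻¹) ^ ε j =
      s j * (s (j + 1))⁻¹ * b j ^ ε j := by
    intro j
    rcases hε j with hj | hj
    · simp only [src, tgt, hj, if_true, zpow_one]; ring
    · have hne : ¬ ((-1 : ℤ) = 1) := by norm_num
      simp only [src, tgt, hj, hne, if_false, zpow_neg_one, mul_inv_rev, inv_inv]
      ring
  simp only [h]
  have h2 : ∏ j, s (j + 1) = ∏ j, s j := Equiv.prod_comp (Equiv.addRight (1 : Fin (k + 1))) s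
  rw [Finset.prod_mul_distrib, Finset.prod_mul_distrib, Finset.prod_inv_distrib, h2,
    mul_inv_cancel₀ (Finset.prod_ne_zero_iff.2 fun j _ => hs j), one_mul]

theorem differentiable_block_mul (F : Matrix (Fin n) (Fin n) ℂ) (j : Fin k) (a b : Fin n) :
    Differentiable ℂ fun G : Fin k × Fin n × Fin n → ℂ => (block G j * F) a b := by
  simp only [Matrix.mul_apply, block_apply]
  fun_prop

/-- The leading principal minors of `G_j * F_j` are polynomial in `G` and equal `1` at `G_j =
F_j⁻¹`, so almost surely none of them vanishes. -/
theorem ae_exists_unipotentLower_mul_upper {F : Fin k → Matrix (Fin n) (Fin n) ℂ}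
    (hF : ∀ j, IsUnit (F j).det) :
    ∀ᵐ G : Fin k × Fin n × Fin n → ℂ, ∀ j, ∃ L U : Matrix (Fin n) (Fin n) ℂ,
      IsUnipotentLower L ∧ U.IsUpperTriangular ∧ block G j * F j = L * U := by
  rw [ae_all_iff]
  intro j
  have h : ∀ᵐ G : Fin k × Fin n × Fin n → ℂ, ∀ a : Fin n,
      ((block G j * F j).toSquareBlockProp (fun c => c < a)).det ≠ 0 := by
    rw [ae_all_iff]
    intro a
    refine ae_ne_zero_of_differentiable (g := fun G : Fin k × Fin n × Fin n → ℂ =>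
      ((block G j * F j).toSquareBlockProp (fun c => c < a)).det)
      (differentiable_det fun c d => differentiable_block_mul _ _ _ _)
      (x₀ := unblock fun j => (F j)⁻¹) ?_
    rw [block_unblock, Matrix.nonsing_inv_mul _ (hF j)]
    have : (1 : Matrix (Fin n) (Fin n) ℂ).toSquareBlockProp (fun c => c < a) = 1 := by
      ext c d
      simp [Matrix.toSquareBlockProp_def, Matrix.one_apply, Subtype.ext_iff]
    rw [this, Matrix.det_one]
    exact one_ne_zero
  filter_upwards [h] with G hG
  exact Matrix.exists_unipotentLower_mul_upper _ fun a => (hG a).isUnit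

theorem measurable_lexKey_lt {α : Type*} [MeasurableSpace α] {f g : α → ℂ} (hf : Measurable f)
    (hg : Measurable g) : MeasurableSet {x | lexKey (f x) < lexKey (g x)} := by
  have : {x | lexKey (f x) < lexKey (g x)} =
      {x | (f x).re < (g x).re} ∪ ({x | (f x).re = (g x).re} ∩ {x | (f x).im < (g x).im}) := by
    ext x
    simp [lexKey, Prod.Lex.toLex_lt_toLex]
  rw [this]
  have h1 := Complex.measurable_re.comp hf
  have h2 := Complex.measurable_re.comp hg
  have h3 := Complex.measurable_im.comp hf
  have h4 := Complex.measurable_im.comp hg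
  exact (measurableSet_lt h1 h2).union ((measurableSet_eq_fun h1 h2).inter (measurableSet_lt h3 h4))

theorem measurableSet_sortedSet (n : ℕ) : MeasurableSet (sortedSet n) := by
  have : sortedSet n = ⋂ i, ⋂ j, {z | i < j → lexKey (z i) < lexKey (z j)} := by
    ext z
    simp only [sortedSet, StrictMono, Function.comp, Set.mem_ofPred_eq, Set.mem_iInter]
  rw [this]
  refine MeasurableSet.iInter fun i => MeasurableSet.iInter fun j => ?_
  by_cases h : i < j
  · simp only [h, true_imp_iff]
    exact measurable_lexKey_lt (measurable_pi_apply i) (measurable_pi_apply j)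
  · simp [h]

theorem Measurable.zpow_sign {α : Type*} [MeasurableSpace α] {f : α → ℂ} (hf : Measurable f)
    (m : ℤ) : Measurable fun x => f x ^ m := by
  rcases m with m | m
  · simpa using hf.pow_const m
  · simp only [zpow_negSucc]
    exact (hf.pow_const _).inv

theorem measurable_diagProd (ε : Fin k → ℤ) : Measurable (diagProd (n := n) ε) := by
  refine measurable_pi_lambda _ fun a => ?_
  exact Finset.measurable_prod _ fun j _ => (measurable_pi_apply (j, a, a)).zpow_sign (ε j)

theorem measurableSet_regularSet (ε : Fin k → ℤ) : MeasurableSet (regularSet (n := n) ε) := by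
  have h : {X : Fin k × Fin n × Fin n → ℂ | ∀ j a, X (j, a, a) ≠ 0} =
      ⋂ j, ⋂ a, {X | X (j, a, a) ≠ 0} := by
    ext; simp
  have h2 : MeasurableSet {X : Fin k × Fin n × Fin n → ℂ | ∀ j a, X (j, a, a) ≠ 0} := by
    rw [h]
    exact MeasurableSet.iInter fun j => MeasurableSet.iInter fun a =>
      (measurableSet_singleton (0 : ℂ)).compl.preimage (measurable_pi_apply _)
  exact h2.inter (measurable_diagProd ε (measurableSet_sortedSet n))

/-- Injectivity is essential here: a continuous injective image of a Borel set is Borel. -/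
theorem measurableSet_image_assemble {ε : Fin (k + 1) → ℤ} (hε : ∀ j, ε j = 1 ∨ ε j = -1) :
    MeasurableSet (assemble ε '' regularSet (n := n) ε) :=
  (measurableSet_regularSet ε).image_of_continuousOn_injOn
    (differentiable_assemble ε).continuous.continuousOn (injOn_assemble hε)

theorem measurable_matrix_mul {α : Type*} [MeasurableSpace α] {f g : α → Matrix (Fin n) (Fin n) ℂ}
    (hf : ∀ i j, Measurable fun x => f x i j) (hg : ∀ i j, Measurable fun x => g x i j)
    (i j : Fin n) : Measurable fun x => (f x * g x) i j := by
  simp only [Matrix.mul_apply]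
  exact Finset.measurable_sum _ fun c _ => (hf i c).mul (hg c j)

theorem measurable_matrix_det {α : Type*} [MeasurableSpace α] {f : α → Matrix (Fin n) (Fin n) ℂ}
    (hf : ∀ i j, Measurable fun x => f x i j) : Measurable fun x => (f x).det := by
  simp only [Matrix.det_apply']
  exact Finset.measurable_sum _ fun σ _ => (Finset.measurable_prod _ fun i _ => hf _ _).const_mul _

theorem measurable_matrix_inv {α : Type*} [MeasurableSpace α] {f : α → Matrix (Fin n) (Fin n) ℂ}
    (hf : ∀ i j, Measurable fun x => f x i j) (i j : Fin n) :
    Measurable fun x => (f x)⁻¹ i j := by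
  simp only [Matrix.inv_def, Matrix.smul_apply, Ring.inverse_eq_inv', smul_eq_mul,
    Matrix.adjugate_apply]
  refine (measurable_matrix_det hf).inv.mul (measurable_matrix_det fun a b => ?_)
  simp only [Matrix.updateRow_apply]
  split_ifs
  · exact measurable_const
  · exact hf a b

/-- The action of tuples of matrices on tuples of matrices by change of frames. -/
noncomputable def frameAction (ε : Fin (k + 1) → ℤ) (G X : Fin (k + 1) × Fin n × Fin n → ℂ) :
    Fin (k + 1) × Fin n × Fin n → ℂ :=
  unblock fun j => block G (src ε j) * block X j * (block G (tgt ε j))⁻¹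

theorem measurable_frameAction (ε : Fin (k + 1) → ℤ) :
    Measurable fun p : (Fin (k + 1) × Fin n × Fin n → ℂ) × (Fin (k + 1) × Fin n × Fin n → ℂ) =>
      frameAction ε p.1 p.2 := by
  refine measurable_pi_lambda _ ?_
  rintro ⟨j, a, b⟩
  have h1 : ∀ l a b, Measurable fun p : (Fin (k + 1) × Fin n × Fin n → ℂ) ×
      (Fin (k + 1) × Fin n × Fin n → ℂ) => block p.1 l a b := fun l a b =>
    (measurable_pi_apply (l, a, b)).comp measurable_fst
  have h2 : ∀ l a b, Measurable fun p : (Fin (k + 1) × Fin n × Fin n → ℂ) ×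
      (Fin (k + 1) × Fin n × Fin n → ℂ) => block p.2 l a b := fun l a b =>
    (measurable_pi_apply (l, a, b)).comp measurable_snd
  exact measurable_matrix_mul (measurable_matrix_mul (h1 _) (h2 _))
    (measurable_matrix_inv (h1 _)) a b

/-- Simultaneous two-sided multiplication by invertible matrices. -/
noncomputable def twoSidedMulEquiv {L N : Fin k → Matrix (Fin n) (Fin n) ℂ}
    (hL : ∀ j, IsUnit (L j).det) (hN : ∀ j, IsUnit (N j).det) :
    (Fin k × Fin n × Fin n → ℂ) ≃ₗ[ℂ] (Fin k × Fin n × Fin n → ℂ) :=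
  LinearEquiv.ofLinearMap (twoSidedMul L N) (twoSidedMul (fun j => (L j)⁻¹) fun j => (N j)⁻¹)
    (LinearMap.ext fun X => by
      change unblock (fun j => L j * ((L j)⁻¹ * block X j * (N j)⁻¹) * N j) = X
      simp only [Matrix.mul_assoc, Matrix.mul_nonsing_inv_cancel_left _ _ (hL _),
        Matrix.nonsing_inv_mul _ (hN _), Matrix.mul_one]
      rfl)
    (LinearMap.ext fun X => by
      change unblock (fun j => (L j)⁻¹ * (L j * block X j * N j) * (N j)⁻¹) = X
      simp only [Matrix.mul_assoc, Matrix.nonsing_inv_mul_cancel_left _ _ (hL _),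
        Matrix.mul_nonsing_inv _ (hN _), Matrix.mul_one]
      rfl)

/-- The upper factors `U` of the frames are absorbed into the triangular matrices, and
`prod_frame_zpow` keeps the diagonal products sorted. -/
theorem frame_mem_image {ε : Fin (k + 1) → ℤ} (hε : ∀ j, ε j = 1 ∨ ε j = -1)
    {L U B : Fin (k + 1) → Matrix (Fin n) (Fin n) ℂ} (hL : ∀ j, IsUnipotentLower (L j))
    (hU : ∀ j, (U j).IsUpperTriangular) (hU0 : ∀ j, IsUnit (U j).det)
    (hB : ∀ j, (B j).IsUpperTriangular) (hB0 : ∀ j a, B j a a ≠ 0)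
    (hs : (fun a => ∏ j, B j a a ^ ε j) ∈ sortedSet n) :
    unblock (fun j => (L (src ε j) * U (src ε j)) * B j * (L (tgt ε j) * U (tgt ε j))⁻¹) ∈
      assemble ε '' regularSet ε := by
  have hR : ∀ j, (U (src ε j) * B j * (U (tgt ε j))⁻¹).IsUpperTriangular := fun j =>
    ((hU _).mul (hB _)).mul ((hU _).inv_of_isUnit (hU0 _))
  have hRd : ∀ j a, (U (src ε j) * B j * (U (tgt ε j))⁻¹) a a =
      U (src ε j) a a * B j a a * (U (tgt ε j) a a)⁻¹ := fun j a => by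
    rw [((hU _).mul (hB _)).mul_apply_diag ((hU _).inv_of_isUnit (hU0 _)) Function.injective_id,
      (hU _).mul_apply_diag (hB _) Function.injective_id,
      (hU _).inv_apply_diag (hU0 _) Function.injective_id]
  have hUd := fun j => (hU j).diag_ne_zero (hU0 j)
  choose X hX1 hX2 using fun j => exists_parts_eq (hL j) (hR j)
  have hXd : ∀ j a, X j a a = U (src ε j) a a * B j a a * (U (tgt ε j) a a)⁻¹ := fun j a => by
    rw [← hRd, ← hX2, upperPart_apply_diag]
  refine ⟨unblock X, ⟨fun j a => ?_, ?_⟩, ?_⟩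
  · change X j a a ≠ 0
    rw [hXd]
    exact mul_ne_zero (mul_ne_zero (hUd _ a) (hB0 j a)) (inv_ne_zero (hUd _ a))
  · have : diagProd ε (unblock X) = fun a => ∏ j, B j a a ^ ε j := by
      funext a
      change ∏ j, X j a a ^ ε j = _
      simp only [hXd]
      exact prod_frame_zpow hε (s := fun j => U j a a) (fun j => hUd j a) fun j => B j a a
    rw [this]
    exact hs
  · simp only [assemble, block_unblock, hX1, hX2, Matrix.mul_inv_rev, Matrix.mul_assoc]

/-- The eigenframes of a given family need not have LU factorizations, but they do after
multiplication by almost every `G`. By Fubini a single invertible `G` serves almost every family,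
and its frame action is an invertible linear map, which preserves null sets. -/
theorem ae_mem_image_assemble {ε : Fin (k + 1) → ℤ} (hε : ∀ j, ε j = 1 ∨ ε j = -1) :
    ∀ᵐ X : Fin (k + 1) × Fin n × Fin n → ℂ, X ∈ assemble ε '' regularSet ε := by
  have h1 : ∀ᵐ X : Fin (k + 1) × Fin n × Fin n → ℂ, ∀ᵐ G : Fin (k + 1) × Fin n × Fin n → ℂ,
      frameAction ε G X ∈ assemble ε '' regularSet ε := by
    filter_upwards [ae_exists_diagonalization hε] with X hX
    obtain ⟨hX0, F, d, hF, hd, hM⟩ := hX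
    obtain ⟨F, B, hF, hB, hB0, hBd, hXF⟩ := exists_intertwining_frames hε hX0 hF hM
    filter_upwards [ae_exists_unipotentLower_mul_upper hF, ae_isUnit_det_block] with G hG hG0
    choose L U hL hU hLU using hG
    have hU0 : ∀ j, IsUnit (U j).det := fun j => by
      have h := congrArg Matrix.det (hLU j)
      rw [Matrix.det_mul, Matrix.det_mul, (hL j).det, one_mul] at h
      rw [← h]
      exact (hG0 j).mul (hF j)
    have := frame_mem_image hε hL hU hU0 hB hB0 (by simp only [hBd]; exact hd)
    have heq : frameAction ε G X = unblock fun j =>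
        (L (src ε j) * U (src ε j)) * B j * (L (tgt ε j) * U (tgt ε j))⁻¹ := by
      refine congrArg unblock (funext fun j => ?_)
      rw [hXF, ← hLU, ← hLU, Matrix.mul_inv_rev]
      simp only [Matrix.mul_assoc]
    rw [heq]
    exact this
  have hm : MeasurableSet {p : (Fin (k + 1) × Fin n × Fin n → ℂ) ×
      (Fin (k + 1) × Fin n × Fin n → ℂ) |
      frameAction ε p.2 p.1 ∈ assemble ε '' regularSet ε} :=
    ((measurable_frameAction ε).comp measurable_swap) (measurableSet_image_assemble hε)
  rw [Measure.ae_ae_comm hm] at h1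
  obtain ⟨G, hG, hG0⟩ := (h1.and ae_isUnit_det_block).exists
  exact ae_of_ae_comp_linearEquiv (twoSidedMulEquiv (L := fun j => block G (src ε j))
    (N := fun j => (block G (tgt ε j))⁻¹) (fun j => hG0 _)
    fun j => Matrix.isUnit_nonsing_inv_det _ (hG0 _)) hG

end ConullImage

/-! ### Integrals over product measures and the Gaussian weight. -/

section ProductMeasures

theorem lintegral_fin_prod_eq_prod {n : ℕ} {E : Type*} [MeasurableSpace E]
    {μ : Fin n → Measure E} [∀ i, SigmaFinite (μ i)] {f : Fin n → E → ℝ≥0∞}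
    (hf : ∀ i, Measurable (f i)) :
    ∫⁻ x, ∏ i, f i (x i) ∂Measure.pi μ = ∏ i, ∫⁻ x, f i x ∂μ i := by
  induction n with
  | zero => simp
  | succ n ih =>
    rw [← ((measurePreserving_piFinSuccAbove μ 0).symm).lintegral_comp_emb
      (MeasurableEquiv.measurableEmbedding _)]
    simp_rw [MeasurableEquiv.piFinSuccAbove_symm_apply, Fin.insertNthEquiv,
      Fin.prod_univ_succ, Fin.insertNth_zero, Equiv.coe_fn_mk, Fin.cons_succ,
      Fin.zero_succAbove, cast_eq, Fin.cons_zero]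
    have hm : Measurable fun x : Fin n → E => ∏ i, f i.succ (x i) := (Finset.measurable_prod _ fun i _ =>
      (hf i.succ).comp (measurable_pi_apply i))
    have h := lintegral_prod_mul (μ := μ 0) (ν := Measure.pi fun j : Fin n => μ j.succ)
      (hf 0).aemeasurable hm.aemeasurable
    rw [← ih fun i => hf i.succ]
    exact h

theorem lintegral_fintype_prod_eq_prod {ι E : Type*} [Fintype ι] [MeasurableSpace E]
    {μ : ι → Measure E} [∀ i, SigmaFinite (μ i)] {f : ι → E → ℝ≥0∞}
    (hf : ∀ i, Measurable (f i)) :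
    ∫⁻ x, ∏ i, f i (x i) ∂Measure.pi μ = ∏ i, ∫⁻ x, f i x ∂μ i := by
  let e := (Fintype.equivFin ι).symm
  rw [← (measurePreserving_piCongrLeft _ e).lintegral_comp_emb
    (MeasurableEquiv.measurableEmbedding _)]
  simp_rw [← e.prod_comp, MeasurableEquiv.coe_piCongrLeft, Equiv.piCongrLeft_apply_apply]
  exact lintegral_fin_prod_eq_prod fun i => hf (e i)

theorem Measure.pi_withDensity {ι E : Type*} [Fintype ι] [MeasurableSpace E]
    {μ : ι → Measure E} [∀ i, SigmaFinite (μ i)] {f : ι → E → ℝ≥0∞}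
    (hf : ∀ i, Measurable (f i)) [∀ i, SigmaFinite ((μ i).withDensity (f i))] :
    Measure.pi (fun i => (μ i).withDensity (f i)) =
      (Measure.pi μ).withDensity fun x => ∏ i, f i (x i) := by
  refine Measure.pi_eq fun s hs => ?_
  rw [withDensity_apply _ (MeasurableSet.univ_pi hs), ← lintegral_indicator
    (MeasurableSet.univ_pi hs)]
  have h : ∀ x : ι → E, (Set.univ.pi s).indicator (fun x => ∏ i, f i (x i)) x =
      ∏ i, (s i).indicator (f i) (x i) := by
    intro x
    by_cases hx : x ∈ Set.univ.pi s
    · rw [Set.indicator_of_mem hx]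
      exact Finset.prod_congr rfl fun i _ => (Set.indicator_of_mem (hx i trivial) _).symm
    · rw [Set.indicator_of_notMem hx]
      simp only [Set.mem_univ_pi, not_forall] at hx
      obtain ⟨i, hi⟩ := hx
      exact (Finset.prod_eq_zero (Finset.mem_univ i) (Set.indicator_of_notMem hi _)).symm
  simp only [h]
  rw [lintegral_fintype_prod_eq_prod fun i => (hf i).indicator (hs i)]
  refine Finset.prod_congr rfl fun i _ => ?_
  rw [lintegral_indicator (hs i), withDensity_apply _ (hs i)]

theorem lintegral_piEquivPiSubtypeProd {ι : Type*} [Fintype ι] (p : ι → Prop) [DecidablePred p]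
    {F : (ι → ℂ) → ℝ≥0∞} (hF : Measurable F) :
    ∫⁻ x, F x = ∫⁻ y : {i // p i} → ℂ, ∫⁻ z : {i // ¬ p i} → ℂ,
      F ((MeasurableEquiv.piEquivPiSubtypeProd (fun _ => ℂ) p).symm (y, z)) := by
  rw [← ((volume_preserving_piEquivPiSubtypeProd (fun _ : ι => ℂ) p).symm).lintegral_comp_emb
    (MeasurableEquiv.measurableEmbedding _), Measure.volume_eq_prod, lintegral_prod]
  exact (hF.comp (MeasurableEquiv.measurable _)).aemeasurable

theorem exists_lintegral_comp_linearEquiv {ι : Type*} [Fintype ι] (f : (ι → ℂ) ≃ₗ[ℂ] (ι → ℂ)) :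
    ∃ c : ℝ≥0∞, c ≠ 0 ∧ c ≠ ∞ ∧ ∀ g : (ι → ℂ) → ℝ≥0∞, ∫⁻ x, g (f x) = c * ∫⁻ x, g x := by
  have hdet : LinearMap.det ((f.restrictScalars ℝ : (ι → ℂ) ≃ₗ[ℝ] (ι → ℂ)) :
      (ι → ℂ) →ₗ[ℝ] (ι → ℂ)) ≠ 0 := (LinearEquiv.isUnit_det' _).ne_zero
  refine ⟨ENNReal.ofReal |(LinearMap.det ((f.restrictScalars ℝ : (ι → ℂ) ≃ₗ[ℝ] (ι → ℂ)) :
      (ι → ℂ) →ₗ[ℝ] (ι → ℂ)))⁻¹|, ?_, ENNReal.ofReal_ne_top, fun g => ?_⟩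
  · rw [Ne, ENNReal.ofReal_eq_zero, not_le]
    exact abs_pos.2 (inv_ne_zero hdet)
  · have h := Measure.map_linearMap_addHaar_eq_smul_addHaar (volume : Measure (ι → ℂ)) hdet
    rw [← smul_eq_mul, ← lintegral_smul_measure, ← h]
    exact (lintegral_map_equiv g
      (f.restrictScalars ℝ).toContinuousLinearEquiv.toHomeomorph.toMeasurableEquiv).symm

/-- The unnormalized standard Gaussian density on a finite power of `ℂ`. -/
noncomputable def gaussWeight {ι : Type*} [Fintype ι] (x : ι → ℂ) : ℝ≥0∞ :=
  ENNReal.ofReal (Real.exp (-∑ i, ‖x i‖ ^ 2))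

theorem gaussWeight_eq_prod {ι : Type*} [Fintype ι] (x : ι → ℂ) :
    gaussWeight x = ∏ i, ENNReal.ofReal (Real.exp (-‖x i‖ ^ 2)) := by
  rw [gaussWeight, ← Finset.sum_neg_distrib, Real.exp_sum,
    ENNReal.ofReal_prod_of_nonneg fun _ _ => (Real.exp_pos _).le]

theorem measurable_gaussWeight {ι : Type*} [Fintype ι] :
    Measurable (gaussWeight : (ι → ℂ) → ℝ≥0∞) := by
  unfold gaussWeight
  fun_prop

theorem lintegral_norm_pow_mul_exp_lt_top (m : ℕ) :
    ∫⁻ z : ℂ, ENNReal.ofReal (‖z‖ ^ m * Real.exp (-‖z‖ ^ 2)) < ∞ := by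
  have h := Complex.integral_rpow_mul_exp_neg_rpow (p := 2) (q := m) (by norm_num)
    (by have : (0 : ℝ) ≤ m := m.cast_nonneg
        linarith)
  have hpos : 2 * Real.pi / 2 * Real.Gamma (((m : ℝ) + 2) / 2) ≠ 0 :=
    mul_ne_zero (by positivity) (Real.Gamma_pos_of_pos (by positivity)).ne'
  -- A nonzero Bochner integral certifies integrability, since the integral of a non-integrable
  -- function is `0` by convention.
  rw [← h] at hpos
  have hi := Integrable.of_integral_ne_zero hpos
  have h2 := hi.lintegral_lt_top
  simpa using h2

theorem lintegral_gaussWeight_ne_top {ι : Type*} [Fintype ι] :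
    ∫⁻ x : ι → ℂ, gaussWeight x ≠ ∞ := by
  simp only [gaussWeight_eq_prod]
  rw [volume_pi, lintegral_fintype_prod_eq_prod
    (f := fun _ z => ENNReal.ofReal (Real.exp (-‖z‖ ^ 2))) fun i => by fun_prop]
  refine ENNReal.prod_ne_top fun i _ => ?_
  have := lintegral_norm_pow_mul_exp_lt_top 0
  simpa using this.ne

theorem lintegral_gaussWeight_ne_zero {ι : Type*} [Fintype ι] :
    ∫⁻ x : ι → ℂ, gaussWeight x ≠ 0 := by
  intro h
  rw [lintegral_eq_zero_iff measurable_gaussWeight] at h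
  obtain ⟨x, hx⟩ := h.exists
  simp only [gaussWeight, Pi.zero_apply, ENNReal.ofReal_eq_zero] at hx
  exact absurd hx (not_le.2 (Real.exp_pos _))

end ProductMeasures

/-! ### Integrating out the lower triangular variables. -/

section ChangeOfVariables

variable {n k : ℕ}

/-- The density of the generalized Schur parametrization against a function of the diagonal
products, on the regular set. -/
noncomputable def schurWeight (ε : Fin k → ℤ) (H : (Fin n → ℂ) → ℝ≥0∞)
    (X : Fin k × Fin n × Fin n → ℂ) : ℝ≥0∞ :=
  (regularSet ε).indicator
    (fun X => ENNReal.ofReal (schurJacobian ε X) * H (diagProd ε X)) X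

theorem measurable_schurJacobian {ε : Fin k → ℤ} :
    Measurable (schurJacobian (n := n) ε) := by
  refine Measurable.mul ?_ ?_
  · refine Finset.measurable_prod _ fun i _ => Finset.measurable_prod _ fun j _ => ?_
    have h := measurable_diagProd (n := n) ε
    exact (((measurable_pi_apply i).comp h).sub ((measurable_pi_apply j).comp h)).norm.pow_const 2
  · refine Finset.measurable_prod _ fun j _ => Finset.measurable_prod _ fun a _ => ?_
    have h : Measurable fun X : Fin k × Fin n × Fin n → ℂ => X (j, a, a) ^
      ((1 - ε j) * ((n : ℤ) - 1)) := (measurable_pi_apply (j, a, a)).zpow_sign _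
    simpa only [norm_zpow] using h.norm

theorem measurable_schurWeight {ε : Fin k → ℤ} {H : (Fin n → ℂ) → ℝ≥0∞} (hH : Measurable H) :
    Measurable (schurWeight ε H) :=
  (measurable_schurJacobian.ennreal_ofReal.mul (hH.comp (measurable_diagProd ε))).indicator
    (measurableSet_regularSet ε)

theorem schurWeight_mono {ε : Fin k → ℤ} {H H' : (Fin n → ℂ) → ℝ≥0∞} (h : ∀ z, H z ≤ H' z)
    (X : Fin k × Fin n × Fin n → ℂ) : schurWeight ε H X ≤ schurWeight ε H' X :=
  Set.indicator_le_indicator (by gcongr; exact h _)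

theorem schurWeight_congr (ε : Fin k → ℤ) (H : (Fin n → ℂ) → ℝ≥0∞)
    {X Y : Fin k × Fin n × Fin n → ℂ} (h : ∀ j a, X (j, a, a) = Y (j, a, a)) :
    schurWeight ε H X = schurWeight ε H Y := by
  have hd : diagProd ε X = diagProd ε Y := by
    funext a; simp only [diagProd, h]
  have hr : X ∈ regularSet ε ↔ Y ∈ regularSet ε := by
    change (_ ∧ _) ↔ (_ ∧ _)
    simp only [h, hd]
  have hj : schurJacobian ε X = schurJacobian ε Y := by
    simp only [schurJacobian, hd, h]
  unfold schurWeight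
  by_cases hX : X ∈ regularSet ε
  · rw [Set.indicator_of_mem hX, Set.indicator_of_mem (hr.1 hX), hd, hj]
  · rw [Set.indicator_of_notMem hX, Set.indicator_of_notMem (mt hr.2 hX)]

/-- A diagonal change of frame fixes the diagonal products, hence the regular set, the Vandermonde
factor and `H`. Only the powers of the `|x_j|` change, by a factor independent of `X` and of `H`. -/
theorem exists_schurWeight_scale {ε : Fin (k + 1) → ℤ} (hε : ∀ j, ε j = 1 ∨ ε j = -1)
    {s : Fin (k + 1) → Fin n → ℂ} (hs : ∀ j a, s j a ≠ 0) :
    ∃ c : ℝ≥0∞, c ≠ 0 ∧ c ≠ ∞ ∧ ∀ (H : (Fin n → ℂ) → ℝ≥0∞)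
      (X Y : Fin (k + 1) × Fin n × Fin n → ℂ),
      (∀ j a, Y (j, a, a) = s (src ε j) a * X (j, a, a) * (s (tgt ε j) a)⁻¹) →
      schurWeight ε H X = c * schurWeight ε H Y := by
  let κ : ℝ := ∏ j, ∏ a, (‖s (src ε j) a‖ * ‖s (tgt ε j) a‖⁻¹) ^ ((1 - ε j) * ((n : ℤ) - 1))
  have hκ : 0 < κ := Finset.prod_pos fun j _ => Finset.prod_pos fun a _ =>
    zpow_pos (mul_pos (norm_pos_iff.2 (hs _ _)) (inv_pos.2 (norm_pos_iff.2 (hs _ _)))) _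
  refine ⟨ENNReal.ofReal κ⁻¹, ?_, ENNReal.ofReal_ne_top, fun H X Y h => ?_⟩
  · rw [Ne, ENNReal.ofReal_eq_zero, not_le]
    exact inv_pos.2 hκ
  have hd : diagProd ε Y = diagProd ε X := by
    funext a
    simp only [diagProd, h]
    exact prod_frame_zpow hε (s := fun j => s j a) (fun j => hs j a) fun j => X (j, a, a)
  have hr : X ∈ regularSet ε ↔ Y ∈ regularSet ε := by
    change (_ ∧ _) ↔ (_ ∧ _)
    simp only [h, hd]
    simp [hs]
  have hj : schurJacobian ε Y = κ * schurJacobian ε X := by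
    simp only [schurJacobian, hd, h, norm_mul, norm_inv, κ]
    rw [mul_left_comm]
    congr 1
    simp only [← Finset.prod_mul_distrib]
    refine Finset.prod_congr rfl fun j _ => Finset.prod_congr rfl fun a _ => ?_
    rw [← mul_zpow, mul_right_comm]
  unfold schurWeight
  by_cases hX : X ∈ regularSet ε
  · rw [Set.indicator_of_mem hX, Set.indicator_of_mem (hr.1 hX), hd, hj, ← mul_assoc,
      ← ENNReal.ofReal_mul (inv_pos.2 hκ).le, inv_mul_cancel_left₀ hκ.ne']
  · rw [Set.indicator_of_notMem hX, Set.indicator_of_notMem (mt hr.2 hX), mul_zero]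

/-- The change of variables formula on the regular set, where the map is injective; conullity of the
image removes the restriction on the left. -/
theorem lintegral_eq_lintegral_assemble {ε : Fin (k + 1) → ℤ} (hε : ∀ j, ε j = 1 ∨ ε j = -1)
    {F : (Fin (k + 1) × Fin n × Fin n → ℂ) → ℝ≥0∞} {H : (Fin n → ℂ) → ℝ≥0∞}
    (hFH : ∀ X ∈ regularSet ε, F (assemble ε X) = H (diagProd ε X)) :
    ∫⁻ A, F A * gaussWeight A = ∫⁻ X, schurWeight ε H X * gaussWeight (assemble ε X) := by
  have hW : (assemble ε '' regularSet (n := n) ε) =ᵐ[volume] Set.univ := by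
    rw [Filter.eventuallyEq_univ]
    exact ae_mem_image_assemble hε
  rw [← setLIntegral_univ, ← setLIntegral_congr hW,
    lintegral_image_eq_lintegral_abs_det_fderiv_mul volume (measurableSet_regularSet ε)
      (fun X _ => (hasFDerivAt_assemble ε X).hasFDerivWithinAt) (injOn_assemble hε),
    ← lintegral_indicator (measurableSet_regularSet ε)]
  refine lintegral_congr fun X => ?_
  unfold schurWeight
  by_cases hX : X ∈ regularSet ε
  · rw [Set.indicator_of_mem hX, Set.indicator_of_mem hX, abs_det_fderiv_assemble hε hX.1,
      hFH X hX, mul_assoc]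
  · rw [Set.indicator_of_notMem hX, Set.indicator_of_notMem hX, zero_mul]

/-- Gluing the strictly lower triangular entries with the upper triangular ones. -/
noncomputable def glue (y : {i : Fin k × Fin n × Fin n // i.2.2 < i.2.1} → ℂ)
    (z : {i : Fin k × Fin n × Fin n // ¬ i.2.2 < i.2.1} → ℂ) : Fin k × Fin n × Fin n → ℂ :=
  (MeasurableEquiv.piEquivPiSubtypeProd (fun _ => ℂ)
    fun i : Fin k × Fin n × Fin n => i.2.2 < i.2.1).symm (y, z)

theorem glue_apply_of_lt (y : {i : Fin k × Fin n × Fin n // i.2.2 < i.2.1} → ℂ)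
    (z : {i : Fin k × Fin n × Fin n // ¬ i.2.2 < i.2.1} → ℂ) {i : Fin k × Fin n × Fin n}
    (h : i.2.2 < i.2.1) : glue y z i = y ⟨i, h⟩ := dif_pos h

theorem glue_apply_of_not_lt (y : {i : Fin k × Fin n × Fin n // i.2.2 < i.2.1} → ℂ)
    (z : {i : Fin k × Fin n × Fin n // ¬ i.2.2 < i.2.1} → ℂ) {i : Fin k × Fin n × Fin n}
    (h : ¬ i.2.2 < i.2.1) : glue y z i = z ⟨i, h⟩ := dif_neg h

theorem gaussWeight_piEquivPiSubtypeProd {ι : Type*} [Fintype ι] (p : ι → Prop) [DecidablePred p]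
    (y : {i // p i} → ℂ) (z : {i // ¬ p i} → ℂ) :
    gaussWeight ((MeasurableEquiv.piEquivPiSubtypeProd (fun _ => ℂ) p).symm (y, z)) =
      gaussWeight y * gaussWeight z := by
  rw [gaussWeight_eq_prod, gaussWeight_eq_prod, gaussWeight_eq_prod,
    ← Fintype.prod_subtype_mul_prod_subtype p]
  congr 1
  · refine Finset.prod_congr rfl fun i _ => ?_
    have : (MeasurableEquiv.piEquivPiSubtypeProd (fun _ => ℂ) p).symm (y, z) i = y i :=
      dif_pos i.2
    rw [this]
  · refine Finset.prod_congr rfl fun i _ => ?_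
    have : (MeasurableEquiv.piEquivPiSubtypeProd (fun _ => ℂ) p).symm (y, z) i = z i :=
      dif_neg i.2
    rw [this]

/-- The upper triangular matrices with given entries. -/
noncomputable def upperMatrix (z : {i : Fin k × Fin n × Fin n // ¬ i.2.2 < i.2.1} → ℂ) (j : Fin k) :
    Matrix (Fin n) (Fin n) ℂ :=
  upperPart (block (glue 0 z) j)

theorem upperPart_block_glue (y : {i : Fin k × Fin n × Fin n // i.2.2 < i.2.1} → ℂ)
    (z : {i : Fin k × Fin n × Fin n // ¬ i.2.2 < i.2.1} → ℂ) (j : Fin k) :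
    upperPart (block (glue y z) j) = upperMatrix z j := by
  ext a b
  simp only [upperMatrix, upperPart, Matrix.of_apply, block_apply]
  split_ifs with h
  · rfl
  · rw [glue_apply_of_not_lt y z (i := (j, a, b)) h, glue_apply_of_not_lt 0 z (i := (j, a, b)) h]

theorem upperMatrix_apply (z : {i : Fin k × Fin n × Fin n // ¬ i.2.2 < i.2.1} → ℂ)
    (i : {i : Fin k × Fin n × Fin n // ¬ i.2.2 < i.2.1}) :
    upperMatrix z i.1.1 i.1.2.1 i.1.2.2 = z i := by
  simp only [upperMatrix, upperPart, Matrix.of_apply, block_apply, i.2, if_false]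
  exact glue_apply_of_not_lt 0 z i.2

theorem isUpperTriangular_upperMatrix (z : {i : Fin k × Fin n × Fin n // ¬ i.2.2 < i.2.1} → ℂ)
    (j : Fin k) : (upperMatrix z j).IsUpperTriangular := isUpperTriangular_upperPart _

theorem unipotentPart_block_glue (y : {i : Fin k × Fin n × Fin n // i.2.2 < i.2.1} → ℂ)
    (z : {i : Fin k × Fin n × Fin n // ¬ i.2.2 < i.2.1} → ℂ) (j : Fin k) :
    unipotentPart (block (glue y z) j) = unipotentPart (block (glue y 0) j) := by
  ext a b
  simp only [unipotentPart, Matrix.of_apply, block_apply]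
  split_ifs with h
  · rw [glue_apply_of_lt y z (i := (j, a, b)) h, glue_apply_of_lt y 0 (i := (j, a, b)) h]
  · rfl
  · rfl

/-- Two-sided multiplication of upper triangular matrices. -/
noncomputable def upperMul (P Q : Fin k → Matrix (Fin n) (Fin n) ℂ) :
    ({i : Fin k × Fin n × Fin n // ¬ i.2.2 < i.2.1} → ℂ) →ₗ[ℂ]
      ({i : Fin k × Fin n × Fin n // ¬ i.2.2 < i.2.1} → ℂ) where
  toFun z := fun i => (P i.1.1 * upperMatrix z i.1.1 * Q i.1.1) i.1.2.1 i.1.2.2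
  map_add' x y := by
    have h : ∀ j, upperMatrix (x + y) j = upperMatrix x j + upperMatrix y j := fun j => by
      ext a b
      by_cases h : b < a
      · simp [upperMatrix, upperPart, h]
      · have h1 := fun w : {i : Fin k × Fin n × Fin n // ¬ i.2.2 < i.2.1} → ℂ =>
          upperMatrix_apply w ⟨(j, a, b), h⟩
        simp only at h1
        simp only [Matrix.add_apply, h1, Pi.add_apply]
    funext i
    simp only [h, Matrix.mul_add, Matrix.add_mul, Matrix.add_apply, Pi.add_apply]
  map_smul' c x := by
    have h : ∀ j, upperMatrix (c • x) j = c • upperMatrix x j := fun j => by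
      ext a b
      by_cases h : b < a
      · simp [upperMatrix, upperPart, h]
      · have h1 := fun w : {i : Fin k × Fin n × Fin n // ¬ i.2.2 < i.2.1} → ℂ =>
          upperMatrix_apply w ⟨(j, a, b), h⟩
        simp only at h1
        simp only [Matrix.smul_apply, h1, Pi.smul_apply]
    funext i
    simp only [h, Matrix.mul_smul, Matrix.smul_mul, Matrix.smul_apply, Pi.smul_apply,
      RingHom.id_apply]

theorem upperMatrix_upperMul {P Q : Fin k → Matrix (Fin n) (Fin n) ℂ}
    (hP : ∀ j, (P j).IsUpperTriangular) (hQ : ∀ j, (Q j).IsUpperTriangular)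
    (z : {i : Fin k × Fin n × Fin n // ¬ i.2.2 < i.2.1} → ℂ) (j : Fin k) :
    upperMatrix (upperMul P Q z) j = P j * upperMatrix z j * Q j := by
  ext a b
  by_cases h : b < a
  · rw [isUpperTriangular_upperMatrix _ _ h,
      ((hP j).mul (isUpperTriangular_upperMatrix z j)).mul (hQ j) h]
  · exact upperMatrix_apply (upperMul P Q z) ⟨(j, a, b), h⟩

theorem upperMul_injective {P Q : Fin k → Matrix (Fin n) (Fin n) ℂ}
    (hP : ∀ j, (P j).IsUpperTriangular) (hQ : ∀ j, (Q j).IsUpperTriangular)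
    (hP0 : ∀ j, IsUnit (P j).det) (hQ0 : ∀ j, IsUnit (Q j).det) :
    Function.Injective (upperMul P Q) := by
  intro z w h
  have hm : ∀ j, upperMatrix z j = upperMatrix w j := fun j => by
    have h1 : P j * upperMatrix z j * Q j = P j * upperMatrix w j * Q j := by
      rw [← upperMatrix_upperMul hP hQ, ← upperMatrix_upperMul hP hQ, h]
    have h2 := congrArg (fun M => (P j)⁻¹ * (M * (Q j)⁻¹)) h1
    simpa only [Matrix.mul_nonsing_inv_cancel_right _ _ (hQ0 j),
      Matrix.nonsing_inv_mul_cancel_left _ _ (hP0 j)] using h2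
  funext i
  rw [← upperMatrix_apply z i, ← upperMatrix_apply w i, hm]

theorem gaussWeight_eq_frobenius (X : Fin k × Fin n × Fin n → ℂ) :
    gaussWeight X = ENNReal.ofReal (Real.exp (-∑ j, frobeniusSq (block X j))) := by
  simp only [gaussWeight, frobeniusSq, block_apply, Fintype.sum_prod_type]

theorem gaussWeight_upper (z : {i : Fin k × Fin n × Fin n // ¬ i.2.2 < i.2.1} → ℂ) :
    gaussWeight z = ENNReal.ofReal (Real.exp (-∑ j, frobeniusSq (upperMatrix z j))) := by
  have h0 : gaussWeight (0 : {i : Fin k × Fin n × Fin n // i.2.2 < i.2.1} → ℂ) = 1 := by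
    simp [gaussWeight]
  have h1 : gaussWeight (glue 0 z) = gaussWeight z := by
    rw [glue, gaussWeight_piEquivPiSubtypeProd, h0, one_mul]
  rw [← h1, gaussWeight_eq_frobenius]
  refine congrArg (fun t : ℝ => ENNReal.ofReal (Real.exp (-t)))
    (Finset.sum_congr rfl fun j _ => congrArg frobeniusSq ?_)
  ext a b
  simp only [upperMatrix, upperPart, Matrix.of_apply, block_apply]
  split_ifs with h
  · rw [glue_apply_of_lt 0 z (i := (j, a, b)) h, Pi.zero_apply]
  · rfl

/-- With the lower parts fixed, QR gives `L_j = U_j * S_j`. The unitary factors leave the Frobenius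
norm, so the Gaussian weight at `R` is the standard one at `S_src * R * S_tgt⁻¹`. This substitution
is linear and invertible on upper triangular families, and it scales `schurWeight` by a constant.
The crucial point is that `c` does not depend on `H`. -/
theorem exists_lintegral_upper {ε : Fin (k + 1) → ℤ} (hε : ∀ j, ε j = 1 ∨ ε j = -1)
    (y : {i : Fin (k + 1) × Fin n × Fin n // i.2.2 < i.2.1} → ℂ) :
    ∃ c : ℝ≥0∞, c ≠ 0 ∧ c ≠ ∞ ∧ ∀ H : (Fin n → ℂ) → ℝ≥0∞,
      ∫⁻ z, schurWeight ε H (glue y z) * gaussWeight (assemble ε (glue y z)) =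
        c * ∫⁻ z, schurWeight ε H (glue 0 z) * gaussWeight z := by
  let L := fun j => unipotentPart (block (glue y 0) j)
  have hL : ∀ j, IsUnipotentLower (L j) := fun j => isUnipotentLower_unipotentPart _
  choose U S hU hS hLUS using fun j => Matrix.exists_unitary_mul_upper (L j)
  have hS0 : ∀ j, IsUnit (S j).det := fun j => by
    have h := (hL j).isUnit_det
    rw [hLUS j, Matrix.det_mul] at h
    exact isUnit_of_mul_isUnit_right h
  have hU0 : ∀ j, IsUnit (U j).det := fun j => by
    have h := (hL j).isUnit_det
    rw [hLUS j, Matrix.det_mul] at h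
    exact isUnit_of_mul_isUnit_left h
  let T := upperMul (fun j => S (src ε j)) fun j => (S (tgt ε j))⁻¹
  have hSi : ∀ j, (S j)⁻¹.IsUpperTriangular := fun j => (hS j).inv_of_isUnit (hS0 j)
  have hTm := upperMatrix_upperMul (P := fun j => S (src ε j)) (Q := fun j => (S (tgt ε j))⁻¹)
    (fun j => hS _) (fun j => hSi _)
  have hT : Function.Injective T := upperMul_injective (fun j => hS _) (fun j => hSi _)
    (fun j => hS0 _) fun j => Matrix.isUnit_nonsing_inv_det _ (hS0 _)
  obtain ⟨c₁, hc₁, hc₁', hT'⟩ := exists_lintegral_comp_linearEquiv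
    (LinearEquiv.ofInjectiveEndo T hT)
  obtain ⟨c₂, hc₂, hc₂', hs⟩ := exists_schurWeight_scale hε (s := fun j a => S j a a)
    fun j a => (hS j).diag_ne_zero (hS0 j) a
  refine ⟨c₂ * c₁, mul_ne_zero hc₂ hc₁, ENNReal.mul_ne_top hc₂' hc₁', fun H => ?_⟩
  have h1 : ∀ z, schurWeight ε H (glue y z) = c₂ * schurWeight ε H (glue 0 (T z)) := fun z => by
    refine hs H _ _ fun j a => ?_
    have hja : ¬ ((j, a, a) : Fin (k + 1) × Fin n × Fin n).2.2 <
      ((j, a, a) : Fin (k + 1) × Fin n × Fin n).2.1 := lt_irrefl _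
    rw [glue_apply_of_not_lt 0 (T z) hja, glue_apply_of_not_lt y z hja,
      ← upperMatrix_apply (T z), ← upperMatrix_apply z]
    simp only [T, hTm]
    rw [((hS _).mul (isUpperTriangular_upperMatrix _ _)).mul_apply_diag (hSi _)
      Function.injective_id, (hS _).mul_apply_diag (isUpperTriangular_upperMatrix _ _)
      Function.injective_id, (hS _).inv_apply_diag (hS0 _) Function.injective_id]
  have h2 : ∀ z, gaussWeight (assemble ε (glue y z)) = gaussWeight (T z) := fun z => by
    rw [gaussWeight_eq_frobenius, gaussWeight_upper]
    refine congrArg (fun t : ℝ => ENNReal.ofReal (Real.exp (-t)))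
      (Finset.sum_congr rfl fun j _ => ?_)
    simp only [T, hTm, assemble, block_unblock, unipotentPart_block_glue y z,
      upperPart_block_glue]
    change frobeniusSq (L (src ε j) * upperMatrix z j * (L (tgt ε j))⁻¹) = _
    rw [hLUS (src ε j), hLUS (tgt ε j), Matrix.mul_inv_rev,
      ← frobeniusSq_unitary_mul_mul (hU (src ε j)) (V := (U (tgt ε j))⁻¹) _
        (S (src ε j) * upperMatrix z j * (S (tgt ε j))⁻¹)]
    · simp only [Matrix.mul_assoc]
    · have : (U (tgt ε j))⁻¹ = star (U (tgt ε j)) :=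
        Matrix.inv_eq_left_inv (Matrix.mem_unitaryGroup_iff'.1 (hU _))
      rw [this]
      exact Unitary.star_mem (hU _)
  simp only [h1, h2, mul_assoc]
  rw [lintegral_const_mul' _ _ hc₂']
  congr 1
  exact hT' fun w => schurWeight ε H (glue 0 w) * gaussWeight w

/-- Both integrals are a constant times the same functional `I H` of the diagonal data, so neither
constant has to be computed. The bound `H ≤ 1` keeps `I H` finite, which allows it to be pulled out
of an integral of `c`, a function chosen pointwise and not known to be measurable. -/
theorem exists_lintegral_schurWeight {ε : Fin (k + 1) → ℤ} (hε : ∀ j, ε j = 1 ∨ ε j = -1) :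
    ∃ C : ℝ≥0∞, C ≠ 0 ∧ C ≠ ∞ ∧
      ∀ (F : (Fin (k + 1) × Fin n × Fin n → ℂ) → ℝ≥0∞) (H : (Fin n → ℂ) → ℝ≥0∞),
      Measurable H → (∀ z, H z ≤ 1) →
      (∀ X ∈ regularSet ε, F (assemble ε X) = H (diagProd ε X)) →
      ∫⁻ A, F A * gaussWeight A = C * ∫⁻ X, schurWeight ε H X * gaussWeight X := by
  choose c hc hc' h using exists_lintegral_upper (n := n) hε
  let I := fun H : (Fin n → ℂ) → ℝ≥0∞ => ∫⁻ z, schurWeight ε H (glue 0 z) * gaussWeight z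
  have hF : ∀ (F : (Fin (k + 1) × Fin n × Fin n → ℂ) → ℝ≥0∞) (H : (Fin n → ℂ) → ℝ≥0∞),
      Measurable H → (∀ X ∈ regularSet ε, F (assemble ε X) = H (diagProd ε X)) →
      ∫⁻ A, F A * gaussWeight A = ∫⁻ y, c y * I H := by
    intro F H hH hFH
    rw [lintegral_eq_lintegral_assemble hε hFH, lintegral_piEquivPiSubtypeProd
      (fun i : Fin (k + 1) × Fin n × Fin n => i.2.2 < i.2.1)]
    · exact lintegral_congr fun y => h y H
    · exact (measurable_schurWeight hH).mul
        (measurable_gaussWeight.comp (differentiable_assemble ε).continuous.measurable)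
  have hG : ∀ H : (Fin n → ℂ) → ℝ≥0∞, Measurable H →
      ∫⁻ X, schurWeight ε H X * gaussWeight X =
        (∫⁻ y : {i : Fin (k + 1) × Fin n × Fin n // i.2.2 < i.2.1} → ℂ, gaussWeight y) * I H := by
    intro H hH
    rw [lintegral_piEquivPiSubtypeProd (fun i : Fin (k + 1) × Fin n × Fin n => i.2.2 < i.2.1)
      (F := fun X => schurWeight ε H X * gaussWeight X)
      ((measurable_schurWeight hH).mul measurable_gaussWeight),
      ← lintegral_mul_const _ measurable_gaussWeight]
    refine lintegral_congr fun y => ?_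
    change _ = gaussWeight y * ∫⁻ z, schurWeight ε H (glue 0 z) * gaussWeight z
    have hy : gaussWeight y ≠ ∞ := ENNReal.ofReal_ne_top
    rw [← lintegral_const_mul' _ _ hy]
    refine lintegral_congr fun z => ?_
    rw [gaussWeight_piEquivPiSubtypeProd]
    have : schurWeight ε H ((MeasurableEquiv.piEquivPiSubtypeProd (fun _ => ℂ)
        fun i : Fin (k + 1) × Fin n × Fin n => i.2.2 < i.2.1).symm (y, z)) =
        schurWeight ε H (glue 0 z) := by
      refine schurWeight_congr ε H fun j a => ?_
      have hja : ¬ ((j, a, a) : Fin (k + 1) × Fin n × Fin n).2.2 <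
        ((j, a, a) : Fin (k + 1) × Fin n × Fin n).2.1 := lt_irrefl _
      exact (glue_apply_of_not_lt y z hja).trans (glue_apply_of_not_lt 0 z hja).symm
    rw [this]
    ring
  -- The case `H = 1` expresses the finite, positive Gaussian mass as `∫ c * I 1`, which shows that
  -- both factors are finite and nonzero.
  have h1 := hF 1 1 measurable_one fun _ _ => rfl
  simp only [Pi.one_apply, one_mul] at h1
  have hI1 : I 1 ≠ ∞ := by
    intro hI
    rw [hI] at h1
    have : ∀ y, c y * ∞ = ∞ := fun y => ENNReal.mul_top (hc y)
    simp only [this, lintegral_const] at h1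
    rw [ENNReal.top_mul (isOpen_univ.measure_ne_zero _ Set.univ_nonempty)] at h1
    exact lintegral_gaussWeight_ne_top h1
  have hI0 : I 1 ≠ 0 := by
    intro hI
    rw [hI] at h1
    simp only [mul_zero, lintegral_zero] at h1
    exact lintegral_gaussWeight_ne_zero h1
  rw [lintegral_mul_const' _ _ hI1] at h1
  have hC0 : ∫⁻ y, c y ≠ 0 := fun h0 => by
    rw [h0, zero_mul] at h1
    exact lintegral_gaussWeight_ne_zero h1
  have hC1 : ∫⁻ y, c y ≠ ∞ := fun h0 => by
    rw [h0, ENNReal.top_mul hI0] at h1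
    exact lintegral_gaussWeight_ne_top h1
  refine ⟨(∫⁻ y, c y) / ∫⁻ y : {i : Fin (k + 1) × Fin n × Fin n // i.2.2 < i.2.1} → ℂ,
    gaussWeight y, ENNReal.div_ne_zero.2 ⟨hC0, lintegral_gaussWeight_ne_top⟩,
    ENNReal.div_ne_top hC1 lintegral_gaussWeight_ne_zero, fun F H hH hH1 hFH => ?_⟩
  have hIH : I H ≠ ∞ := by
    refine ne_top_of_le_ne_top hI1 (lintegral_mono fun z => ?_)
    gcongr
    exact schurWeight_mono hH1 _
  rw [hF F H hH hFH, hG H hH, lintegral_mul_const' _ _ hIH, ← mul_assoc,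
    ENNReal.div_mul_cancel lintegral_gaussWeight_ne_zero lintegral_gaussWeight_ne_top]

end ChangeOfVariables

/-! ### The weight measure and the diagonal variables. -/

section WeightMeasure

variable {n k : ℕ}

/-- The density on `ℂ^k` whose push-forward is the weight. -/
noncomputable def signedDensity (n : ℕ) (ε : Fin k → ℤ) (x : Fin k → ℂ) : ℝ≥0∞ :=
  ENNReal.ofReal (Real.exp (-∑ j, ‖x j‖ ^ 2) * ∏ j, ‖x j‖ ^ ((1 - ε j) * ((n : ℤ) - 1)))

/-- The measure `ω(z) |dz|²` as a push-forward. -/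
noncomputable def weightMeasure (n : ℕ) (ε : Fin k → ℤ) : Measure ℂ :=
  Measure.map (fun x : Fin k → ℂ => ∏ j, x j ^ ε j)
    ((volume : Measure (Fin k → ℂ)).withDensity (signedDensity n ε))

theorem measurable_signedDensity (n : ℕ) (ε : Fin k → ℤ) : Measurable (signedDensity n ε) := by
  refine Measurable.ennreal_ofReal (Measurable.mul (by fun_prop)
    (Finset.measurable_prod _ fun j _ => ?_))
  have h : Measurable fun x : Fin k → ℂ => x j ^ ((1 - ε j) * ((n : ℤ) - 1)) :=
    (measurable_pi_apply j).zpow_sign _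
  simpa only [norm_zpow] using h.norm

theorem measurable_signedProd (ε : Fin k → ℤ) :
    Measurable fun x : Fin k → ℂ => ∏ j, x j ^ ε j :=
  Finset.measurable_prod _ fun j _ => (measurable_pi_apply j).zpow_sign (ε j)

theorem exists_natCast_exponent (hn : 1 ≤ n) {e : ℤ} (he : e = 1 ∨ e = -1) :
    ∃ m : ℕ, (1 - e) * ((n : ℤ) - 1) = m ∧ (e = -1 → m = 2 * (n - 1)) ∧ (e = 1 → m = 0) := by
  rcases he with rfl | rfl
  · exact ⟨0, by simp, by norm_num, fun _ => rfl⟩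
  · refine ⟨2 * (n - 1), ?_, fun _ => rfl, by norm_num⟩
    push_cast [Nat.cast_sub hn]
    ring

theorem isFiniteMeasure_withDensity_signedDensity (hn : 1 ≤ n) {ε : Fin k → ℤ}
    (hε : ∀ j, ε j = 1 ∨ ε j = -1) :
    IsFiniteMeasure ((volume : Measure (Fin k → ℂ)).withDensity (signedDensity n ε)) := by
  refine isFiniteMeasure_withDensity ?_
  choose m hm _ _ using fun j => exists_natCast_exponent hn (hε j)
  have h : ∀ x : Fin k → ℂ, signedDensity n ε x =
      ∏ j, ENNReal.ofReal (‖x j‖ ^ m j * Real.exp (-‖x j‖ ^ 2)) := fun x => by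
    rw [signedDensity, ← ENNReal.ofReal_prod_of_nonneg fun _ _ => by positivity,
      Finset.prod_mul_distrib, ← Real.exp_sum, Finset.sum_neg_distrib, mul_comm]
    simp only [hm, zpow_natCast]
  simp only [h]
  rw [volume_pi, lintegral_fintype_prod_eq_prod
    (f := fun j z => ENNReal.ofReal (‖z‖ ^ m j * Real.exp (-‖z‖ ^ 2))) fun i => by fun_prop]
  exact ENNReal.prod_ne_top fun j _ => (lintegral_norm_pow_mul_exp_lt_top (m j)).ne

theorem isFiniteMeasure_weightMeasure (hn : 1 ≤ n) {ε : Fin k → ℤ}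
    (hε : ∀ j, ε j = 1 ∨ ε j = -1) : IsFiniteMeasure (weightMeasure n ε) := by
  have := isFiniteMeasure_withDensity_signedDensity hn hε
  unfold weightMeasure
  infer_instance

/-- The map `x ↦ x ^ e * c` is inverted by `y ↦ (y / c) ^ e`, because `e * e = 1`, and a map
differentiable away from `0` sends null sets to null sets. -/
theorem ae_zpow_mul_notMem {s : Set ℂ} (hs : volume s = 0) {e : ℤ} (he : e = 1 ∨ e = -1) {c : ℂ}
    (hc : c ≠ 0) : ∀ᵐ x : ℂ, x ^ e * c ∉ s := by
  have h0 : ∀ᵐ x : ℂ, x ≠ 0 := ae_iff.2 (by simp)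
  have hg : volume ((fun y : ℂ => (y / c) ^ e) '' (s \ {0})) = 0 := by
    refine addHaar_image_eq_zero_of_differentiableOn_of_addHaar_eq_zero volume ?_
      (measure_mono_null Set.sdiff_subset hs)
    intro y hy
    have hy0 : y ≠ 0 := hy.2
    have h1 : DifferentiableAt ℂ (fun y : ℂ => (y / c) ^ e) y := by
      rcases he with rfl | rfl
      · simp
      · simp only [zpow_neg_one]
        exact (differentiableAt_id.div_const c).inv (div_ne_zero hy0 hc)
    exact (h1.restrictScalars ℝ).differentiableWithinAt
  have h1 := measure_eq_zero_iff_ae_notMem.1 hg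
  filter_upwards [h0, h1] with x hx0 hx hxs
  refine hx ⟨x ^ e * c, ⟨hxs, mul_ne_zero (zpow_ne_zero _ hx0) hc⟩, ?_⟩
  simp only
  rw [mul_div_cancel_right₀ _ hc, ← zpow_mul]
  rcases he with rfl | rfl <;> simp

theorem ae_forall_ne_zero {ι : Type*} [Fintype ι] : ∀ᵐ x : ι → ℂ, ∀ i, x i ≠ 0 := by
  rw [ae_all_iff]
  intro i
  exact ae_ne_zero_of_differentiable (g := fun x : ι → ℂ => x i) (by fun_prop) (x₀ := fun _ => 1)
    one_ne_zero

/-- With all variables but the first frozen at nonzero values, the product is a nonzero multiple of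
`x ^ (±1)`; Fubini does the rest. -/
theorem weightMeasure_absolutelyContinuous {ε : Fin (k + 1) → ℤ}
    (hε : ∀ j, ε j = 1 ∨ ε j = -1) : weightMeasure n ε ≪ volume := by
  refine Measure.AbsolutelyContinuous.mk fun s hsm hs => ?_
  rw [weightMeasure, Measure.map_apply (measurable_signedProd ε) hsm]
  refine withDensity_absolutelyContinuous _ _ ?_
  have hm := measurable_signedProd ε hsm
  have he := (volume_preserving_piFinSuccAbove (fun _ : Fin (k + 1) => ℂ) 0).symm
  rw [← he.measure_preimage hm.nullMeasurableSet, measure_eq_zero_iff_ae_notMem,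
    Measure.volume_eq_prod]
  have h1 : ∀ᵐ y : Fin k → ℂ, ∀ᵐ x : ℂ, x ^ ε 0 * ∏ j : Fin k, y j ^ ε j.succ ∉ s := by
    filter_upwards [ae_forall_ne_zero (ι := Fin k)] with y hy
    exact ae_zpow_mul_notMem hs (hε 0)
      (Finset.prod_ne_zero_iff.2 fun j _ => zpow_ne_zero _ (hy j))
  have hms : MeasurableSet {p : ℂ × (Fin k → ℂ) |
      p.1 ^ ε 0 * ∏ j : Fin k, p.2 j ^ ε j.succ ∉ s} := by
    have : Measurable fun p : ℂ × (Fin k → ℂ) => p.1 ^ ε 0 * ∏ j : Fin k, p.2 j ^ ε j.succ :=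
      (measurable_fst.zpow_sign _).mul
        ((measurable_signedProd fun j : Fin k => ε j.succ).comp measurable_snd)
    exact (this hsm).compl
  rw [← Measure.ae_ae_comm hms, ← Measure.ae_prod_iff_ae_ae hms] at h1
  filter_upwards [h1] with p hp
  simpa [MeasurableEquiv.piFinSuccAbove_symm_apply, Fin.insertNthEquiv, Fin.prod_univ_succ] using hp

theorem exists_isWeight (hn : 1 ≤ n) {ε : Fin (k + 1) → ℤ} (hε : ∀ j, ε j = 1 ∨ ε j = -1) :
    ∃ w : ℂ → ℝ, IsWeight n ε w := by
  have hfin := isFiniteMeasure_weightMeasure hn hε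
  refine ⟨fun z => ((weightMeasure n ε).rnDeriv volume z).toReal,
    (Measure.measurable_rnDeriv _ _).ennreal_toReal, fun z => ENNReal.toReal_nonneg, ?_⟩
  change _ = weightMeasure n ε
  rw [← Measure.withDensity_rnDeriv_eq (weightMeasure n ε) volume
    (weightMeasure_absolutelyContinuous hε)]
  refine withDensity_congr_ae ?_
  rw [Measure.withDensity_rnDeriv_eq (weightMeasure n ε) volume
    (weightMeasure_absolutelyContinuous hε)]
  filter_upwards [Measure.rnDeriv_lt_top (weightMeasure n ε) volume] with z hz
  exact ENNReal.ofReal_toReal hz.ne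

theorem IsWeight.withDensity_eq {ε : Fin k → ℤ} {w : ℂ → ℝ} (hw : IsWeight n ε w) :
    (volume : Measure ℂ).withDensity (fun z => ENNReal.ofReal (w z)) = weightMeasure n ε :=
  hw.pushforward

theorem bijective_diagonal : Function.Bijective fun p : Fin n × Fin k =>
    (⟨(p.2, p.1, p.1), rfl⟩ : {i : Fin k × Fin n × Fin n // i.2.1 = i.2.2}) := by
  refine ⟨?_, ?_⟩
  · rintro ⟨a, j⟩ ⟨b, i⟩ h
    simp only [Subtype.mk.injEq, Prod.mk.injEq] at h
    ext <;> simp [h]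
  · rintro ⟨⟨j, a, b⟩, rfl : a = b⟩
    exact ⟨(a, j), rfl⟩

theorem measurePreserving_diagonal :
    MeasurePreserving (fun (v : Fin n → Fin k → ℂ)
      (i : {i : Fin k × Fin n × Fin n // i.2.1 = i.2.2}) => v i.1.2.1 i.1.1) := by
  refine ⟨by fun_prop, (Measure.pi_eq fun s hs => ?_).symm⟩
  rw [Measure.map_apply (by fun_prop) (MeasurableSet.univ_pi hs)]
  have h : (fun (v : Fin n → Fin k → ℂ)
      (i : {i : Fin k × Fin n × Fin n // i.2.1 = i.2.2}) => v i.1.2.1 i.1.1) ⁻¹' Set.univ.pi s =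
      Set.univ.pi fun a => Set.univ.pi fun j => s ⟨(j, a, a), rfl⟩ := by
    ext v
    simp only [Set.mem_preimage, Set.mem_univ_pi]
    constructor
    · exact fun h a j => h ⟨(j, a, a), rfl⟩
    · rintro h ⟨⟨j, a, b⟩, rfl : a = b⟩
      exact h a j
  rw [h, volume_pi_pi]
  simp only [volume_pi_pi]
  rw [← Fintype.prod_prod_type']
  exact Fintype.prod_bijective _ bijective_diagonal _ _ fun _ => rfl

/-- The squared modulus of the Vandermonde determinant. -/
noncomputable def vandermondeSq (z : Fin n → ℂ) : ℝ := ∏ i, ∏ j ∈ Finset.Ioi i, ‖z i - z j‖ ^ 2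

/-- `schurWeight` depends on the diagonal entries only, so the off-diagonal Gaussian integral
factors out as `C`. Regrouping the diagonal entries by position `a` gives `n` vectors in `ℂ^k`;
Gaussian weight and Jacobian powers together form the density `signedDensity` of each, whose
push-forward is the weight measure. -/
theorem lintegral_schurWeight (hn : 1 ≤ n) {ε : Fin k → ℤ} (hε : ∀ j, ε j = 1 ∨ ε j = -1) :
    ∃ C : ℝ≥0∞, C ≠ 0 ∧ C ≠ ∞ ∧ ∀ H : (Fin n → ℂ) → ℝ≥0∞, Measurable H →
      ∫⁻ X, schurWeight ε H X * gaussWeight X =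
        C * ∫⁻ z, (sortedSet n).indicator (fun z => ENNReal.ofReal (vandermondeSq z) * H z) z
          ∂Measure.pi fun _ => weightMeasure n ε := by
  refine ⟨∫⁻ y : {i : Fin k × Fin n × Fin n // ¬ i.2.1 = i.2.2} → ℂ, gaussWeight y,
    lintegral_gaussWeight_ne_zero, lintegral_gaussWeight_ne_top, fun H hH => ?_⟩
  have := isFiniteMeasure_withDensity_signedDensity hn hε
  have := isFiniteMeasure_weightMeasure hn hε
  have hV : Measurable fun z : Fin n → ℂ => ENNReal.ofReal (vandermondeSq z) * H z := by
    refine Measurable.mul ?_ hH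
    unfold vandermondeSq
    fun_prop
  have hVi := hV.indicator (measurableSet_sortedSet n)
  set V := (sortedSet n).indicator (fun z => ENNReal.ofReal (vandermondeSq z) * H z)
  have hpi : Measure.pi (fun _ : Fin n => weightMeasure n ε) =
      Measure.map (fun (v : Fin n → Fin k → ℂ) a => ∏ j, v a j ^ ε j)
        ((volume : Measure (Fin n → Fin k → ℂ)).withDensity
          fun v => ∏ a, signedDensity n ε (v a)) := by
    rw [volume_pi, ← Measure.pi_withDensity fun _ => measurable_signedDensity n ε,
      Measure.pi_map_pi (f := fun (_ : Fin n) (x : Fin k → ℂ) => ∏ j, x j ^ ε j)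
        fun a => (measurable_signedProd ε).aemeasurable]
    rfl
  have hmz : Measurable fun (v : Fin n → Fin k → ℂ) a => ∏ j, v a j ^ ε j :=
    measurable_pi_lambda _ fun a => (measurable_signedProd ε).comp (measurable_pi_apply a)
  have hdm : Measurable fun v : Fin n → Fin k → ℂ => ∏ a, signedDensity n ε (v a) :=
    Finset.measurable_prod _ fun a _ => (measurable_signedDensity n ε).comp
      (measurable_pi_apply a)
  have hwd := lintegral_withDensity_eq_lintegral_mul volume hdm (hVi.comp hmz)
  simp only [Function.comp_def] at hwd
  rw [hpi, lintegral_map hVi hmz, hwd,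
    lintegral_piEquivPiSubtypeProd (fun i : Fin k × Fin n × Fin n => i.2.1 = i.2.2)
      (F := fun X => schurWeight ε H X * gaussWeight X)
      ((measurable_schurWeight hH).mul measurable_gaussWeight)]
  let e := (MeasurableEquiv.piEquivPiSubtypeProd (fun _ => ℂ)
      fun i : Fin k × Fin n × Fin n => i.2.1 = i.2.2).symm
  have he : ∀ (y : {i : Fin k × Fin n × Fin n // i.2.1 = i.2.2} → ℂ)
      (z : {i : Fin k × Fin n × Fin n // ¬ i.2.1 = i.2.2} → ℂ) (j : Fin k) (a : Fin n),
      e (y, z) (j, a, a) = y ⟨(j, a, a), rfl⟩ := fun y z j a => by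
    have ha : ((j, a, a) : Fin k × Fin n × Fin n).2.1 = ((j, a, a) : Fin k × Fin n × Fin n).2.2 :=
      rfl
    exact dif_pos ha
  have h1 : ∀ (y : {i : Fin k × Fin n × Fin n // i.2.1 = i.2.2} → ℂ)
      (z : {i : Fin k × Fin n × Fin n // ¬ i.2.1 = i.2.2} → ℂ),
      schurWeight ε H (e (y, z)) * gaussWeight (e (y, z)) =
        schurWeight ε H (e (y, 0)) * gaussWeight y * gaussWeight z := fun y z => by
    rw [gaussWeight_piEquivPiSubtypeProd, ← mul_assoc]
    congr 2
    exact schurWeight_congr ε H fun j a => (he y z j a).trans (he y 0 j a).symm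
  have h2 : ∀ y : {i : Fin k × Fin n × Fin n // i.2.1 = i.2.2} → ℂ,
      ∫⁻ z, schurWeight ε H (e (y, z)) * gaussWeight (e (y, z)) =
        schurWeight ε H (e (y, 0)) * gaussWeight y *
          ∫⁻ z : {i : Fin k × Fin n × Fin n // ¬ i.2.1 = i.2.2} → ℂ, gaussWeight z := fun y => by
    simp only [h1]
    exact lintegral_const_mul _ measurable_gaussWeight
  have hms : Measurable fun y : {i : Fin k × Fin n × Fin n // i.2.1 = i.2.2} → ℂ =>
      schurWeight ε H (e (y, 0)) * gaussWeight y :=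
    ((measurable_schurWeight hH).comp (e.measurable.comp (by fun_prop))).mul measurable_gaussWeight
  rw [lintegral_congr h2, lintegral_mul_const _ hms, mul_comm]
  congr 1
  rw [← (measurePreserving_diagonal (n := n) (k := k)).lintegral_comp hms]
  refine lintegral_congr_ae ?_
  have hne : ∀ᵐ v : Fin n → Fin k → ℂ, ∀ a j, v a j ≠ 0 := by
    rw [ae_all_iff]
    intro a
    exact (Measure.quasiMeasurePreserving_eval (fun _ : Fin n => (volume : Measure (Fin k → ℂ)))
      a).ae ae_forall_ne_zero
  filter_upwards [hne] with v hv
  have hX : ∀ j a, e (fun i => v i.1.2.1 i.1.1, 0) (j, a, a) = v a j := fun j a => he _ 0 j a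
  have hd : diagProd ε (e (fun i => v i.1.2.1 i.1.1, 0)) = fun a => ∏ j, v a j ^ ε j := by
    funext a
    simp only [diagProd, hX]
  have hr : e (fun i => v i.1.2.1 i.1.1, 0) ∈ regularSet ε ↔
      (fun a => ∏ j, v a j ^ ε j) ∈ sortedSet n := by
    change (_ ∧ _) ↔ _
    rw [hd]
    simp only [hX]
    exact ⟨fun h => h.2, fun h => ⟨fun j a => hv a j, h⟩⟩
  have hg : gaussWeight (fun i : {i : Fin k × Fin n × Fin n // i.2.1 = i.2.2} =>
      v i.1.2.1 i.1.1) = ENNReal.ofReal (Real.exp (-∑ a, ∑ j, ‖v a j‖ ^ 2)) := by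
    refine congrArg (fun t : ℝ => ENNReal.ofReal (Real.exp (-t))) ?_
    rw [← Fintype.sum_prod_type']
    exact (Fintype.sum_bijective _ bijective_diagonal _ _ fun _ => rfl).symm
  have hsd : ∏ a, signedDensity n ε (v a) = ENNReal.ofReal
      (Real.exp (-∑ a, ∑ j, ‖v a j‖ ^ 2) *
        ∏ j, ∏ a, ‖v a j‖ ^ ((1 - ε j) * ((n : ℤ) - 1))) := by
    simp only [signedDensity]
    rw [← ENNReal.ofReal_prod_of_nonneg fun _ _ => by positivity, Finset.prod_mul_distrib,
      ← Real.exp_sum, Finset.sum_neg_distrib, Finset.prod_comm]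
  rw [hg, Pi.mul_apply, hsd]
  unfold schurWeight V
  by_cases hs : (fun a => ∏ j, v a j ^ ε j) ∈ sortedSet n
  · rw [Set.indicator_of_mem (hr.2 hs), Set.indicator_of_mem hs, hd, schurJacobian, hd,
      vandermondeSq]
    simp only [hX]
    rw [ENNReal.ofReal_mul (by positivity), ENNReal.ofReal_mul (by positivity)]
    ring
  · rw [Set.indicator_of_notMem (mt hr.1 hs), Set.indicator_of_notMem hs, zero_mul, mul_zero]

end WeightMeasure

/-! ### Symmetric functions of the eigenvalues. -/

section EigenvalueLaw

variable {n k : ℕ}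

theorem exists_perm_comp_of_map_eq {α : Type*} {f g : Fin n → α}
    (h : (Finset.univ.val.map f : Multiset α) = Finset.univ.val.map g) :
    ∃ σ : Equiv.Perm (Fin n), g ∘ σ = f := by
  classical
  have hc : ∀ c, Nonempty ({a // f a = c} ≃ {a // g a = c}) := fun c => by
    refine Fintype.card_eq.1 ?_
    have := congrArg (Multiset.count c) h
    rw [Multiset.count_map, Multiset.count_map] at this
    simpa only [Fintype.card_subtype, Finset.card_def, Finset.filter_val, eq_comm] using this
  exact ⟨Equiv.ofFiberEquiv fun c => (hc c).some, funext fun a => Equiv.ofFiberEquiv_map _ a⟩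

/-- The law of the points of a configuration listed in uniformly random order. -/
noncomputable def orderingLaw (n : ℕ) (s : Multiset ℂ) : Measure (Fin n → ℂ) :=
  ((n ! : ℝ≥0∞)⁻¹) •
    ∑ σ : Equiv.Perm (Fin n), Measure.dirac (fun i => s.toList.getD (σ i) 0)

/-- Any two enumerations differ by a permutation, which the average over all permutations absorbs.
-/
theorem orderingLaw_map (z : Fin n → ℂ) :
    orderingLaw n (Finset.univ.val.map z) =
      ((n ! : ℝ≥0∞)⁻¹) • ∑ σ : Equiv.Perm (Fin n), Measure.dirac (z ∘ σ) := by
  obtain ⟨τ, hτ⟩ : ∃ τ : Equiv.Perm (Fin n),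
      z ∘ τ = fun i : Fin n => (Finset.univ.val.map z : Multiset ℂ).toList.getD i 0 := by
    refine exists_perm_comp_of_map_eq ?_
    conv_rhs => rw [← Multiset.coe_toList (Finset.univ.val.map z)]
    have hl : (Finset.univ.val.map z : Multiset ℂ).toList.length = n := by simp
    generalize (Finset.univ.val.map z : Multiset ℂ).toList = l at hl
    subst hl
    rw [Fin.univ_val_map]
    congr 1
    exact List.ext_getElem (by simp) fun i h1 h2 => by simp
  unfold orderingLaw
  congr 1
  refine Fintype.sum_equiv (Equiv.mulLeft τ) _ _ fun σ => ?_
  congr 1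
  funext i
  exact (congrFun hτ (σ i)).symm

theorem uniformOrderingLaw_eq (M : Matrix (Fin n) (Fin n) ℂ) :
    uniformOrderingLaw M = orderingLaw n (eigenvalueMultiset M) := rfl

theorem eigenvalueMultiset_diagonal (z : Fin n → ℂ) :
    eigenvalueMultiset (Matrix.diagonal z) = Finset.univ.val.map z := by
  rw [eigenvalueMultiset, Matrix.charpoly_diagonal]
  exact Polynomial.roots_multiset_prod_X_sub_C (Finset.univ.val.map z) ▸ by
    simp [Finset.prod, Function.comp_def]

/-- The non-leading coefficients of the characteristic polynomial. -/
noncomputable def charpolyCoeffs (M : Matrix (Fin n) (Fin n) ℂ) : Fin n → ℂ :=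
  fun m => M.charpoly.coeff m

theorem charpoly_eq_of_charpolyCoeffs_eq {M N : Matrix (Fin n) (Fin n) ℂ}
    (h : charpolyCoeffs M = charpolyCoeffs N) : M.charpoly = N.charpoly := by
  ext m
  rcases lt_trichotomy m n with hm | rfl | hm
  · exact congrFun h ⟨m, hm⟩
  · have h1 := M.charpoly_monic.coeff_natDegree
    have h2 := N.charpoly_monic.coeff_natDegree
    rw [Matrix.charpoly_natDegree_eq_dim, Fintype.card_fin] at h1 h2
    rw [h1, h2]
  · rw [Polynomial.coeff_eq_zero_of_natDegree_lt, Polynomial.coeff_eq_zero_of_natDegree_lt] <;>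
      simpa [Matrix.charpoly_natDegree_eq_dim] using hm

theorem exists_charpoly_diagonal_eq {p : Polynomial ℂ} (hp : p.Monic) (hn : p.natDegree = n) :
    ∃ z : Fin n → ℂ, (Matrix.diagonal z).charpoly = p := by
  have h := IsAlgClosed.splits p
  have hc : p.roots.card = n := by rw [← h.natDegree_eq_card_roots, hn]
  have hl : p.roots.toList.length = n := by simp [hc]
  refine ⟨fun i => p.roots.toList.get (Fin.cast hl.symm i), ?_⟩
  have he := h.eq_prod_roots
  rw [hp.leadingCoeff, map_one, one_mul] at he
  conv_rhs => rw [he]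
  rw [Matrix.charpoly_diagonal]
  conv_rhs => rw [← Multiset.coe_toList p.roots]
  rw [Multiset.map_coe, Multiset.prod_coe, ← List.prod_ofFn]
  generalize p.roots.toList = l at hl
  subst hl
  congr 1
  exact List.ext_getElem (by simp) fun i h1 h2 => by simp

theorem measurable_charpolyCoeffs {α : Type*} [MeasurableSpace α]
    {f : α → Matrix (Fin n) (Fin n) ℂ} (hf : ∀ i j, Measurable fun x => f x i j) :
    Measurable fun x => charpolyCoeffs (f x) := by
  refine measurable_pi_lambda _ fun m => ?_
  have h1 : Measurable fun x (p : Fin n × Fin n) => f x p.1 p.2 :=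
    measurable_pi_lambda _ fun p => hf p.1 p.2
  simp only [charpolyCoeffs, Matrix.coeff_charpoly_eq_eval]
  exact (MvPolynomial.continuous_eval _).measurable.comp h1

/-- Symmetric measurable functions of the roots are measurable functions of the matrix. -/
theorem measurable_comp_eigenvalueMultiset {α β : Type*} [MeasurableSpace α] [MeasurableSpace β]
    {f : α → Matrix (Fin n) (Fin n) ℂ} (hf : ∀ i j, Measurable fun x => f x i j)
    {Q : Multiset ℂ → β} (hQ : Measurable fun z : Fin n → ℂ => Q (Finset.univ.val.map z)) :
    Measurable fun x => Q (eigenvalueMultiset (f x)) := by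
  have hz : Measurable fun z : Fin n → ℂ => charpolyCoeffs (Matrix.diagonal z) :=
    measurable_charpolyCoeffs fun i j => by
      simp only [Matrix.diagonal_apply]
      split_ifs <;> fun_prop
  -- Since `ℂ` is algebraically closed, every coefficient vector comes from a diagonal matrix.
  have hsurj : Function.Surjective fun z : Fin n → ℂ => charpolyCoeffs (Matrix.diagonal z) := by
    intro c
    have hd : (∑ i : Fin n, Polynomial.C (c i) * Polynomial.X ^ (i : ℕ)).degree < ((n : ℕ) : WithBot ℕ) :=
      Polynomial.degree_sum_fin_lt c
    obtain ⟨z, hz⟩ := exists_charpoly_diagonal_eq (Polynomial.monic_X_pow_add hd)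
      (Polynomial.natDegree_eq_of_degree_eq_some (by
        rw [Polynomial.degree_add_eq_left_of_degree_lt (by rwa [Polynomial.degree_X_pow]),
          Polynomial.degree_X_pow]))
    refine ⟨z, funext fun m => ?_⟩
    simp only [charpolyCoeffs, hz, Polynomial.coeff_add, Polynomial.coeff_X_pow, m.2.ne,
      if_false, zero_add, Polynomial.finsetSum_coeff, Polynomial.coeff_C_mul, mul_ite, mul_one,
      mul_zero, Fin.val_inj, Finset.sum_ite_eq, Finset.mem_univ, if_true]
  let g : (Fin n → ℂ) → β := fun c => Q (eigenvalueMultiset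
    (Matrix.diagonal (Function.surjInv hsurj c)))
  have hg : ∀ M : Matrix (Fin n) (Fin n) ℂ, g (charpolyCoeffs M) = Q (eigenvalueMultiset M) :=
    fun M => by
      have h := charpoly_eq_of_charpolyCoeffs_eq (Function.surjInv_eq hsurj (charpolyCoeffs M))
      simp only [g, eigenvalueMultiset, h]
  -- No measurable choice of roots is needed: a function is measurable as soon as its composition
  -- with a measurable surjection of standard Borel spaces is.
  have hgm : Measurable g := by
    refine (Measurable.measurable_comp_iff_of_surjective hz hsurj).1 ?_
    simpa only [Function.comp_def, hg, eigenvalueMultiset_diagonal] using hQ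
  simpa only [Function.comp_def, hg] using hgm.comp (measurable_charpolyCoeffs hf)

theorem measurable_signedProduct_block (ε : Fin k → ℤ) (hε : ∀ j, ε j = 1 ∨ ε j = -1)
    (a b : Fin n) : Measurable fun X : Fin k × Fin n × Fin n → ℂ => signedProduct ε (block X) a b := by
  have h : ∀ (m : ℕ) (B : Fin m → (Fin k × Fin n × Fin n → ℂ) → Matrix (Fin n) (Fin n) ℂ),
      (∀ i a b, Measurable fun X => B i X a b) →
      ∀ a b, Measurable fun X => ((List.ofFn fun i => B i X).prod : Matrix (Fin n) (Fin n) ℂ) a b := by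
    intro m
    induction m with
    | zero => intro B _ a b; simp
    | succ m ih =>
      intro B hB
      simp only [List.ofFn_succ, List.prod_cons]
      exact measurable_matrix_mul (hB 0) (ih (fun i => B i.succ) fun i => hB i.succ)
  refine h k (fun i X => block X i ^ ε i) (fun i a b => ?_) a b
  have hb : ∀ a b, Measurable fun X : Fin k × Fin n × Fin n → ℂ => block X i a b := fun a b =>
    measurable_pi_apply (i, a, b)
  rcases hε i with h | h <;> simp only [h]
  · simpa only [zpow_one] using hb a b
  · simpa only [Matrix.zpow_neg_one] using measurable_matrix_inv hb a b

end EigenvalueLaw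

/-! ### Expectations of symmetric functions of the eigenvalues. -/

section EigenvalueDensity

variable {n k : ℕ}

theorem stdComplexGaussian_eq : stdComplexGaussian =
    (volume : Measure ℂ).withDensity fun z =>
      ENNReal.ofReal Real.pi⁻¹ * ENNReal.ofReal (Real.exp (-‖z‖ ^ 2)) := by
  unfold stdComplexGaussian
  simp only [ENNReal.ofReal_mul (inv_nonneg.2 Real.pi_pos.le)]

theorem IsIndepGinibre.lintegral_entries {Ω : Type*} [MeasurableSpace Ω] {P : Measure Ω}
    [IsProbabilityMeasure P] {A : Fin k → Ω → Matrix (Fin n) (Fin n) ℂ} (hA : IsIndepGinibre P A) :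
    ∃ c : ℝ≥0∞, c ≠ 0 ∧ c ≠ ∞ ∧ ∀ G : (Fin k × Fin n × Fin n → ℂ) → ℝ≥0∞, Measurable G →
      ∫⁻ ω, G (fun i => A i.1 ω i.2.1 i.2.2) ∂P = c * ∫⁻ X, G X * gaussWeight X := by
  have hm : ∀ i : Fin k × Fin n × Fin n, AEMeasurable (fun ω => A i.1 ω i.2.1 i.2.2) P :=
    fun i => (hA.law i.1 i.2.1 i.2.2).aemeasurable
  have hlaw : P.map (fun ω (i : Fin k × Fin n × Fin n) => A i.1 ω i.2.1 i.2.2) =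
      Measure.pi fun _ => stdComplexGaussian := by
    rw [(iIndepFun_iff_map_fun_eq_pi_map hm).1 hA.indep]
    congr 1
    funext i
    exact (hA.law i.1 i.2.1 i.2.2).map_eq
  have hfin : IsFiniteMeasure stdComplexGaussian := by
    rw [stdComplexGaussian_eq]
    refine isFiniteMeasure_withDensity ?_
    rw [lintegral_const_mul _ (by fun_prop)]
    have h := (lintegral_norm_pow_mul_exp_lt_top 0).ne
    simp only [pow_zero, one_mul] at h
    exact ENNReal.mul_ne_top ENNReal.ofReal_ne_top h
  refine ⟨∏ _i : Fin k × Fin n × Fin n, ENNReal.ofReal Real.pi⁻¹,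
    Finset.prod_ne_zero_iff.2 fun _ _ => by simp [Real.pi_pos],
    ENNReal.prod_ne_top fun _ _ => ENNReal.ofReal_ne_top, fun G hG => ?_⟩
  have hd : Measurable fun z : ℂ =>
      ENNReal.ofReal Real.pi⁻¹ * ENNReal.ofReal (Real.exp (-‖z‖ ^ 2)) := by fun_prop
  rw [← lintegral_map' hG.aemeasurable (aemeasurable_pi_lambda _ hm), hlaw]
  rw [stdComplexGaussian_eq] at hfin ⊢
  rw [Measure.pi_withDensity fun _ => hd, ← volume_pi,
    lintegral_withDensity_eq_lintegral_mul _ (by fun_prop) hG,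
    ← lintegral_const_mul' _ _ (ENNReal.prod_ne_top fun _ _ => ENNReal.ofReal_ne_top)]
  refine lintegral_congr fun X => ?_
  rw [Pi.mul_apply, Finset.prod_mul_distrib, gaussWeight_eq_prod]
  ring

theorem measurePreserving_comp_perm (μ : Measure ℂ) [SigmaFinite μ] (σ : Equiv.Perm (Fin n)) :
    MeasurePreserving (fun z : Fin n → ℂ => z ∘ σ) (Measure.pi fun _ => μ)
      (Measure.pi fun _ => μ) := by
  refine ⟨by fun_prop, (Measure.pi_eq fun s hs => ?_).symm⟩
  rw [Measure.map_apply (by fun_prop) (MeasurableSet.univ_pi hs)]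
  have h : (fun z : Fin n → ℂ => z ∘ σ) ⁻¹' Set.univ.pi s = Set.univ.pi fun i => s (σ.symm i) := by
    ext z
    simp only [Set.mem_preimage, Set.mem_univ_pi, Function.comp_apply]
    exact ⟨fun h i => by simpa using h (σ.symm i), fun h i => by simpa using h (σ i)⟩
  rw [h, Measure.pi_pi]
  exact Equiv.prod_comp σ.symm fun i => μ (s i)

theorem vandermondeSq_eq_zero {z : Fin n → ℂ} (hz : ¬ Function.Injective z) :
    vandermondeSq z = 0 := by
  simp only [Function.Injective, not_forall] at hz
  obtain ⟨i, j, hij, hne⟩ := hz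
  wlog h : i < j generalizing i j
  · exact this j i hij.symm (Ne.symm hne) (lt_of_le_of_ne (not_lt.1 h) (Ne.symm hne))
  refine Finset.prod_eq_zero (Finset.mem_univ i) (Finset.prod_eq_zero (Finset.mem_Ioi.2 h) ?_)
  simp [hij]

theorem vandermondeSq_eq_norm_sq (z : Fin n → ℂ) :
    vandermondeSq z = ‖(Matrix.vandermonde z).det‖ ^ 2 := by
  rw [Matrix.det_vandermonde, vandermondeSq]
  simp only [norm_prod, Finset.prod_pow, norm_sub_rev]

theorem vandermondeSq_comp_perm (z : Fin n → ℂ) (σ : Equiv.Perm (Fin n)) :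
    vandermondeSq (z ∘ σ) = vandermondeSq z := by
  rw [vandermondeSq_eq_norm_sq, vandermondeSq_eq_norm_sq]
  have : Matrix.vandermonde (z ∘ σ) = (Matrix.vandermonde z).submatrix σ id := rfl
  rw [this, Matrix.det_permute]
  rcases Int.units_eq_one_or (Equiv.Perm.sign σ) with h | h <;> simp [h]

/-- Exactly one permutation sorts a vector with distinct entries, and the other vectors do not
contribute. The sorted region therefore carries a fraction `1 / n!` of the integral. -/
theorem lintegral_sortedSet_indicator (μ : Measure ℂ) [SigmaFinite μ]
    {f : (Fin n → ℂ) → ℝ≥0∞} (hf : Measurable f) (hs : ∀ z (σ : Equiv.Perm (Fin n)), f (z ∘ σ) = f z)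
    (h0 : ∀ z, ¬ Function.Injective z → f z = 0) :
    ∫⁻ z, (sortedSet n).indicator f z ∂(Measure.pi fun _ => μ) =
      (n ! : ℝ≥0∞)⁻¹ * ∫⁻ z, f z ∂(Measure.pi fun _ => μ) := by
  have hpt : ∀ z, f z = ∑ σ : Equiv.Perm (Fin n), (sortedSet n).indicator f (z ∘ σ) := by
    intro z
    by_cases hz : Function.Injective z
    · obtain ⟨σ, hσ⟩ := exists_sorted_perm hz
      rw [Finset.sum_eq_single σ _ (by simp), Set.indicator_of_mem hσ, hs]
      intro τ _ hτ
      refine Set.indicator_of_notMem (fun hτs => hτ ?_) _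
      have h := eq_of_mem_sortedSet hτs hσ (by
        rw [← Multiset.map_map, ← Multiset.map_map, Multiset.map_univ_val_equiv,
          Multiset.map_univ_val_equiv])
      exact Equiv.ext fun i => hz (congrFun h i)
    · rw [h0 z hz]
      refine (Finset.sum_eq_zero fun σ _ => ?_).symm
      refine Set.indicator_apply_eq_zero.2 fun _ => ?_
      rw [hs, h0 z hz]
  have hi := hf.indicator (measurableSet_sortedSet n)
  have h1 : ∫⁻ z, f z ∂(Measure.pi fun _ => μ) =
      n ! * ∫⁻ z, (sortedSet n).indicator f z ∂(Measure.pi fun _ => μ) := by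
    rw [lintegral_congr hpt, lintegral_finsetSum (f := fun (σ : Equiv.Perm (Fin n)) z =>
      (sortedSet n).indicator f (z ∘ σ)) _ fun σ _ =>
        hi.comp (measurePreserving_comp_perm μ σ).measurable]
    have : ∀ σ : Equiv.Perm (Fin n), ∫⁻ z, (sortedSet n).indicator f (z ∘ σ)
        ∂(Measure.pi fun _ => μ) = ∫⁻ z, (sortedSet n).indicator f z ∂(Measure.pi fun _ => μ) :=
      fun σ => (measurePreserving_comp_perm μ σ).lintegral_comp hi
    simp only [this]
    rw [Finset.sum_const, Finset.card_univ, Fintype.card_perm, Fintype.card_fin, nsmul_eq_mul]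
  rw [h1, ← mul_assoc, ENNReal.inv_mul_cancel, one_mul]
  · exact_mod_cast (Nat.factorial_pos n).ne'
  · exact ENNReal.natCast_ne_top _

theorem measurable_vandermondeSq : Measurable (vandermondeSq (n := n)) := by
  unfold vandermondeSq
  fun_prop

theorem IsIndepGinibre.exists_lintegral_eigenvalues {Ω : Type*} [MeasurableSpace Ω] {P : Measure Ω}
    [IsProbabilityMeasure P] (hn : 1 ≤ n) {ε : Fin (k + 1) → ℤ} (hε : ∀ j, ε j = 1 ∨ ε j = -1)
    {A : Fin (k + 1) → Ω → Matrix (Fin n) (Fin n) ℂ} (hA : IsIndepGinibre P A) :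
    ∃ C : ℝ≥0∞, C ≠ 0 ∧ C ≠ ∞ ∧ ∀ (Q : Multiset ℂ → ℝ≥0∞) (b : ℝ≥0∞), b ≠ 0 → b ≠ ∞ →
      (Measurable fun z : Fin n → ℂ => Q (Finset.univ.val.map z)) →
      (∀ z : Fin n → ℂ, Q (Finset.univ.val.map z) ≤ b) →
      ∫⁻ ω, Q (eigenvalueMultiset (signedProduct ε fun i => A i ω)) ∂P =
        C * ∫⁻ z : Fin n → ℂ, ENNReal.ofReal (vandermondeSq z) * Q (Finset.univ.val.map z)
          ∂Measure.pi fun _ => weightMeasure n ε := by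
  have hfin := isFiniteMeasure_weightMeasure hn hε
  obtain ⟨c₁, hc₁, hc₁', h₁⟩ := hA.lintegral_entries
  obtain ⟨c₂, hc₂, hc₂', h₂⟩ := exists_lintegral_schurWeight (n := n) hε
  obtain ⟨c₃, hc₃, hc₃', h₃⟩ := lintegral_schurWeight (n := n) hn hε
  have hnf : (n ! : ℝ≥0∞) ≠ 0 := by exact_mod_cast (Nat.factorial_pos n).ne'
  refine ⟨c₁ * c₂ * c₃ * (n ! : ℝ≥0∞)⁻¹, ?_, ?_, fun Q b hb hb' hQ hQb => ?_⟩
  · exact mul_ne_zero (mul_ne_zero (mul_ne_zero hc₁ hc₂) hc₃)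
      (ENNReal.inv_ne_zero.2 (ENNReal.natCast_ne_top _))
  · exact ENNReal.mul_ne_top (ENNReal.mul_ne_top (ENNReal.mul_ne_top hc₁' hc₂') hc₃')
      (ENNReal.inv_ne_top.2 hnf)
  -- Dividing by the bound `b` meets the requirement `H ≤ 1` of `exists_lintegral_schurWeight`.
  let R : Multiset ℂ → ℝ≥0∞ := fun s => b⁻¹ * Q s
  have hR : Measurable fun z : Fin n → ℂ => R (Finset.univ.val.map z) := hQ.const_mul _
  have hR1 : ∀ z : Fin n → ℂ, R (Finset.univ.val.map z) ≤ 1 := fun z => by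
    calc b⁻¹ * Q (Finset.univ.val.map z) ≤ b⁻¹ * b := by gcongr; exact hQb z
      _ = 1 := ENNReal.inv_mul_cancel hb hb'
  have hQR : ∀ s, Q s = b * R s := fun s => by
    rw [← mul_assoc, ENNReal.mul_inv_cancel hb hb', one_mul]
  have hM : Measurable fun X : Fin (k + 1) × Fin n × Fin n → ℂ =>
      R (eigenvalueMultiset (signedProduct ε (block X))) :=
    measurable_comp_eigenvalueMultiset (measurable_signedProduct_block ε hε) hR
  have hsym := lintegral_sortedSet_indicator (weightMeasure n ε)
    (f := fun z : Fin n → ℂ => ENNReal.ofReal (vandermondeSq z) * R (Finset.univ.val.map z))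
    (measurable_vandermondeSq.ennreal_ofReal.mul hR)
    (fun z σ => by
      rw [vandermondeSq_comp_perm, ← Multiset.map_map, Multiset.map_univ_val_equiv])
    (fun z hz => by rw [vandermondeSq_eq_zero hz, ENNReal.ofReal_zero, zero_mul])
  have hmain : ∫⁻ ω, R (eigenvalueMultiset (signedProduct ε fun i => A i ω)) ∂P =
      c₁ * c₂ * c₃ * (n ! : ℝ≥0∞)⁻¹ * ∫⁻ z : Fin n → ℂ, ENNReal.ofReal (vandermondeSq z) *
        R (Finset.univ.val.map z) ∂Measure.pi fun _ => weightMeasure n ε := by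
    have e1 := h₁ _ hM
    have e2 := h₂ (fun X => R (eigenvalueMultiset (signedProduct ε (block X))))
      (fun z => R (Finset.univ.val.map z)) hR hR1
      fun X hX => by rw [eigenvalueMultiset_assemble hε hX.1]
    rw [e2, h₃ _ hR, hsym] at e1
    rw [mul_assoc, mul_assoc, mul_assoc]
    exact e1
  simp only [hQR]
  rw [lintegral_const_mul' _ _ hb', hmain]
  simp only [mul_left_comm _ b]
  rw [lintegral_const_mul' _ _ hb']
  ring

end EigenvalueDensity

/-! ### The joint density in uniformly random order. -/

section JointDensity

variable {n k : ℕ}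

theorem pi_weightMeasure_eq (hn : 1 ≤ n) {ε : Fin k → ℤ} (hε : ∀ j, ε j = 1 ∨ ε j = -1)
    {w : ℂ → ℝ} (hw : IsWeight n ε w) :
    (Measure.pi fun _ : Fin n => weightMeasure n ε) =
      (volume : Measure (Fin n → ℂ)).withDensity fun z => ∏ l, ENNReal.ofReal (w (z l)) := by
  have hfin := isFiniteMeasure_weightMeasure hn hε
  rw [← hw.withDensity_eq] at hfin ⊢
  exact Measure.pi_withDensity fun _ => hw.measurable.ennreal_ofReal

theorem IsIndepGinibre.exists_lintegral_eigenvalues_eq {Ω : Type*} [MeasurableSpace Ω]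
    {P : Measure Ω} [IsProbabilityMeasure P] (hn : 1 ≤ n) {ε : Fin (k + 1) → ℤ}
    (hε : ∀ j, ε j = 1 ∨ ε j = -1) {A : Fin (k + 1) → Ω → Matrix (Fin n) (Fin n) ℂ}
    (hA : IsIndepGinibre P A) {w : ℂ → ℝ} (hw : IsWeight n ε w) :
    ∃ C : ℝ, 0 < C ∧ ∀ (Q : Multiset ℂ → ℝ≥0∞) (b : ℝ≥0∞), b ≠ 0 → b ≠ ∞ →
      (Measurable fun z : Fin n → ℂ => Q (Finset.univ.val.map z)) →
      (∀ z : Fin n → ℂ, Q (Finset.univ.val.map z) ≤ b) →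
      ∫⁻ ω, Q (eigenvalueMultiset (signedProduct ε fun i => A i ω)) ∂P =
        ∫⁻ z : Fin n → ℂ, ENNReal.ofReal (C * ((∏ l, w (z l)) * vandermondeSq z)) *
          Q (Finset.univ.val.map z) := by
  obtain ⟨C, hC, hC', h⟩ := hA.exists_lintegral_eigenvalues hn hε
  refine ⟨C.toReal, ENNReal.toReal_pos hC hC', fun Q b hb hb' hQ hQb => ?_⟩
  have hm : Measurable fun z : Fin n → ℂ => ∏ l, ENNReal.ofReal (w (z l)) :=
    Finset.measurable_prod _ fun l _ => (hw.measurable.comp (measurable_pi_apply l)).ennreal_ofReal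
  rw [h Q b hb hb' hQ hQb, pi_weightMeasure_eq hn hε hw,
    lintegral_withDensity_eq_lintegral_mul _ hm
      (g := fun z => ENNReal.ofReal (vandermondeSq z) * Q (Finset.univ.val.map z))
      (measurable_vandermondeSq.ennreal_ofReal.mul hQ),
    ← lintegral_const_mul' _ _ hC']
  refine lintegral_congr fun z => ?_
  rw [Pi.mul_apply, ENNReal.ofReal_mul ENNReal.toReal_nonneg, ENNReal.ofReal_toReal hC',
    ENNReal.ofReal_mul (Finset.prod_nonneg fun l _ => hw.nonneg _),
    ENNReal.ofReal_prod_of_nonneg fun l _ => hw.nonneg _]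
  ring

/-- Against a symmetric `g` every permuted copy of `f` has the same integral; this is what cancels
the `1 / n!` of the uniformly random ordering. -/
theorem lintegral_mul_sum_comp_perm {g f : (Fin n → ℂ) → ℝ≥0∞} (hg : Measurable g)
    (hf : Measurable f) (hs : ∀ z (σ : Equiv.Perm (Fin n)), g (z ∘ σ) = g z) :
    ∫⁻ z, g z * ∑ σ : Equiv.Perm (Fin n), f (z ∘ σ) = n ! * ∫⁻ z, g z * f z := by
  have hσ : ∀ σ : Equiv.Perm (Fin n), MeasurePreserving fun z : Fin n → ℂ => z ∘ σ :=
    fun σ => measurePreserving_comp_perm volume σ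
  have h1 : ∀ z, g z * ∑ σ : Equiv.Perm (Fin n), f (z ∘ σ) =
      ∑ σ : Equiv.Perm (Fin n), g (z ∘ σ) * f (z ∘ σ) := fun z => by
    simp only [hs, Finset.mul_sum]
  rw [lintegral_congr h1, lintegral_finsetSum (f := fun (σ : Equiv.Perm (Fin n)) z =>
    g (z ∘ σ) * f (z ∘ σ)) _ fun σ _ => (hg.mul hf).comp (hσ σ).measurable]
  have : ∀ σ : Equiv.Perm (Fin n), ∫⁻ z, g (z ∘ σ) * f (z ∘ σ) = ∫⁻ z, g z * f z :=
    fun σ => (hσ σ).lintegral_comp (hg.mul hf)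
  simp only [this]
  rw [Finset.sum_const, Finset.card_univ, Fintype.card_perm, Fintype.card_fin, nsmul_eq_mul]

theorem orderingLaw_map_apply (z : Fin n → ℂ) {B : Set (Fin n → ℂ)} (hB : MeasurableSet B) :
    orderingLaw n (Finset.univ.val.map z) B =
      (n ! : ℝ≥0∞)⁻¹ * ∑ σ : Equiv.Perm (Fin n), B.indicator 1 (z ∘ σ) := by
  rw [orderingLaw_map, Measure.smul_apply, Measure.finsetSum_apply, smul_eq_mul]
  simp only [Measure.dirac_apply' _ hB]

theorem measurable_orderingLaw_map :
    Measurable fun z : Fin n → ℂ => orderingLaw n (Finset.univ.val.map z) := by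
  refine Measure.measurable_of_measurable_coe _ fun B hB => ?_
  simp only [orderingLaw_map_apply _ hB]
  exact Measurable.const_mul (Finset.measurable_sum _ fun σ _ =>
    (measurable_one.indicator hB).comp (measurePreserving_comp_perm volume σ).measurable) _

theorem IsIndepGinibre.aemeasurable_eigenvalues {Ω β : Type*} [MeasurableSpace Ω]
    [MeasurableSpace β] {P : Measure Ω} {ε : Fin k → ℤ}
    (hε : ∀ j, ε j = 1 ∨ ε j = -1) {A : Fin k → Ω → Matrix (Fin n) (Fin n) ℂ}
    (hA : IsIndepGinibre P A) {Q : Multiset ℂ → β}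
    (hQ : Measurable fun z : Fin n → ℂ => Q (Finset.univ.val.map z)) :
    AEMeasurable (fun ω => Q (eigenvalueMultiset (signedProduct ε fun i => A i ω))) P := by
  have h1 := measurable_comp_eigenvalueMultiset (measurable_signedProduct_block ε hε) hQ
  have h2 : AEMeasurable (fun ω (i : Fin k × Fin n × Fin n) => A i.1 ω i.2.1 i.2.2) P :=
    aemeasurable_pi_lambda _ fun i => (hA.law i.1 i.2.1 i.2.2).aemeasurable
  have h3 : ∀ ω, block (fun i : Fin k × Fin n × Fin n => A i.1 ω i.2.1 i.2.2) =
      fun i => A i ω := fun ω => rfl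
  have h4 := h1.comp_aemeasurable h2
  simp only [Function.comp_def] at h4
  refine h4.congr (Filter.Eventually.of_forall fun ω => ?_)
  simp only
  rw [h3]

theorem IsIndepGinibre.exists_hasEigenvalueDensity {Ω : Type*} [MeasurableSpace Ω]
    {P : Measure Ω} [IsProbabilityMeasure P] (hn : 1 ≤ n) {ε : Fin (k + 1) → ℤ}
    (hε : ∀ j, ε j = 1 ∨ ε j = -1) {A : Fin (k + 1) → Ω → Matrix (Fin n) (Fin n) ℂ}
    (hA : IsIndepGinibre P A) {w : ℂ → ℝ} (hw : IsWeight n ε w) :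
    ∃ C : ℝ, 0 < C ∧ HasEigenvalueDensity P (fun ω => signedProduct ε fun i => A i ω)
      fun z => C * ((∏ l, w (z l)) * vandermondeSq z) := by
  obtain ⟨C, hC, h⟩ := hA.exists_lintegral_eigenvalues_eq hn hε hw
  have hm : AEMeasurable (fun ω => uniformOrderingLaw (signedProduct ε fun i => A i ω)) P := by
    simp only [uniformOrderingLaw_eq]
    exact hA.aemeasurable_eigenvalues hε (Q := orderingLaw n) measurable_orderingLaw_map
  refine ⟨C, hC, hm, Measure.ext fun B hB => ?_⟩
  have hn0 : (n ! : ℝ≥0∞) ≠ 0 := by exact_mod_cast (Nat.factorial_pos n).ne'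
  have hn1 : (n ! : ℝ≥0∞) ≠ ∞ := ENNReal.natCast_ne_top _
  have hQ1 : ∀ z : Fin n → ℂ, orderingLaw n (Finset.univ.val.map z) B ≤ 1 := fun z => by
    rw [orderingLaw_map_apply z hB]
    calc (n ! : ℝ≥0∞)⁻¹ * ∑ σ : Equiv.Perm (Fin n), B.indicator 1 (z ∘ σ)
        ≤ (n ! : ℝ≥0∞)⁻¹ * ∑ σ : Equiv.Perm (Fin n), 1 := by
          gcongr with σ
          exact Set.indicator_le_self' (fun _ _ => zero_le) _
      _ = 1 := by
          rw [Finset.sum_const, Finset.card_univ, Fintype.card_perm, Fintype.card_fin,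
            nsmul_eq_mul, mul_one, ENNReal.inv_mul_cancel hn0 hn1]
  have hdm : Measurable fun z : Fin n → ℂ =>
      ENNReal.ofReal (C * ((∏ l, w (z l)) * vandermondeSq z)) :=
    (Measurable.const_mul ((Finset.measurable_prod _ fun l _ =>
      hw.measurable.comp (measurable_pi_apply l)).mul measurable_vandermondeSq) C).ennreal_ofReal
  rw [Measure.bind_apply hB hm, withDensity_apply _ hB, ← lintegral_indicator hB]
  simp only [uniformOrderingLaw_eq]
  rw [h (fun s => orderingLaw n s B) 1 one_ne_zero ENNReal.one_ne_top
    ((Measure.measurable_coe hB).comp measurable_orderingLaw_map) hQ1]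
  simp only [orderingLaw_map_apply _ hB, mul_left_comm _ (n ! : ℝ≥0∞)⁻¹]
  rw [lintegral_const_mul' _ _ (ENNReal.inv_ne_top.2 hn0),
    lintegral_mul_sum_comp_perm hdm (measurable_one.indicator hB) fun z σ => ?_, ← mul_assoc,
    ENNReal.inv_mul_cancel hn0 hn1, one_mul]
  · refine lintegral_congr fun z => ?_
    by_cases hz : z ∈ B <;> simp [hz]
  · rw [vandermondeSq_comp_perm]
    simp only [Function.comp_apply]
    rw [Equiv.prod_comp σ fun i => w (z i)]

end JointDensity

/-! ### Rotation invariance and moments of the weight. -/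

section Moments

variable {n k : ℕ}

theorem measurePreserving_mul_of_norm_eq_one {c : ℂ} (hc : ‖c‖ = 1) :
    MeasurePreserving fun z : ℂ => c * z := by
  have h := (rotation (⟨c, mem_sphere_zero_iff_norm.2 hc⟩ : Circle)).measurePreserving
  exact h

theorem map_withDensity_eq_self {α : Type*} [MeasurableSpace α] {μ : Measure α} {r : α → α}
    (hr : MeasurePreserving r μ μ) {d : α → ℝ≥0∞} (hd : Measurable d) (h : ∀ x, d (r x) = d x) :
    Measure.map r (μ.withDensity d) = μ.withDensity d := by
  ext s hs
  rw [Measure.map_apply hr.measurable hs, withDensity_apply _ hs,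
    withDensity_apply _ (hr.measurable hs), ← hr.setLIntegral_comp_preimage hs hd]
  simp only [h]

theorem map_mul_weightMeasure {ε : Fin (k + 1) → ℤ} (hε : ∀ j, ε j = 1 ∨ ε j = -1) {c : ℂ}
    (hc : ‖c‖ = 1) :
    Measure.map (fun z => c * z) (weightMeasure n ε) = weightMeasure n ε := by
  -- Rotating the first variable by `c ^ ε 0` multiplies the signed product by `(c ^ ε 0) ^ ε 0 = c`
  -- and leaves the density unchanged.
  let u : Fin (k + 1) → ℂ := fun j => if j = 0 then c ^ ε 0 else 1
  have hu : ∀ j, ‖u j‖ = 1 := fun j => by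
    by_cases h : j = 0 <;> simp [u, h, hc]
  let r : (Fin (k + 1) → ℂ) → Fin (k + 1) → ℂ := fun x j => u j * x j
  have hr : MeasurePreserving r :=
    volume_preserving_pi fun j => measurePreserving_mul_of_norm_eq_one (hu j)
  have hd : ∀ x, signedDensity n ε (r x) = signedDensity n ε x := fun x => by
    simp only [signedDensity, r, norm_mul, hu, one_mul]
  have hT : ∀ x, ∏ j, r x j ^ ε j = c * ∏ j, x j ^ ε j := fun x => by
    simp only [r, mul_zpow, Finset.prod_mul_distrib]
    congr 1
    rw [Fin.prod_univ_succ]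
    have h1 : (c ^ ε 0) ^ ε 0 = c := by
      rw [← zpow_mul]
      rcases hε 0 with h | h <;> simp [h]
    simp [u, Fin.succ_ne_zero, h1]
  have hm := measurable_signedProd ε
  have h := map_withDensity_eq_self hr (measurable_signedDensity n ε) hd
  conv_rhs => rw [weightMeasure, ← h]
  rw [weightMeasure, Measure.map_map (by fun_prop) hm, Measure.map_map hm hr.measurable]
  congr 1
  funext x
  exact (hT x).symm

/-- Pulled back to `ℂ^k`, the exponent of `|x_j|` becomes `2l` for sign `+1` and `2(n - 1 - l)` for
sign `-1`. The condition `l < n` makes the latter nonnegative, and each factor is then a finite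
Gaussian moment. -/
theorem lintegral_norm_pow_weightMeasure_ne_top {ε : Fin k → ℤ}
    (hε : ∀ j, ε j = 1 ∨ ε j = -1) {l : ℕ} (hl : l < n) :
    ∫⁻ z, ENNReal.ofReal (‖z‖ ^ (2 * l)) ∂weightMeasure n ε ≠ ∞ := by
  have hm : ∀ j, ∃ m : ℕ, (1 - ε j) * ((n : ℤ) - 1) + ε j * (2 * l : ℕ) = m := fun j => by
    rcases hε j with h | h
    · exact ⟨2 * l, by rw [h]; ring⟩
    · refine ⟨2 * (n - 1 - l), ?_⟩
      rw [h]
      omega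
  choose m hm using hm
  rw [weightMeasure, lintegral_map (by fun_prop) (measurable_signedProd ε)]
  have hwd := lintegral_withDensity_eq_lintegral_mul volume (measurable_signedDensity n ε)
    (g := fun x => ENNReal.ofReal (‖∏ j, x j ^ ε j‖ ^ (2 * l)))
    ((measurable_signedProd ε).norm.pow_const _).ennreal_ofReal
  rw [hwd]
  have h : ∀ᵐ x : Fin k → ℂ, (signedDensity n ε *
      fun x : Fin k → ℂ => ENNReal.ofReal (‖∏ j, x j ^ ε j‖ ^ (2 * l))) x =
      ∏ j, ENNReal.ofReal (‖x j‖ ^ m j * Real.exp (-‖x j‖ ^ 2)) := by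
    filter_upwards [ae_forall_ne_zero] with x hx
    rw [Pi.mul_apply, signedDensity, ← ENNReal.ofReal_mul (by positivity),
      ← ENNReal.ofReal_prod_of_nonneg fun _ _ => by positivity,
      Finset.prod_mul_distrib, ← Real.exp_sum, Finset.sum_neg_distrib, mul_assoc, mul_comm,
      norm_prod, ← Finset.prod_pow, ← Finset.prod_mul_distrib]
    congr 2
    refine Finset.prod_congr rfl fun j _ => ?_
    rw [norm_zpow, ← zpow_natCast (‖x j‖ ^ ε j), ← zpow_mul,
      ← zpow_add₀ (norm_ne_zero_iff.2 (hx j)), hm, zpow_natCast]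
  rw [lintegral_congr_ae h, volume_pi, lintegral_fintype_prod_eq_prod
    (f := fun j z => ENNReal.ofReal (‖z‖ ^ m j * Real.exp (-‖z‖ ^ 2))) fun i => by fun_prop]
  exact ENNReal.prod_ne_top fun j _ => (lintegral_norm_pow_mul_exp_lt_top (m j)).ne

theorem weightMeasure_ne_zero (n : ℕ) (ε : Fin k → ℤ) : weightMeasure n ε ≠ 0 := by
  intro h
  rw [weightMeasure, Measure.map_eq_zero_iff (measurable_signedProd ε).aemeasurable,
    withDensity_eq_zero_iff (measurable_signedDensity n ε).aemeasurable] at h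
  obtain ⟨x, hx, hx'⟩ := (h.and (ae_forall_ne_zero (ι := Fin k))).exists
  rw [Pi.zero_apply, signedDensity, ENNReal.ofReal_eq_zero, ← not_lt] at hx
  exact hx (mul_pos (Real.exp_pos _)
    (Finset.prod_pos fun j _ => zpow_pos (norm_pos_iff.2 (hx' j)) _))

theorem IsWeight.integrable_norm_pow_mul {ε : Fin k → ℤ} (hε : ∀ j, ε j = 1 ∨ ε j = -1)
    {w : ℂ → ℝ} (hw : IsWeight n ε w) {l : ℕ} (hl : l < n) :
    Integrable fun z : ℂ => ‖z‖ ^ (2 * l) * w z := by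
  have hm := hw.measurable
  refine ⟨(by fun_prop : Measurable _).aestronglyMeasurable, ?_⟩
  rw [hasFiniteIntegral_iff_ofReal (Filter.Eventually.of_forall fun z =>
    mul_nonneg (by positivity) (hw.nonneg z)), lt_top_iff_ne_top]
  have h := lintegral_norm_pow_weightMeasure_ne_top hε hl
  rw [← hw.withDensity_eq, lintegral_withDensity_eq_lintegral_mul _ hm.ennreal_ofReal
    (by fun_prop)] at h
  refine ne_of_eq_of_ne (lintegral_congr fun z => ?_) h
  rw [Pi.mul_apply, ← ENNReal.ofReal_mul (hw.nonneg z), mul_comm]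

theorem IsWeight.integral_norm_pow_mul_pos {ε : Fin k → ℤ} (hε : ∀ j, ε j = 1 ∨ ε j = -1)
    {w : ℂ → ℝ} (hw : IsWeight n ε w) {l : ℕ} (hl : l < n) :
    0 < ∫ z : ℂ, ‖z‖ ^ (2 * l) * w z := by
  have h0 : ∀ z : ℂ, 0 ≤ ‖z‖ ^ (2 * l) * w z := fun z => mul_nonneg (by positivity) (hw.nonneg z)
  refine lt_of_le_of_ne (integral_nonneg h0) fun h => weightMeasure_ne_zero n ε ?_
  rw [eq_comm, integral_eq_zero_iff_of_nonneg h0 (hw.integrable_norm_pow_mul hε hl)] at h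
  rw [← hw.withDensity_eq, withDensity_eq_zero_iff hw.measurable.ennreal_ofReal.aemeasurable]
  have hne : ∀ᵐ z : ℂ, z ≠ 0 := ae_iff.2 (by simp)
  filter_upwards [h, hne] with z hz hz0
  rcases mul_eq_zero.1 hz with h1 | h1
  · exact absurd h1 (by positivity)
  · simp [h1]

theorem IsWeight.integral_smul_eq {ε : Fin k → ℤ} {w : ℂ → ℝ} (hw : IsWeight n ε w)
    (f : ℂ → ℂ) : ∫ z, f z ∂weightMeasure n ε = ∫ z, (w z : ℂ) * f z := by
  have hd := hw.withDensity_eq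
  have h1 : (fun z => ENNReal.ofReal (w z)) = fun z => ((w z).toNNReal : ℝ≥0∞) := rfl
  rw [← hd, h1, integral_withDensity_eq_integral_smul hw.measurable.real_toNNReal]
  refine integral_congr_ae (Filter.Eventually.of_forall fun z => ?_)
  simp only [NNReal.smul_def, Real.coe_toNNReal _ (hw.nonneg z), Complex.real_smul]

/-- Rotation by the angle `π / (l - m)` preserves the weight measure and changes the sign of the
integrand. -/
theorem IsWeight.integral_pow_mul_conj_pow_eq_zero {ε : Fin (k + 1) → ℤ}
    (hε : ∀ j, ε j = 1 ∨ ε j = -1) {w : ℂ → ℝ} (hw : IsWeight n ε w) {l m : ℕ} (hlm : l ≠ m) :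
    ∫ z : ℂ, (w z : ℂ) * (z ^ l * starRingEnd ℂ z ^ m) = 0 := by
  have hne : ((l : ℝ) - m) ≠ 0 := sub_ne_zero.2 (by exact_mod_cast hlm)
  let θ : ℝ := Real.pi / ((l : ℝ) - m)
  let c : ℂ := Complex.exp (θ * Complex.I)
  have hc : ‖c‖ = 1 := Complex.norm_exp_ofReal_mul_I θ
  have hcc : c ^ l * starRingEnd ℂ c ^ m = -1 := by
    rw [← Complex.exp_conj, map_mul, Complex.conj_ofReal, Complex.conj_I, ← Complex.exp_nat_mul,
      ← Complex.exp_nat_mul, ← Complex.exp_add, ← Complex.exp_pi_mul_I]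
    congr 1
    have : (Real.pi : ℂ) = θ * (l - m) := by
      have : Real.pi = θ * (l - m) := (div_mul_cancel₀ _ hne).symm
      exact_mod_cast congrArg (fun t : ℝ => (t : ℂ)) this
    rw [this]
    ring
  rw [← hw.integral_smul_eq]
  have h : ∫ z, z ^ l * starRingEnd ℂ z ^ m ∂weightMeasure n ε =
      -∫ z, z ^ l * starRingEnd ℂ z ^ m ∂weightMeasure n ε := by
    conv_lhs => rw [← map_mul_weightMeasure hε hc]
    rw [integral_map (by fun_prop)
      (Continuous.aestronglyMeasurable (by fun_prop)), ← integral_neg]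
    refine integral_congr_ae (Filter.Eventually.of_forall fun z => ?_)
    simp only [map_mul, mul_pow]
    rw [mul_mul_mul_comm, hcc, neg_one_mul]
  exact self_eq_neg.1 h

end Moments

/-! ### Projection kernels and integrating out points. -/

section ProjectionKernel

/-- Expansion along the first row leaves minors that contain the first column; up to a cyclic shift
of columns these are the determinants in Cramer's rule, hence given by the adjugate. -/
theorem Matrix.det_bordered {R : Type*} [CommRing R] {m : ℕ}
    (M : Matrix (Fin (m + 1)) (Fin (m + 1)) R) :
    M.det = M 0 0 * (M.submatrix Fin.succ Fin.succ).det -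
      ∑ j, ∑ i, (M.submatrix Fin.succ Fin.succ).adjugate j i * (M 0 j.succ * M i.succ 0) := by
  rw [Matrix.det_succ_row_zero, Fin.sum_univ_succ, sub_eq_add_neg, ← Finset.sum_neg_distrib]
  congr 1
  · simp
  refine Finset.sum_congr rfl fun j _ => ?_
  have hj : ∑ i, (M.submatrix Fin.succ Fin.succ).adjugate j i * (M 0 j.succ * M i.succ 0) =
      M 0 j.succ * ((M.submatrix Fin.succ Fin.succ).updateCol j fun i => M i.succ 0).det := by
    rw [← Matrix.cramer_apply, Matrix.cramer_eq_adjugate_mulVec, Matrix.mulVec, dotProduct,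
      Finset.mul_sum]
    exact Finset.sum_congr rfl fun i _ => by ring
  rw [hj]
  rcases m with _ | m
  · exact j.elim0
  have hs : M.submatrix Fin.succ (Fin.succAbove j.succ) =
      ((M.submatrix Fin.succ Fin.succ).updateCol j fun i => M i.succ 0).submatrix id
        j.cycleRange.symm := by
    ext a b
    refine Fin.cases ?_ (fun b => ?_) b
    · simp
    · simp [Fin.succAbove_ne]
  rw [hs, Matrix.det_permute', Equiv.Perm.sign_symm, Fin.sign_cycleRange]
  have h2 : ((-1 : R) ^ (j : ℕ)) * (-1) ^ (j : ℕ) = 1 := by rw [← mul_pow]; simp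
  push_cast [Fin.val_succ, pow_succ]
  linear_combination (-(M 0 j.succ *
    ((M.submatrix Fin.succ Fin.succ).updateCol j fun i => M i.succ 0).det)) * h2

variable {n : ℕ}

/-- An orthonormal system of `n` functions on the complex plane. -/
structure IsOrthonormalSystem (u : Fin n → ℂ → ℂ) : Prop where
  measurable : ∀ l, Measurable (u l)
  integrable : ∀ l m, Integrable fun t => u l t * starRingEnd ℂ (u m t)
  integral_eq : ∀ l m, ∫ t, u l t * starRingEnd ℂ (u m t) = if l = m then 1 else 0

/-- The kernel of the orthogonal projection onto the span of an orthonormal system. -/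
noncomputable def projectionKernel (u : Fin n → ℂ → ℂ) (x y : ℂ) : ℂ :=
  ∑ l, u l x * starRingEnd ℂ (u l y)

/-- The Gram matrix of a kernel. -/
noncomputable def kernelMatrix {m : ℕ} (K : ℂ → ℂ → ℂ) (x : Fin m → ℂ) : Matrix (Fin m) (Fin m) ℂ :=
  Matrix.of fun i j => K (x i) (x j)

theorem projectionKernel_conj (u : Fin n → ℂ → ℂ) (x y : ℂ) :
    projectionKernel u y x = starRingEnd ℂ (projectionKernel u x y) := by
  simp only [projectionKernel, map_sum, map_mul, Complex.conj_conj, mul_comm]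

theorem kernelMatrix_projectionKernel {m : ℕ} (u : Fin n → ℂ → ℂ) (x : Fin m → ℂ) :
    kernelMatrix (projectionKernel u) x = (Matrix.of fun i l => u l (x i)) *
      (Matrix.of fun i l => u l (x i)).conjTranspose := by
  ext i j
  simp [kernelMatrix, projectionKernel, Matrix.mul_apply]

/-- The joint intensities of the determinantal process. -/
noncomputable def detIntensity {m : ℕ} (u : Fin n → ℂ → ℂ) (x : Fin m → ℂ) : ℝ :=
  (kernelMatrix (projectionKernel u) x).det.re

open scoped ComplexOrder in
theorem det_kernelMatrix_nonneg {m : ℕ} (u : Fin n → ℂ → ℂ) (x : Fin m → ℂ) :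
    0 ≤ (kernelMatrix (projectionKernel u) x).det := by
  rw [kernelMatrix_projectionKernel]
  exact (Matrix.posSemidef_self_mul_conjTranspose _).det_nonneg

theorem detIntensity_nonneg {m : ℕ} (u : Fin n → ℂ → ℂ) (x : Fin m → ℂ) :
    0 ≤ detIntensity u x :=
  (Complex.le_def.1 (det_kernelMatrix_nonneg u x)).1

theorem ofReal_detIntensity {m : ℕ} (u : Fin n → ℂ → ℂ) (x : Fin m → ℂ) :
    ((detIntensity u x : ℝ) : ℂ) = (kernelMatrix (projectionKernel u) x).det :=
  Complex.ext rfl (Complex.le_def.1 (det_kernelMatrix_nonneg u x)).2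

theorem detIntensity_eq_norm_sq (u : Fin n → ℂ → ℂ) (z : Fin n → ℂ) :
    detIntensity u z = ‖(Matrix.of fun i l => u l (z i)).det‖ ^ 2 := by
  rw [detIntensity, kernelMatrix_projectionKernel, Matrix.det_mul, Matrix.det_conjTranspose,
    RCLike.star_def, Complex.mul_conj, Complex.ofReal_re, Complex.normSq_eq_norm_sq]

theorem detIntensity_eq_zero_of_not_injective {m : ℕ} (u : Fin n → ℂ → ℂ) {x : Fin m → ℂ}
    (hx : ¬ Function.Injective x) : detIntensity u x = 0 := by
  simp only [Function.Injective, not_forall] at hx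
  obtain ⟨i, j, hij, hne⟩ := hx
  rw [detIntensity, Matrix.det_zero_of_row_eq hne, Complex.zero_re]
  funext l
  simp only [kernelMatrix, Matrix.of_apply, hij]

/-- The kernel matrix has rank at most `n`. -/
theorem detIntensity_eq_zero_of_lt {m : ℕ} (hm : n < m) (u : Fin n → ℂ → ℂ) (x : Fin m → ℂ) :
    detIntensity u x = 0 := by
  have h : (kernelMatrix (projectionKernel u) x).det = 0 := by
    by_contra h
    have h1 := Matrix.rank_of_isUnit _ ((Matrix.isUnit_iff_isUnit_det _).2 (isUnit_iff_ne_zero.2 h))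
    rw [kernelMatrix_projectionKernel, Fintype.card_fin] at h1
    have h2 := (Matrix.rank_mul_le_left (Matrix.of fun i l => u l (x i))
      (Matrix.of fun i l => u l (x i)).conjTranspose).trans (Matrix.rank_le_width _)
    omega
  rw [detIntensity, h, Complex.zero_re]

theorem detIntensity_comp_perm {m : ℕ} (u : Fin n → ℂ → ℂ) (x : Fin m → ℂ)
    (σ : Equiv.Perm (Fin m)) : detIntensity u (x ∘ σ) = detIntensity u x := by
  have : kernelMatrix (projectionKernel u) (x ∘ σ) =
      (kernelMatrix (projectionKernel u) x).submatrix σ σ := rfl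
  rw [detIntensity, detIntensity, this, Matrix.det_submatrix_equiv_self]

theorem IsOrthonormalSystem.measurable_kernel {u : Fin n → ℂ → ℂ} (hu : IsOrthonormalSystem u) :
    Measurable (Function.uncurry (projectionKernel u)) := by
  have := hu.measurable
  unfold Function.uncurry projectionKernel
  refine Finset.measurable_sum _ fun l _ => Measurable.mul ((this l).comp measurable_fst) ?_
  exact Complex.continuous_conj.measurable.comp ((this l).comp measurable_snd)

theorem IsOrthonormalSystem.measurable_detIntensity {u : Fin n → ℂ → ℂ}
    (hu : IsOrthonormalSystem u) (m : ℕ) : Measurable (detIntensity (m := m) u) := by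
  refine Complex.measurable_re.comp ?_
  simp only [Matrix.det_apply]
  refine Finset.measurable_sum _ fun σ _ => Measurable.const_smul (Finset.measurable_prod _
    fun i _ => ?_) _
  have h : Measurable fun x : Fin m → ℂ => (x (σ i), x i) := by fun_prop
  exact hu.measurable_kernel.comp h

theorem IsOrthonormalSystem.integrable_kernel_mul {u : Fin n → ℂ → ℂ}
    (hu : IsOrthonormalSystem u) (x y : ℂ) :
    Integrable fun t => projectionKernel u t y * projectionKernel u x t := by
  have h : (fun t => projectionKernel u t y * projectionKernel u x t) = fun t =>
      ∑ l, ∑ m, (u l t * starRingEnd ℂ (u m t)) * (u m x * starRingEnd ℂ (u l y)) := by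
    funext t
    rw [projectionKernel, projectionKernel, Finset.sum_mul_sum]
    exact Finset.sum_congr rfl fun l _ => Finset.sum_congr rfl fun m _ => by ring
  rw [h]
  exact integrable_finsetSum _ fun l _ => integrable_finsetSum _ fun m _ =>
    (hu.integrable l m).mul_const _

theorem IsOrthonormalSystem.integral_kernel_mul {u : Fin n → ℂ → ℂ}
    (hu : IsOrthonormalSystem u) (x y : ℂ) :
    ∫ t, projectionKernel u t y * projectionKernel u x t = projectionKernel u x y := by
  have h : (fun t => projectionKernel u t y * projectionKernel u x t) = fun t =>
      ∑ l, ∑ m, (u l t * starRingEnd ℂ (u m t)) * (u m x * starRingEnd ℂ (u l y)) := by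
    funext t
    rw [projectionKernel, projectionKernel, Finset.sum_mul_sum]
    exact Finset.sum_congr rfl fun l _ => Finset.sum_congr rfl fun m _ => by ring
  rw [h, integral_finsetSum _ fun l _ => integrable_finsetSum _ fun m _ =>
    (hu.integrable l m).mul_const _]
  refine Finset.sum_congr rfl fun l _ => ?_
  rw [integral_finsetSum _ fun m _ => (hu.integrable l m).mul_const _]
  simp only [integral_mul_const, hu.integral_eq, ite_mul, one_mul, zero_mul,
    Finset.sum_ite_eq, Finset.mem_univ, if_true]

theorem IsOrthonormalSystem.integrable_kernel_diag {u : Fin n → ℂ → ℂ}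
    (hu : IsOrthonormalSystem u) : Integrable fun t => projectionKernel u t t :=
  integrable_finsetSum _ fun l _ => hu.integrable l l

theorem IsOrthonormalSystem.integral_kernel_diag {u : Fin n → ℂ → ℂ}
    (hu : IsOrthonormalSystem u) : ∫ t, projectionKernel u t t = n := by
  unfold projectionKernel
  rw [integral_finsetSum _ fun l _ => hu.integrable l l]
  simp [hu.integral_eq]

theorem det_kernelMatrix_cons {m : ℕ} (K : ℂ → ℂ → ℂ) (t : ℂ) (x : Fin m → ℂ) :
    (kernelMatrix K (Fin.cons t x : Fin (m + 1) → ℂ)).det =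
      K t t * (kernelMatrix K x).det -
        ∑ j, ∑ i, (kernelMatrix K x).adjugate j i * (K t (x j) * K (x i) t) := by
  rw [Matrix.det_bordered]
  rfl

theorem IsOrthonormalSystem.integrable_det {u : Fin n → ℂ → ℂ} (hu : IsOrthonormalSystem u)
    {m : ℕ} (x : Fin m → ℂ) : Integrable fun t =>
      (kernelMatrix (projectionKernel u) (Fin.cons t x : Fin (m + 1) → ℂ)).det := by
  simp only [det_kernelMatrix_cons]
  exact (hu.integrable_kernel_diag.mul_const _).sub (integrable_finsetSum _ fun j _ =>
    integrable_finsetSum _ fun i _ => (hu.integrable_kernel_mul _ _).const_mul _)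

/-- In the bordered expansion the diagonal term integrates to the trace `n` of the kernel. By the
reproducing property the remaining terms become the trace of `adj(K) * K = det K • 1`, which is `m *
det K`. -/
theorem IsOrthonormalSystem.integral_det {u : Fin n → ℂ → ℂ} (hu : IsOrthonormalSystem u)
    {m : ℕ} (x : Fin m → ℂ) :
    ∫ t, (kernelMatrix (projectionKernel u) (Fin.cons t x : Fin (m + 1) → ℂ)).det =
      ((n : ℂ) - m) * (kernelMatrix (projectionKernel u) x).det := by
  have hI : ∀ j : Fin m, Integrable fun t => ∑ i, (kernelMatrix (projectionKernel u) x).adjugate j i *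
      (projectionKernel u t (x j) * projectionKernel u (x i) t) := fun j =>
    integrable_finsetSum _ fun i _ => (hu.integrable_kernel_mul _ _).const_mul _
  simp only [det_kernelMatrix_cons]
  rw [integral_sub (hu.integrable_kernel_diag.mul_const _) (integrable_finsetSum _ fun j _ => hI j),
    integral_mul_const, hu.integral_kernel_diag, sub_mul, integral_finsetSum _ fun j _ => hI j]
  congr 1
  have h : ∀ j, ∫ t, ∑ i, (kernelMatrix (projectionKernel u) x).adjugate j i *
      (projectionKernel u t (x j) * projectionKernel u (x i) t) =
      ((kernelMatrix (projectionKernel u) x).adjugate * kernelMatrix (projectionKernel u) x) j j :=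
    fun j => by
      rw [integral_finsetSum _ fun i _ => (hu.integrable_kernel_mul _ _).const_mul _,
        Matrix.mul_apply]
      refine Finset.sum_congr rfl fun i _ => ?_
      rw [integral_const_mul, hu.integral_kernel_mul]
      rfl
  simp only [h, Matrix.adjugate_mul]
  simp

theorem IsOrthonormalSystem.lintegral_detIntensity_cons {u : Fin n → ℂ → ℂ}
    (hu : IsOrthonormalSystem u) {m : ℕ} (hm : m ≤ n) (x : Fin m → ℂ) :
    ∫⁻ t, ENNReal.ofReal (detIntensity u (Fin.cons t x : Fin (m + 1) → ℂ)) =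
      ((n - m : ℕ) : ℝ≥0∞) * ENNReal.ofReal (detIntensity u x) := by
  have hi : Integrable fun t => detIntensity u (Fin.cons t x : Fin (m + 1) → ℂ) :=
    (hu.integrable_det x).re
  rw [← ofReal_integral_eq_lintegral_ofReal hi
    (Filter.Eventually.of_forall fun t => detIntensity_nonneg u _)]
  have h1 : ∫ t, detIntensity u (Fin.cons t x : Fin (m + 1) → ℂ) =
      ((n - m : ℕ) : ℝ) * detIntensity u x := by
    have h2 := hu.integral_det x
    simp only [← ofReal_detIntensity] at h2
    rw [integral_complex_ofReal] at h2
    rw [Nat.cast_sub hm]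
    exact_mod_cast h2
  rw [← ENNReal.ofReal_natCast, ← ENNReal.ofReal_mul (Nat.cast_nonneg _), ← h1]

/-- Integrating out the first coordinates of the joint intensities. -/
theorem IsOrthonormalSystem.lintegral_mul_detIntensity {u : Fin n → ℂ → ℂ}
    (hu : IsOrthonormalSystem u) {m : ℕ} {g : (Fin m → ℂ) → ℝ≥0∞} (hg : Measurable g) {N : ℕ}
    (hmN : m ≤ N) (hN : N ≤ n) :
    ((n - N)! : ℝ≥0∞) * ∫⁻ z : Fin N → ℂ, g (fun i => z ⟨N - m + i, by omega⟩) *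
        ENNReal.ofReal (detIntensity u z) =
      ((n - m)! : ℝ≥0∞) * ∫⁻ x, g x * ENNReal.ofReal (detIntensity u x) := by
  -- Each step integrates out coordinate `0`, so `g` reads the last `m` coordinates.
  induction N, hmN using Nat.le_induction with
  | base => simp
  | succ N hmN ih =>
    rw [← ih (by omega)]
    have hf : (n - N)! = (n - (N + 1))! * (n - N) := by
      rw [show n - N = n - (N + 1) + 1 by omega, Nat.factorial_succ, mul_comm]
    rw [hf, Nat.cast_mul, mul_assoc]
    congr 1
    have hmeas : ∀ N (h : m ≤ N), Measurable fun z : Fin N → ℂ =>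
        g (fun i : Fin m => z ⟨N - m + i, by omega⟩) * ENNReal.ofReal (detIntensity u z) :=
      fun N h => (hg.comp (by fun_prop)).mul (hu.measurable_detIntensity N).ennreal_ofReal
    have he := (volume_preserving_piFinSuccAbove (fun _ : Fin (N + 1) => ℂ) 0).symm
    have hsplit := lintegral_prod_symm (μ := (volume : Measure ℂ))
      (ν := (volume : Measure (Fin N → ℂ))) _
      ((hmeas (N + 1) (by omega)).comp he.measurable).aemeasurable
    simp only [Function.comp_def] at hsplit
    rw [← he.lintegral_comp (hmeas (N + 1) (by omega)), Measure.volume_eq_prod, hsplit,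
      ← lintegral_const_mul _ (hmeas N hmN)]
    refine lintegral_congr fun x => ?_
    have hc : ∀ t, (MeasurableEquiv.piFinSuccAbove (fun _ : Fin (N + 1) => ℂ) 0).symm (t, x) =
        Fin.cons t x := fun t => by
      simp [MeasurableEquiv.piFinSuccAbove_symm_apply, Fin.insertNthEquiv]
    have hi : ∀ t, (fun i : Fin m => (Fin.cons t x : Fin (N + 1) → ℂ)
        ⟨N + 1 - m + i, by omega⟩) = fun i : Fin m => x ⟨N - m + i, by omega⟩ := fun t => by
      funext i
      have : (⟨N + 1 - m + i, by omega⟩ : Fin (N + 1)) = Fin.succ ⟨N - m + i, by omega⟩ :=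
        Fin.ext (by simp only [Fin.val_succ]; omega)
      rw [this, Fin.cons_succ]
    simp only [hc, hi]
    have hcm : Measurable fun t : ℂ => (Fin.cons t x : Fin (N + 1) → ℂ) := by
      simp only [← hc]
      exact he.measurable.comp (by fun_prop)
    have hdm : Measurable fun t : ℂ =>
        ENNReal.ofReal (detIntensity u (Fin.cons t x : Fin (N + 1) → ℂ)) :=
      ((hu.measurable_detIntensity (N + 1)).comp hcm).ennreal_ofReal
    rw [lintegral_const_mul _ hdm,
      hu.lintegral_detIntensity_cons (by omega)]
    ring

end ProjectionKernel

/-! ### From a determinantal density to joint intensities. -/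

section Determinantal

variable {n : ℕ}

theorem pointCount_map (z : Fin n → ℂ) (D : Set ℂ) :
    (pointCount (Finset.univ.val.map z) D : ℝ≥0∞) = ∑ a, D.indicator 1 (z a) := by
  classical
  rw [pointCount, Multiset.countP_map, ← Finset.filter_val, Finset.card_val, Finset.card_filter,
    Nat.cast_sum]
  refine Finset.sum_congr rfl fun a _ => ?_
  by_cases h : z a ∈ D <;> simp [h]

theorem measurable_pointCount_map {D : Set ℂ} (hD : MeasurableSet D) :
    Measurable fun z : Fin n → ℂ => pointCount (Finset.univ.val.map z) D := by
  have h : Measurable fun z : Fin n → ℂ => (pointCount (Finset.univ.val.map z) D : ℝ≥0∞) := by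
    simp only [pointCount_map]
    exact Finset.measurable_sum _ fun a _ =>
      (measurable_one.indicator hD).comp (measurable_pi_apply a)
  have h2 := Nat.measurable_floor.comp h.ennreal_toReal
  simpa only [Function.comp_def, ENNReal.toReal_natCast, Nat.floor_natCast] using h2

theorem pointCount_le_card (s : Multiset ℂ) (D : Set ℂ) : pointCount s D ≤ s.card :=
  by classical exact Multiset.countP_le_card _ _

theorem exists_perm_comp_eq {m : ℕ} (f e : Fin m ↪ Fin n) :
    ∃ σ : Equiv.Perm (Fin n), ∀ i, σ (e i) = f i := by
  classical
  obtain ⟨σ, hσ⟩ := Equiv.Perm.exists_extending_pair e f e.injective f.injective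
  exact ⟨σ, hσ⟩

/-- Expanding the product of counts gives a sum over all maps; disjointness of the `D i` kills those
that use a point twice. -/
theorem prod_pointCount_map {m : ℕ} (z : Fin n → ℂ) {D : Fin m → Set ℂ}
    (hD : Pairwise fun i j => Disjoint (D i) (D j)) :
    ∏ i, (pointCount (Finset.univ.val.map z) (D i) : ℝ≥0∞) =
      ∑ f : Fin m ↪ Fin n, ∏ i, (D i).indicator 1 (z (f i)) := by
  classical
  simp only [pointCount_map]
  rw [Finset.prod_univ_sum, Fintype.piFinset_univ]
  have h : ∀ f : Fin m → Fin n, ¬ Function.Injective f →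
      ∏ i, (D i).indicator (1 : ℂ → ℝ≥0∞) (z (f i)) = 0 := fun f hf => by
    simp only [Function.Injective, not_forall] at hf
    obtain ⟨i, j, hij, hne⟩ := hf
    by_cases hi : z (f i) ∈ D i
    · refine Finset.prod_eq_zero (Finset.mem_univ j) (Set.indicator_of_notMem ?_ _)
      rw [← hij]
      exact Set.disjoint_left.1 (hD hne) hi
    · exact Finset.prod_eq_zero (Finset.mem_univ i) (Set.indicator_of_notMem hi _)
  refine (Finset.sum_of_injOn (fun f : Fin m ↪ Fin n => (f : Fin m → Fin n))
    DFunLike.coe_injective.injOn (fun _ _ => Finset.mem_coe.2 (Finset.mem_univ _)) ?_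
    fun _ _ => rfl).symm
  intro f _ hf
  exact h f fun hinj => hf ⟨⟨f, hinj⟩, Finset.mem_coe.2 (Finset.mem_univ _), rfl⟩

/-- By symmetry each of the `n! / (n - m)!` injective tuples of points contributes the same
integral, which equals `(n - m)!` times the integral of the `m`-point determinant. The factor `c *
n!` that remains is `1`. -/
theorem isDeterminantalPointProcess_of_density {Ω : Type*} [MeasurableSpace Ω] {P : Measure Ω}
    [IsProbabilityMeasure P] {X : Ω → Multiset ℂ} {u : Fin n → ℂ → ℂ} (hu : IsOrthonormalSystem u)
    (hX : ∀ {β : Type} [MeasurableSpace β] {Q : Multiset ℂ → β},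
      (Measurable fun z : Fin n → ℂ => Q (Finset.univ.val.map z)) →
      AEMeasurable (fun ω => Q (X ω)) P) {c : ℝ} (hc : 0 ≤ c)
    (hlaw : ∀ (Q : Multiset ℂ → ℝ≥0∞) (b : ℝ≥0∞), b ≠ 0 → b ≠ ∞ →
      (Measurable fun z : Fin n → ℂ => Q (Finset.univ.val.map z)) →
      (∀ z : Fin n → ℂ, Q (Finset.univ.val.map z) ≤ b) →
      ∫⁻ ω, Q (X ω) ∂P = ∫⁻ z : Fin n → ℂ, ENNReal.ofReal (c * detIntensity u z) *
        Q (Finset.univ.val.map z)) :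
    IsDeterminantalPointProcess P X (projectionKernel u) := by
  have hdm := hu.measurable_detIntensity
  -- The normalization is forced by total mass one: integrating out all `n` points gives `n!`.
  have hcn : ENNReal.ofReal c * (n ! : ℝ≥0∞) = 1 := by
    have h1 := hlaw (fun _ => 1) 1 one_ne_zero ENNReal.one_ne_top measurable_const fun _ => le_rfl
    have h2 := hu.lintegral_mul_detIntensity (m := 0) (g := fun _ => 1) measurable_const
      (Nat.zero_le n) le_rfl
    have h3 : detIntensity u (default : Fin 0 → ℂ) = 1 := by simp [detIntensity]
    simp only [lintegral_const, measure_univ, mul_one, ENNReal.ofReal_mul hc] at h1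
    rw [lintegral_const_mul' _ _ ENNReal.ofReal_ne_top] at h1
    simp only [Nat.sub_self, Nat.factorial_zero, Nat.cast_one, one_mul, Nat.sub_zero] at h2
    rw [h2, volume_pi, Measure.pi_of_empty, lintegral_dirac] at h1
    have h4 : ∀ x : Fin 0 → ℂ, detIntensity u x = 1 := fun x => by simp [detIntensity]
    rw [h4, ENNReal.ofReal_one, mul_one] at h1
    exact h1.symm
  refine ⟨fun D hD => hX (measurable_pointCount_map hD), ?_, hu.measurable_kernel,
    fun x y => projectionKernel_conj u x y, fun m => ⟨fun x =>
      (detIntensity u x).toNNReal, ⟨(hdm m).real_toNNReal, fun D hD hdisj => ?_⟩, fun x => by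
        rw [Real.coe_toNNReal _ (detIntensity_nonneg u x), ofReal_detIntensity]
        rfl⟩⟩
  · classical
    have hQ : Measurable fun z : Fin n → ℂ =>
        if (Finset.univ.val.map z : Multiset ℂ).Nodup then (0 : ℝ≥0∞) else 1 := by
      refine Measurable.ite ?_ measurable_const measurable_const
      have : {z : Fin n → ℂ | (Finset.univ.val.map z : Multiset ℂ).Nodup} =
          ⋂ i, ⋂ j, ⋂ _ : i ≠ j, {z : Fin n → ℂ | z i = z j}ᶜ := by
        ext z
        simp only [Set.mem_iInter, Set.mem_compl_iff, Set.mem_ofPred_eq]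
        rw [Multiset.nodup_map_iff_inj_on Finset.univ.nodup]
        simp only [Finset.mem_val, Finset.mem_univ, true_implies]
        exact ⟨fun h i j hij he => hij (h _ _ he), fun h i j he => by_contra fun hij => h i j hij he⟩
      rw [this]
      exact MeasurableSet.iInter fun i => MeasurableSet.iInter fun j => MeasurableSet.iInter fun _ =>
        (measurableSet_eq_fun (measurable_pi_apply i) (measurable_pi_apply j)).compl
    have h1 := hlaw (fun s => if s.Nodup then (0 : ℝ≥0∞) else 1) 1 one_ne_zero ENNReal.one_ne_top hQ
      fun z => by split_ifs <;> simp
    -- A repeated point gives two equal rows in the kernel matrix, so the density vanishes on the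
    -- diagonals and the points are almost surely distinct.
    have h2 : ∀ z : Fin n → ℂ, ENNReal.ofReal (c * detIntensity u z) *
        (if (Finset.univ.val.map z : Multiset ℂ).Nodup then (0 : ℝ≥0∞) else 1) = 0 := fun z => by
      split_ifs with h
      · simp
      · rw [detIntensity_eq_zero_of_not_injective, mul_zero, ENNReal.ofReal_zero, zero_mul]
        exact fun hz => h (Finset.univ.nodup.map hz)
    simp only [h2, lintegral_zero] at h1
    rw [lintegral_eq_zero_iff' (hX (Q := fun s => if s.Nodup then (0 : ℝ≥0∞) else 1) hQ)] at h1
    filter_upwards [h1] with ω hω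
    by_contra h
    simp [h] at hω
  · have hprod : ∀ z : Fin n → ℂ, ∏ i, (pointCount (Finset.univ.val.map z) (D i) : ℝ≥0∞) =
        ∑ f : Fin m ↪ Fin n, ∏ i, (D i).indicator 1 (z (f i)) := fun z =>
      prod_pointCount_map z hdisj
    have hg : Measurable fun x : Fin m → ℂ => ∏ i, (D i).indicator (1 : ℂ → ℝ≥0∞) (x i) :=
      Finset.measurable_prod _ fun i _ => (measurable_one.indicator (hD i)).comp
        (measurable_pi_apply i)
    have hgf : ∀ f : Fin m ↪ Fin n, Measurable fun z : Fin n → ℂ =>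
        ∏ i, (D i).indicator (1 : ℂ → ℝ≥0∞) (z (f i)) := fun f =>
      hg.comp (by fun_prop : Measurable fun (z : Fin n → ℂ) i => z (f i))
    have hQ : Measurable fun z : Fin n → ℂ =>
        ∏ i, (pointCount (Finset.univ.val.map z) (D i) : ℝ≥0∞) := by
      simp only [hprod]
      exact Finset.measurable_sum _ fun f _ => hgf f
    -- The bound uses `n + 1` instead of `n` so that it is nonzero also for `n = 0`.
    rw [hlaw (fun s => ∏ i, (pointCount s (D i) : ℝ≥0∞)) ((n + 1 : ℕ) ^ m : ℝ≥0∞) (by positivity)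
      (ENNReal.pow_ne_top (ENNReal.natCast_ne_top _)) hQ fun z => ?_]
    swap
    · calc ∏ i, (pointCount (Finset.univ.val.map z) (D i) : ℝ≥0∞)
          ≤ ∏ _i : Fin m, ((n + 1 : ℕ) : ℝ≥0∞) := by
            gcongr with i
            refine (pointCount_le_card _ _).trans ?_
            simp
        _ = _ := by simp
    have hR : ∫⁻ x in Set.pi Set.univ D, ((detIntensity u x).toNNReal : ℝ≥0∞) = ∫⁻ x : Fin m → ℂ, (∏ i, (D i).indicator 1 (x i)) * ENNReal.ofReal (detIntensity u x) := by
      rw [← lintegral_indicator (MeasurableSet.univ_pi hD)]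
      refine lintegral_congr fun x => ?_
      by_cases hx : x ∈ Set.pi Set.univ D
      · rw [Set.indicator_of_mem hx, Finset.prod_eq_one fun i _ => by
          simp [hx i (Set.mem_univ i)], one_mul, ENNReal.ofReal]
      · rw [Set.indicator_of_notMem hx]
        simp only [Set.mem_univ_pi, not_forall] at hx
        obtain ⟨i, hi⟩ := hx
        rw [Finset.prod_eq_zero (Finset.mem_univ i) (Set.indicator_of_notMem hi _), zero_mul]
    rw [hR]
    simp only [hprod]
    -- For `m > n` both sides vanish: there are no injective tuples, and the intensity is zero by
    -- the rank bound.
    rcases lt_or_ge n m with hm | hm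
    · have : IsEmpty (Fin m ↪ Fin n) := ⟨fun f => by
        have := Fintype.card_le_of_embedding f
        simp only [Fintype.card_fin] at this
        omega⟩
      simp [detIntensity_eq_zero_of_lt hm]
    -- The reference tuple consists of the last `m` coordinates, as `lintegral_mul_detIntensity`
    -- requires with `N = n`.
    let e : Fin m ↪ Fin n := ⟨fun i => ⟨n - m + i, by omega⟩, fun i j h => by
      simp only [Fin.mk.injEq] at h
      exact Fin.ext (by omega)⟩
    have hcm : Measurable fun z : Fin n → ℂ => ENNReal.ofReal (detIntensity u z) :=
      (hdm n).ennreal_ofReal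
    have hf : ∀ f : Fin m ↪ Fin n, ∫⁻ z : Fin n → ℂ, ENNReal.ofReal (detIntensity u z) *
        ∏ i, (D i).indicator 1 (z (f i)) =
        ((n - m)! : ℝ≥0∞) * ∫⁻ x : Fin m → ℂ, (∏ i, (D i).indicator 1 (x i)) *
          ENNReal.ofReal (detIntensity u x) := fun f => by
      obtain ⟨σ, hσ⟩ := exists_perm_comp_eq f e
      have h1 := (measurePreserving_comp_perm (volume : Measure ℂ) σ).lintegral_comp
        (hcm.mul (hgf e))
      rw [← hu.lintegral_mul_detIntensity hg hm le_rfl, Nat.sub_self, Nat.factorial_zero,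
        Nat.cast_one, one_mul]
      simp only [Pi.mul_apply, detIntensity_comp_perm, Function.comp_apply, hσ] at h1
      refine h1.trans (lintegral_congr fun z => mul_comm _ _)
    have hsum : ∀ z : Fin n → ℂ, ENNReal.ofReal (c * detIntensity u z) *
        ∑ f : Fin m ↪ Fin n, ∏ i, (D i).indicator 1 (z (f i)) = ENNReal.ofReal c *
        ∑ f : Fin m ↪ Fin n, ENNReal.ofReal (detIntensity u z) *
          ∏ i, (D i).indicator 1 (z (f i)) := fun z => by
      rw [ENNReal.ofReal_mul hc, mul_assoc, Finset.mul_sum]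
    rw [lintegral_congr hsum, lintegral_const_mul' _ _ ENNReal.ofReal_ne_top,
      lintegral_finsetSum (f := fun (f : Fin m ↪ Fin n) z => ENNReal.ofReal (detIntensity u z) *
        ∏ i, (D i).indicator 1 (z (f i))) _ fun f _ => hcm.mul (hgf f)]
    simp only [hf]
    rw [Finset.sum_const, Finset.card_univ, Fintype.card_embedding_eq, Fintype.card_fin,
      Fintype.card_fin, nsmul_eq_mul, ← mul_assoc, ← mul_assoc, mul_assoc (ENNReal.ofReal c),
      ← Nat.cast_mul, mul_comm (n.descFactorial m), Nat.factorial_mul_descFactorial hm, hcn, one_mul]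

end Determinantal

/-! ### The eigenvalue kernel from orthonormal monomials. -/

section Eigenvalues

variable {n k : ℕ}

/-- The normalized monomials, multiplied by the square root of the weight. -/
noncomputable def weightedMonomial (w : ℂ → ℝ) (l : Fin n) (z : ℂ) : ℂ :=
  z ^ (l : ℕ) * ((√(w z) * (√(∫ t : ℂ, ‖t‖ ^ (2 * (l : ℕ)) * w t))⁻¹ : ℝ) : ℂ)

theorem weightedMonomial_mul_conj {w : ℂ → ℝ} (hw : ∀ z, 0 ≤ w z) (l m : Fin n) (z : ℂ) :
    weightedMonomial w l z * starRingEnd ℂ (weightedMonomial w m z) =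
      ((w z : ℂ) * (z ^ (l : ℕ) * starRingEnd ℂ z ^ (m : ℕ))) *
        (((√(∫ t : ℂ, ‖t‖ ^ (2 * (l : ℕ)) * w t))⁻¹ *
          (√(∫ t : ℂ, ‖t‖ ^ (2 * (m : ℕ)) * w t))⁻¹ : ℝ) : ℂ) := by
  have h : (w z : ℂ) = (√(w z) : ℂ) * (√(w z) : ℂ) := by
    exact_mod_cast congrArg (fun t : ℝ => (t : ℂ)) (Real.mul_self_sqrt (hw z)).symm
  simp only [weightedMonomial, map_mul, map_pow, Complex.conj_ofReal]
  rw [h]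
  push_cast
  ring

theorem IsWeight.isOrthonormalSystem {ε : Fin (k + 1) → ℤ} (hε : ∀ j, ε j = 1 ∨ ε j = -1)
    {w : ℂ → ℝ} (hw : IsWeight n ε w) :
    IsOrthonormalSystem (weightedMonomial w : Fin n → ℂ → ℂ) where
  measurable l := by
    have := hw.measurable
    unfold weightedMonomial
    fun_prop
  integrable l m := by
    simp only [weightedMonomial_mul_conj hw.nonneg]
    refine Integrable.mul_const ?_ _
    have hm := hw.measurable
    -- The mixed moments are dominated through `|z|^l |z|^m ≤ |z|^(2l) + |z|^(2m)`.
    refine ((hw.integrable_norm_pow_mul hε l.2).add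
      (hw.integrable_norm_pow_mul hε m.2)).mono' ?_ (Filter.Eventually.of_forall fun z => ?_)
    · have : Measurable fun z : ℂ => starRingEnd ℂ z := Complex.continuous_conj.measurable
      exact (by fun_prop : Measurable fun z : ℂ =>
        (w z : ℂ) * (z ^ (l : ℕ) * starRingEnd ℂ z ^ (m : ℕ))).aestronglyMeasurable
    · rw [Pi.add_apply, norm_mul, norm_mul, norm_pow, norm_pow, RCLike.norm_conj,
        Complex.norm_real, Real.norm_of_nonneg (hw.nonneg z), ← add_mul, mul_comm]
      refine mul_le_mul_of_nonneg_right ?_ (hw.nonneg z)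
      nlinarith [sq_nonneg (‖z‖ ^ (l : ℕ) - ‖z‖ ^ (m : ℕ)), sq_nonneg (‖z‖ ^ (l : ℕ)),
        sq_nonneg (‖z‖ ^ (m : ℕ)), pow_mul' ‖z‖ 2 l, pow_mul' ‖z‖ 2 m]
  integral_eq l m := by
    simp only [weightedMonomial_mul_conj hw.nonneg]
    rw [integral_mul_const]
    split_ifs with h
    · subst h
      have hpos := hw.integral_norm_pow_mul_pos hε l.2
      have h1 : ∀ z : ℂ, (w z : ℂ) * (z ^ (l : ℕ) * starRingEnd ℂ z ^ (l : ℕ)) =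
          ((‖z‖ ^ (2 * (l : ℕ)) * w z : ℝ) : ℂ) := fun z => by
        rw [← mul_pow, Complex.mul_conj, Complex.normSq_eq_norm_sq]
        push_cast
        ring
      simp only [h1]
      rw [integral_complex_ofReal, ← Complex.ofReal_mul, ← mul_inv, Real.mul_self_sqrt hpos.le,
        mul_inv_cancel₀ hpos.ne', Complex.ofReal_one]
    · rw [hw.integral_pow_mul_conj_pow_eq_zero hε fun h' => h (Fin.ext h'), zero_mul]

/-- The matrix of values of the orthonormal functions is a Vandermonde matrix with rows scaled by
`√w` and columns scaled by the inverse norms; squaring the modulus of its determinant separates the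
three factors. -/
theorem IsWeight.prod_mul_detIntensity {ε : Fin k → ℤ} (hε : ∀ j, ε j = 1 ∨ ε j = -1)
    {w : ℂ → ℝ} (hw : IsWeight n ε w) (z : Fin n → ℂ) :
    (∏ l : Fin n, ∫ t : ℂ, ‖t‖ ^ (2 * (l : ℕ)) * w t) *
      detIntensity (weightedMonomial w : Fin n → ℂ → ℂ) z = (∏ l, w (z l)) * vandermondeSq z := by
  let s : Fin n → ℂ := fun i => (√(w (z i)) : ℝ)
  let t : Fin n → ℂ := fun l => ((√(∫ t : ℂ, ‖t‖ ^ (2 * (l : ℕ)) * w t))⁻¹ : ℝ)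
  have h : (Matrix.of fun i l => weightedMonomial w l (z i)) =
      Matrix.of fun i l => s i * (Matrix.of fun i l => t l * Matrix.vandermonde z i l) i l := by
    ext i l
    simp only [Matrix.of_apply, weightedMonomial, Matrix.vandermonde_apply, s, t]
    push_cast
    ring
  rw [detIntensity_eq_norm_sq, h, Matrix.det_mul_column, Matrix.det_mul_row, norm_mul, norm_mul,
    vandermondeSq_eq_norm_sq, mul_pow, mul_pow, norm_prod, norm_prod, ← Finset.prod_pow,
    ← Finset.prod_pow]
  have hs : ∀ i, ‖s i‖ ^ 2 = w (z i) := fun i => by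
    rw [Complex.norm_real, Real.norm_of_nonneg (Real.sqrt_nonneg _), Real.sq_sqrt (hw.nonneg _)]
  have ht : ∀ l : Fin n, (∫ t : ℂ, ‖t‖ ^ (2 * (l : ℕ)) * w t) * ‖t l‖ ^ 2 = 1 := fun l => by
    have hpos := hw.integral_norm_pow_mul_pos hε l.2
    rw [Complex.norm_real, Real.norm_of_nonneg (inv_nonneg.2 (Real.sqrt_nonneg _)), inv_pow,
      Real.sq_sqrt hpos.le, mul_inv_cancel₀ hpos.ne']
  simp only [hs]
  rw [mul_left_comm, ← mul_assoc (∏ l : Fin n, ∫ t : ℂ, _), ← Finset.prod_mul_distrib]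
  simp only [ht, Finset.prod_const_one, one_mul]

theorem IsIndepGinibre.exists_isDeterminantalPointProcess {Ω : Type*} [MeasurableSpace Ω]
    {P : Measure Ω} [IsProbabilityMeasure P] (hn : 1 ≤ n) {ε : Fin (k + 1) → ℤ}
    (hε : ∀ j, ε j = 1 ∨ ε j = -1) {A : Fin (k + 1) → Ω → Matrix (Fin n) (Fin n) ℂ}
    (hA : IsIndepGinibre P A) :
    ∃ K : ℂ → ℂ → ℂ, IsDeterminantalPointProcess P
      (fun ω => eigenvalueMultiset (signedProduct ε fun i => A i ω)) K := by
  obtain ⟨w, hw⟩ := exists_isWeight hn hε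
  obtain ⟨C, hC, h⟩ := hA.exists_lintegral_eigenvalues_eq hn hε hw
  refine ⟨_, isDeterminantalPointProcess_of_density (hw.isOrthonormalSystem hε)
    (fun hQ => hA.aemeasurable_eigenvalues hε hQ)
    (c := C * ∏ l : Fin n, ∫ t : ℂ, ‖t‖ ^ (2 * (l : ℕ)) * w t) ?_ fun Q b hb hb' hQ hQb => ?_⟩
  · exact mul_nonneg hC.le (Finset.prod_nonneg fun l _ =>
      (hw.integral_norm_pow_mul_pos hε l.2).le)
  · rw [h Q b hb hb' hQ hQb]
    simp only [mul_assoc C, hw.prod_mul_detIntensity hε]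

end Eigenvalues

theorem theorem1 {Ω : Type*} [MeasurableSpace Ω] (P : Measure Ω) [IsProbabilityMeasure P]
    (n k : ℕ) (hn : 1 ≤ n) (hk : 1 ≤ k)
    (ε : Fin k → ℤ) (hε : ∀ i, ε i = 1 ∨ ε i = -1)
    (A : Fin k → Ω → Matrix (Fin n) (Fin n) ℂ) (hA : IsIndepGinibre P A) :
    (∃ w : ℂ → ℝ, IsWeight n ε w) ∧
    (∀ w : ℂ → ℝ, IsWeight n ε w →
      ∃ C : ℝ, 0 < C ∧
        HasEigenvalueDensity P (fun ω => signedProduct ε fun i => A i ω)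
          (fun z => C * ((∏ l, w (z l)) * ∏ i, ∏ j ∈ Finset.Ioi i, ‖z i - z j‖ ^ 2))) ∧
    (∃ K : ℂ → ℂ → ℂ,
      IsDeterminantalPointProcess P
        (fun ω => eigenvalueMultiset (signedProduct ε fun i => A i ω)) K) := by
  -- Writing the number of factors as a successor makes the cyclic addition on `Fin (k + 1)`
  -- available.
  obtain ⟨k, rfl⟩ := Nat.exists_eq_succ_of_ne_zero (Nat.one_le_iff_ne_zero.1 hk)
  exact ⟨exists_isWeight hn hε, fun w hw => hA.exists_hasEigenvalueDensity hn hε hw,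
    hA.exists_isDeterminantalPointProcess hn hε⟩
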